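/- Let $M$ be a nonempty compact (Hausdorff) smooth manifold without boundary, let $G$ be a Lie group of dimension $q$ with Lie algebra $\mathcal LG$ and derived algebra $D\mathcal LG=[\mathcal LG,\mathcal LG]$, and let $\mathcal F$ be a smooth foliation of codimension $q$ on $M$ which admits a $G$-transversal structure: there are an open cover $\{U_i\}$ of $M$, submersions $f_i\colon U_i\to G$ such that $\mathcal F|_{U_i}$ is given by $f_i=\text{constant}$, and locally constant maps $\gamma_{ij}$ from $U_i\cap U_j$ to the left translations of $G$ such that $f_i(x)=\gamma_{ij}(x)\cdot f_j(x)$ for all $x\in U_i\cap U_j$. Let $d=\dim H^1_{dR}(M)$. (i) If $d\le\dim\mathcal LG-\dim D\mathcal LG$, then $d=\dim\mathcal LG-\dim D\mathcal LG$, and there is a smooth locally trivial fibration $f\colon M\to\mathbb T^d$ over the $d$-dimensional torus such that every leaf of $\mathcal F$ is contained in a fibre of $f$. (ii) In particular, if $\mathcal LG$ is abelian, $d\le\dim\mathcal LG$, and $M$ is connected (this only has to be assumed when $\dim G=0$), then $\mathcal F$ is a fibration over a torus: there is a smooth locally trivial fibration $f\colon M\to\mathbb T^d$ whose fibres are exactly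 the leaves of $\mathcal F$. -/

import Mathlib

open scoped Manifold ContDiff

/-! ### The Lie algebra of a smooth Lie group -/

/-- A `C^∞` Lie group is smooth enough for Mathlib's Lie algebra structure on `T_1 G`. -/
instance leInfty_minSmoothness_three : ENat.LEInfty (minSmoothness ℝ 3) :=
  ⟨by rw [minSmoothness_of_isRCLikeNormedField]; exact ENat.LEInfty.out⟩

/-! ### First de Rham cohomology -/

section DeRham

variable (n : ℕ) (M : Type*) [TopologicalSpace M] [ChartedSpace (EuclideanSpace ℝ (Fin n)) M]
  [IsManifold (𝓡 n) ∞ M]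

/-- Smooth real-valued differential one-forms on `M`: smooth sections of the cotangent bundle. -/
abbrev OneForm : Type _ :=
  ContMDiffSection (𝓡 n) (EuclideanSpace ℝ (Fin n) →L[ℝ] ℝ) ∞
    (fun x : M => TangentSpace (𝓡 n) x →L[ℝ] Bundle.Trivial M ℝ x)

variable {n M}

/-- The expression of the one-form `α` in the preferred chart `φ` at `x₀`, that is, the pull-back
`(φ⁻¹)^* α`, a one-form on the open subset `φ.target` of `ℝⁿ`. -/
noncomputable def OneForm.inChart (α : OneForm n M) (x₀ : M) (e : EuclideanSpace ℝ (Fin n)) :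
    EuclideanSpace ℝ (Fin n) →L[ℝ] ℝ :=
  (show TangentSpace (𝓡 n) ((extChartAt (𝓡 n) x₀).symm e) →L[ℝ] ℝ from
    α ((extChartAt (𝓡 n) x₀).symm e)).comp
  (mfderiv 𝓘(ℝ, EuclideanSpace ℝ (Fin n)) (𝓡 n) (extChartAt (𝓡 n) x₀).symm e)

/-- `dα = 0`: in every preferred chart the expression `η` of `α` satisfies
`dη_e (v, w) = (D η_e v) w - (D η_e w) v = 0`. -/
def OneForm.IsClosed (α : OneForm n M) : Prop :=
  ∀ x₀ : M, ∀ e ∈ (extChartAt (𝓡 n) x₀).target, ∀ v w : EuclideanSpace ℝ (Fin n),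
    fderiv ℝ (α.inChart x₀) e v w = fderiv ℝ (α.inChart x₀) e w v

/-- `α = df` for some smooth function `f`. -/
def OneForm.IsExact (α : OneForm n M) : Prop :=
  ∃ f : M → ℝ, ContMDiff (𝓡 n) 𝓘(ℝ, ℝ) ∞ f ∧
    ∀ (x : M) (v : TangentSpace (𝓡 n) x), α x v = mfderiv (𝓡 n) 𝓘(ℝ, ℝ) f x v

theorem OneForm.contDiffOn_inChart (α : OneForm n M) (x₀ : M) :
    ContDiffOn ℝ ∞ (α.inChart x₀) (extChartAt (𝓡 n) x₀).target := by
  rw [contDiffOn_clm_apply]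
  intro v
  have hφ := contMDiffOn_extChartAt_symm (I := 𝓡 n) (n := ∞) x₀
  have hopen := isOpen_extChartAt_target (I := 𝓡 n) x₀
  have hT := hφ.contMDiffOn_tangentMapWithin (m := ∞) (by simp) hopen.uniqueMDiffOn
  have hv : ContMDiff 𝓘(ℝ, EuclideanSpace ℝ (Fin n)) 𝓘(ℝ, EuclideanSpace ℝ (Fin n)).tangent ∞
      (fun e : EuclideanSpace ℝ (Fin n) => (⟨e, v⟩ : TangentBundle 𝓘(ℝ, EuclideanSpace ℝ (Fin n))
        (EuclideanSpace ℝ (Fin n)))) := by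
    intro e
    rw [Bundle.contMDiffAt_totalSpace]
    refine ⟨contMDiffAt_id, ?_⟩
    simpa using contMDiffAt_const
  have hw := hT.comp (s := (extChartAt (𝓡 n) x₀).target) hv.contMDiffOn (fun e he => he)
  have hα := α.contMDiff.comp_contMDiffOn hφ
  have key := ContMDiffOn.clm_bundle_apply (b := (extChartAt (𝓡 n) x₀).symm)
    (ϕ := fun e => α ((extChartAt (𝓡 n) x₀).symm e))
    (v := fun e => mfderivWithin 𝓘(ℝ, EuclideanSpace ℝ (Fin n)) (𝓡 n) (extChartAt (𝓡 n) x₀).symm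
      (extChartAt (𝓡 n) x₀).target e v) hα hw
  rw [← contMDiffOn_iff_contDiffOn]
  intro e he
  have := key e he
  rw [Bundle.contMDiffWithinAt_totalSpace] at this
  refine this.2.congr (fun y hy => ?_) ?_
  all_goals
    simp only [OneForm.inChart]
    rw [mfderivWithin_of_isOpen hopen ‹_›]
    rfl

variable (n M)

/-- The vector space of closed smooth one-forms on `M`. -/
def closedOneForms : Submodule ℝ (OneForm n M) where
  carrier := {α | α.IsClosed}
  zero_mem' := by
    intro x₀ e he v w
    have : (0 : OneForm n M).inChart x₀ = 0 := by
      funext e; ext v; rfl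
    simp [this]
  add_mem' := by
    intro α η hα hη x₀ e he v w
    have hopen := isOpen_extChartAt_target (I := 𝓡 n) x₀
    have h1 := ((α.contDiffOn_inChart x₀).contDiffAt (hopen.mem_nhds he)).differentiableAt
      (by simp)
    have h2 := ((η.contDiffOn_inChart x₀).contDiffAt (hopen.mem_nhds he)).differentiableAt
      (by simp)
    have h : (α + η).inChart x₀ = α.inChart x₀ + η.inChart x₀ := by
      funext e; ext v; rfl
    rw [h, fderiv_add h1 h2]
    simp [hα x₀ e he v w, hη x₀ e he v w]
  smul_mem' := by
    intro c α hα x₀ e he v w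
    have hopen := isOpen_extChartAt_target (I := 𝓡 n) x₀
    have h1 := ((α.contDiffOn_inChart x₀).contDiffAt (hopen.mem_nhds he)).differentiableAt
      (by simp)
    have h : (c • α).inChart x₀ = c • α.inChart x₀ := by
      funext e; ext v; rfl
    rw [h, fderiv_const_smul h1]
    simp [hα x₀ e he v w]

/-- The vector space of exact smooth one-forms on `M`. -/
def exactOneForms : Submodule ℝ (OneForm n M) where
  carrier := {α | α.IsExact}
  zero_mem' := ⟨fun _ => 0, contMDiff_const, fun x v => by
    rw [mfderiv_const]; rfl⟩
  add_mem' := by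
    rintro α η ⟨f, hf, hαf⟩ ⟨g, hg, hηg⟩
    refine ⟨f + g, hf.add hg, fun x v => ?_⟩
    rw [mfderiv_add (hf.mdifferentiable (by simp) x) (hg.mdifferentiable (by simp) x)]
    exact congrArg₂ (· + ·) (hαf x v) (hηg x v)
  smul_mem' := by
    rintro c α ⟨f, hf, hαf⟩
    refine ⟨c • f, (contDiff_const_smul c).contMDiff.comp hf, fun x v => ?_⟩
    rw [const_smul_mfderiv (hf.mdifferentiable (by simp) x)]
    exact congrArg (c • ·) (hαf x v)

theorem exactOneForms_le_closedOneForms : exactOneForms n M ≤ closedOneForms n M := by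
  rintro α ⟨f, hf, hα⟩ x₀ e he v w
  have hφ := contMDiffOn_extChartAt_symm (I := 𝓡 n) (n := ∞) x₀
  have hopen := isOpen_extChartAt_target (I := 𝓡 n) x₀
  have hg : ContDiffOn ℝ ∞ (f ∘ (extChartAt (𝓡 n) x₀).symm) (extChartAt (𝓡 n) x₀).target := by
    rw [← contMDiffOn_iff_contDiffOn]; exact hf.comp_contMDiffOn hφ
  have heq : ∀ y ∈ (extChartAt (𝓡 n) x₀).target, α.inChart x₀ y = fderiv ℝ (f ∘ (extChartAt (𝓡 n) x₀).symm) y := by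
    intro y hy
    ext u
    have h1 := ((hφ y hy).contMDiffAt (hopen.mem_nhds hy)).mdifferentiableAt (by simp)
    have := mfderiv_comp_apply y (hf.mdifferentiable (by simp) _) h1 u
    rw [mfderiv_eq_fderiv] at this
    exact (hα _ _).trans this.symm
  have h2 : α.inChart x₀ =ᶠ[nhds e] fderiv ℝ (f ∘ (extChartAt (𝓡 n) x₀).symm) := by
    filter_upwards [hopen.mem_nhds he] with y hy using heq y hy
  rw [h2.fderiv_eq]
  have := (hg.contDiffAt (hopen.mem_nhds he)).isSymmSndFDerivAt (by
    rw [minSmoothness_of_isRCLikeNormedField]; exact ENat.LEInfty.out)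
  exact this.eq v w

/-- The first de Rham cohomology `H¹_dR(M)`: closed one-forms modulo exact one-forms. -/
abbrev DeRhamH1 : Type _ :=
  closedOneForms n M ⧸ (exactOneForms n M).submoduleOf (closedOneForms n M)

end DeRham

/-! ### Foliations and their leaves -/

section Foliation

variable {n : ℕ} {M : Type*} [TopologicalSpace M] [ChartedSpace (EuclideanSpace ℝ (Fin n)) M]

/-- `f` restricts to a smooth submersion of the open set `U ⊆ M` to the `k`-dimensional manifold
`N`, and the tangent spaces to its level sets are the spaces `D x`. -/
structure IsSubmersionWithKernel {k : ℕ} {N : Type*} [TopologicalSpace N]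
    [ChartedSpace (EuclideanSpace ℝ (Fin k)) N] (D : ∀ x : M, Submodule ℝ (TangentSpace (𝓡 n) x))
    (U : Set M) (f : M → N) : Prop where
  isOpen : IsOpen U
  contMDiffOn : ContMDiffOn (𝓡 n) (𝓡 k) ∞ f U
  surjective : ∀ x ∈ U, Function.Surjective (mfderiv (𝓡 n) (𝓡 k) f x)
  ker_eq : ∀ x ∈ U, (mfderiv (𝓡 n) (𝓡 k) f x).toLinearMap.ker = D x

variable (n M) in
/-- A smooth foliation of codimension `q` of the `n`-manifold `M`, given by its tangent bundle: a
field of tangent subspaces which near every point consists of the tangent spaces to the level sets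
of a smooth submersion to `ℝ^q` (i.e. an integrable subbundle of corank `q`). -/
structure Foliation (q : ℕ) where
  tangent : ∀ x : M, Submodule ℝ (TangentSpace (𝓡 n) x)
  integrable : ∀ x : M, ∃ U : Set M, x ∈ U ∧
    ∃ s : M → EuclideanSpace ℝ (Fin q), IsSubmersionWithKernel (k := q) tangent U s

variable {q : ℕ}

/-- `x` and `y` are joined by a smooth path everywhere tangent to the foliation. -/
def Foliation.JoinedByTangentPath (F : Foliation n M q) (x y : M) : Prop :=
  ∃ γ : ℝ → M, ContMDiffOn 𝓘(ℝ, ℝ) (𝓡 n) ∞ γ (Set.Icc 0 1) ∧ γ 0 = x ∧ γ 1 = y ∧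
    ∀ t ∈ Set.Icc (0 : ℝ) 1,
      mfderivWithin 𝓘(ℝ, ℝ) (𝓡 n) γ (Set.Icc 0 1) t (1 : ℝ) ∈ F.tangent (γ t)

/-- The leaf through `x`: all points that can be reached from `x` by a piecewise smooth path
tangent to the foliation. -/
def Foliation.leaf (F : Foliation n M q) (x : M) : Set M :=
  {y | Relation.ReflTransGen F.JoinedByTangentPath x y}

/-- A `G`-transversal structure (a Lie transverse structure of model `G`) for a foliation `F` of
codimension `dim G`: an open cover `U i` of `M` with submersions `f i : U i → G` such that `F` is
given by `f i = constant` on `U i`, and locally constant maps `γ i j` from `U i ∩ U j` to the left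
translations of `G` (identified with `G`) such that `f i = γ i j * f j` on `U i ∩ U j`. -/
structure GTransversalStructure (F : Foliation n M q) (G : Type*) [TopologicalSpace G] [Group G]
    [ChartedSpace (EuclideanSpace ℝ (Fin q)) G] (ι : Type*) where
  U : ι → Set M
  f : ι → M → G
  γ : ι → ι → M → G
  cover : ∀ x : M, ∃ i, x ∈ U i
  submersion : ∀ i, IsSubmersionWithKernel (k := q) F.tangent (U i) (f i)
  locallyConstant : ∀ i j, IsLocallyConstant (fun x : ↥(U i ∩ U j) => γ i j x)
  compatible : ∀ i j, ∀ x ∈ U i ∩ U j, f i x = γ i j x * f j x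

end Foliation

/-! ### Smooth fibrations over a torus -/

/-- The `d`-dimensional torus, as the product of `d` circles with its product manifold
structure. -/
abbrev Torus (d : ℕ) : Type := Fin d → Circle

/-- The model with corners of the product manifold `Torus d`. -/
noncomputable abbrev torusModel (d : ℕ) :
    ModelWithCorners ℝ (Fin d → EuclideanSpace ℝ (Fin 1))
      (ModelPi fun _ : Fin d => EuclideanSpace ℝ (Fin 1)) :=
  ModelWithCorners.pi fun _ : Fin d => 𝓡 1

/-- `f : M → T^d` is a smooth fibration, that is, a smooth locally trivial fibre bundle whose
typical fibre is a smooth manifold `L`: near each point of the torus there is a local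
trivialization `f ⁻¹ V ≃ V × L` over `V` that is smooth with smooth inverse. (If `M` is nonempty,
then so is `L`, and `f` is a surjective submersion.) -/
def IsSmoothTorusFibration.{u} {n : ℕ} {M : Type u} [TopologicalSpace M]
    [ChartedSpace (EuclideanSpace ℝ (Fin n)) M] {d : ℕ} (f : M → Torus d) : Prop :=
  ∃ (k : ℕ) (L : Type u) (_ : TopologicalSpace L) (_ : ChartedSpace (EuclideanSpace ℝ (Fin k)) L)
    (_ : IsManifold (𝓡 k) ∞ L), ∀ b : Torus d, ∃ e : Bundle.Trivialization L f, b ∈ e.baseSet ∧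
      ContMDiffOn (𝓡 n) ((torusModel d).prod (𝓡 k)) ∞ e e.source ∧
      ContMDiffOn ((torusModel d).prod (𝓡 k)) (𝓡 n) ∞ e.toOpenPartialHomeomorph.symm e.target

section

open Filter Topology Set

/-! ### The inverse function theorem with smooth inverse -/

-- Linear maps on the Lie algebra that vanish on brackets are the closed left-invariant one-forms on
-- `G`. Taking coordinates on the abelianization gives one such map `p` onto ℝ^c, where c is the
-- dimension of the Lie algebra minus that of its derived algebra. Left invariance makes the
-- pull-backs along the local submersions agree, so `M` carries a locally exact ℝ^c-valued form `α`,
-- surjective at each point and zero on the tangent spaces of the foliation; in the abelian case its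
-- kernel is exactly the tangent space. If `l ∘ α = du` on the compact `M`, then `l ∘ α` vanishes at
-- a maximum of `u`, so `l = 0`. Hence the components of `α` are independent in cohomology and c ≤ d
-- (`IsLocallyExact.le_of_rank_eq`). The hypothesis of the theorem gives d ≤ c, so they form a
-- basis.
--
-- Now let c = d and `M` be connected. The group of periods of `α` is finitely generated
-- (`IsLocallyExact.periods_fg`), no nonzero linear functional kills it
-- (`IsLocallyExact.eq_zero_of_periods`), and every additive function on it is linear
-- (`IsLocallyExact.exists_clm_eq_on_periods`), because such a function is realized by the periods
-- of a closed form, which is cohomologous to some `l ∘ α`. These properties make it a lattice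
-- (`exists_equiv_mem_iff_int`). Integrating `α` modulo the lattice gives a submersion `f` to the
-- torus whose fibres contain the leaves (`IsLocallyExact.exists_isLocalLift`). Connectedness of `M`
-- is automatic for c > 0 (`IsLocallyExact.preconnectedSpace`).
--
-- Submersions of compact manifolds to the torus are locally trivial
-- (`IsTorusSubmersion.isSmoothTorusFibration`). Instead of flows, the proof composes finitely many
-- cut-off moves in charts into a smooth family of maps lifting the small translations of the torus,
-- and iterates this family to reach translations of any size.
--
-- For the equality of leaves and fibres, the fibres must be connected. The lifted translations
-- induce an action of ℝ^d on the path classes of the fibres, and moving along `M` changes the class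
-- by the integral of the form. Two points of one fibre can be joined with integral zero, after
-- inserting a loop with the right period, so they have the same class
-- (`IsTorusSubmersion.reflTransGen_joinedByFibrePath`).

theorem exists_openPartialHomeomorph_contDiffOn {E F : Type*} [NormedAddCommGroup E]
    [NormedSpace ℝ E] [CompleteSpace E] [NormedAddCommGroup F] [NormedSpace ℝ F]
    {f : E → F} {s : Set E} (hs : IsOpen s) {x : E} (hx : x ∈ s) (hf : ContDiffOn ℝ ∞ f s)
    (f' : E ≃L[ℝ] F) (hf' : HasFDerivAt f (f' : E →L[ℝ] F) x) :
    ∃ e : OpenPartialHomeomorph E F, x ∈ e.source ∧ e.source ⊆ s ∧ ⇑e = f ∧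
      ContDiffOn ℝ ∞ e.symm e.target := by
  have hat : ∀ y ∈ s, ContDiffAt ℝ ∞ f y := fun y hy => hf.contDiffAt (hs.mem_nhds hy)
  set e₀ := (hat x hx).toOpenPartialHomeomorph f hf' (by simp) with he₀
  have hcont : ContinuousOn (fderiv ℝ f) s := hf.continuousOn_fderiv_of_isOpen hs (by simp)
  -- The local inverse is smooth at the image of any point with invertible derivative. These points
  -- form an open set, and restricting to it gives smoothness on the whole target.
  set t := s ∩ fderiv ℝ f ⁻¹' (range ((↑) : (E ≃L[ℝ] F) → E →L[ℝ] F)) with ht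
  have hto : IsOpen t := hcont.isOpen_inter_preimage hs ContinuousLinearEquiv.isOpen
  have hxt : x ∈ t := ⟨hx, f', hf'.fderiv.symm⟩
  refine ⟨e₀.restrOpen t hto, ⟨(hat x hx).mem_toOpenPartialHomeomorph_source hf' (by simp), hxt⟩,
    fun y hy => hy.2.1, rfl, fun z hz => ?_⟩
  set e := e₀.restrOpen t hto
  have hy : e.symm z ∈ t := (e.map_target hz).2
  obtain ⟨g, hg⟩ := hy.2
  refine (e.contDiffAt_symm hz (f₀' := g) ?_ (hat _ hy.1)).contDiffWithinAt
  rw [hg]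
  exact ((hat _ hy.1).differentiableAt (by simp)).hasFDerivAt

/-! ### The torus -/

section Torus

variable {E H N : Type*} [NormedAddCommGroup E] [NormedSpace ℝ E] [TopologicalSpace H]
  {I : ModelWithCorners ℝ E H} [TopologicalSpace N] [ChartedSpace H N] {d : ℕ} {m : WithTop ℕ∞}

theorem contMDiffWithinAt_torus {f : N → Torus d} {s : Set N} {x : N}
    (h : ∀ j, ContMDiffWithinAt I (𝓡 1) m (fun y => f y j) s x) :
    ContMDiffWithinAt I (torusModel d) m f s x := by
  rw [contMDiffWithinAt_iff_target]
  refine ⟨continuousWithinAt_pi.2 fun j => (h j).continuousWithinAt, ?_⟩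
  rw [contMDiffWithinAt_pi_space]
  exact fun j => (contMDiffWithinAt_iff_target.1 (h j)).2

theorem contMDiff_torus_apply (j : Fin d) :
    ContMDiff (torusModel d) (𝓡 1) m (fun b : Torus d => b j) := by
  intro b
  rw [contMDiffAt_iff]
  refine ⟨(continuous_apply j).continuousAt, ?_⟩
  have h : ContDiffWithinAt ℝ m (fun v : Fin d → EuclideanSpace ℝ (Fin 1) => v j)
      (range (torusModel d)) (extChartAt (torusModel d) b b) :=
    (contDiff_apply ℝ _ j).contDiffWithinAt
  refine h.congr_of_eventuallyEq ?_ ?_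
  · refine Filter.mem_of_superset (extChartAt_target_mem_nhdsWithin b) fun v hv => ?_
    have : v j ∈ (extChartAt (𝓡 1) (b j)).target := by
      have h1 := (extChartAt (torusModel d) b).map_target hv
      have h2 : extChartAt (torusModel d) b ((extChartAt (torusModel d) b).symm v) = v :=
        (extChartAt (torusModel d) b).right_inv hv
      have h3 : (extChartAt (torusModel d) b).symm v j ∈ (extChartAt (𝓡 1) (b j)).source := by
        rw [extChartAt_source] at h1 ⊢
        exact h1 j (mem_univ j)
      rw [← h2]
      exact (extChartAt (𝓡 1) (b j)).map_source h3
    exact (extChartAt (𝓡 1) (b j)).right_inv this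
  · exact (extChartAt (𝓡 1) (b j)).right_inv
      ((extChartAt (𝓡 1) (b j)).map_source (mem_extChartAt_source _))

/-- The universal covering `ℝ^d → 𝕋^d`. -/
noncomputable def torusExp (v : Fin d → ℝ) : Torus d := fun j => Circle.exp (v j)

theorem torusExp_add (v w : Fin d → ℝ) : torusExp (v + w) = torusExp v * torusExp w := by
  funext j; exact Circle.exp_add _ _

theorem torusExp_zero : torusExp (0 : Fin d → ℝ) = 1 := by
  funext j; exact Circle.exp_zero

theorem torusExp_sub (v w : Fin d → ℝ) : torusExp (v - w) = torusExp v / torusExp w := by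
  funext j; exact Circle.exp_sub _ _

/-- The principal branch of the logarithm on the torus. -/
noncomputable def torusLog (b : Torus d) : Fin d → ℝ := fun j => Complex.arg (b j)

theorem torusExp_torusLog (b : Torus d) : torusExp (torusLog b) = b := by
  funext j; exact Circle.exp_arg _

theorem torusLog_torusExp {v : Fin d → ℝ} (hv : ‖v‖ < Real.pi) : torusLog (torusExp v) = v := by
  funext j
  have := (norm_le_pi_norm v j).trans_lt hv
  rw [Real.norm_eq_abs, abs_lt] at this
  exact Circle.arg_exp this.1 this.2.le

theorem norm_torusLog_le (b : Torus d) : ‖torusLog b‖ ≤ Real.pi := by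
  rw [pi_norm_le_iff_of_nonneg Real.pi_pos.le]
  exact fun j => Complex.abs_arg_le_pi _

/-- The domain on which the principal branch of the logarithm is smooth. -/
def torusSlit (d : ℕ) : Set (Torus d) := {b | ∀ j, (b j : ℂ) ∈ Complex.slitPlane}

theorem isOpen_torusSlit : IsOpen (torusSlit d) := by
  have : torusSlit d = ⋂ j, (fun b : Torus d => (b j : ℂ)) ⁻¹' Complex.slitPlane := by
    ext b; simp [torusSlit]
  rw [this]
  exact isOpen_iInter_of_finite fun j =>
    Complex.isOpen_slitPlane.preimage (continuous_subtype_val.comp (continuous_apply j))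

theorem one_mem_torusSlit : (1 : Torus d) ∈ torusSlit d := fun j => by
  simp [Complex.one_mem_slitPlane]

theorem contMDiffOn_torusLog :
    ContMDiffOn (torusModel d) 𝓘(ℝ, Fin d → ℝ) ∞ torusLog (torusSlit d) := by
  intro b hb
  rw [contMDiffWithinAt_pi_space]
  intro j
  have := finrank_real_complex_fact'
  have h1 : ContMDiffAt (torusModel d) 𝓘(ℝ, ℂ) ∞ (fun c : Torus d => (c j : ℂ)) b :=
    (contMDiff_coe_sphere (E := ℂ) (n := 1) (m := ∞)).contMDiffAt.comp b
      (contMDiff_torus_apply j).contMDiffAt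
  have h2 : ContMDiffAt 𝓘(ℝ, ℂ) 𝓘(ℝ, ℝ) ∞ (fun z : ℂ => (Complex.log z).im) (b j : ℂ) := by
    rw [contMDiffAt_iff_contDiffAt]
    exact Complex.imCLM.contDiff.contDiffAt.comp _
      ((Complex.contDiffAt_log (hb j)).restrict_scalars ℝ)
  have := h2.comp b h1
  refine this.contMDiffWithinAt.congr (fun c _ => ?_) ?_ <;> simp [torusLog, Complex.log_im]

theorem ContMDiffWithinAt.torusExp {h : N → Fin d → ℝ} {s : Set N} {x : N}
    (hh : ContMDiffWithinAt I 𝓘(ℝ, Fin d → ℝ) m h s x) :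
    ContMDiffWithinAt I (torusModel d) m (fun y => _root_.torusExp (h y)) s x :=
  contMDiffWithinAt_torus fun j =>
    (contMDiff_circleExp (m := m)).contMDiffAt.comp_contMDiffWithinAt x
      (contMDiffWithinAt_pi_space.1 hh j)

end Torus

end

section

open Filter Topology Set

-- Charts adapted to a submersion to the torus.

section Lift

variable {n d : ℕ} {M : Type*} [TopologicalSpace M] [ChartedSpace (EuclideanSpace ℝ (Fin n)) M]

/-- `h` is a smooth submersion `U → ℝ^d` lifting `f` to the universal covering of the torus. -/
structure IsLocalLift (f : M → Torus d) (U : Set M) (h : M → Fin d → ℝ) : Prop where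
  isOpen : IsOpen U
  contMDiffOn : ContMDiffOn (𝓡 n) 𝓘(ℝ, Fin d → ℝ) ∞ h U
  eq_torusExp : ∀ x ∈ U, f x = torusExp (h x)
  surjective : ∀ x ∈ U, Function.Surjective (mfderiv (𝓡 n) 𝓘(ℝ, Fin d → ℝ) h x)

/-- `f` is a smooth submersion to the torus. -/
def IsTorusSubmersion (f : M → Torus d) : Prop :=
  ∀ x, ∃ U h, x ∈ U ∧ IsLocalLift (n := n) f U h

/-- `φ` is a smooth chart in which the submersion `f` is the projection to the first factor. -/
structure IsAdaptedChart (f : M → Torus d)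
    (φ : OpenPartialHomeomorph M ((Fin d → ℝ) × EuclideanSpace ℝ (Fin (n - d)))) : Prop where
  contMDiffOn : ContMDiffOn (𝓡 n) 𝓘(ℝ, (Fin d → ℝ) × EuclideanSpace ℝ (Fin (n - d))) ∞ φ φ.source
  contMDiffOn_symm :
    ContMDiffOn 𝓘(ℝ, (Fin d → ℝ) × EuclideanSpace ℝ (Fin (n - d))) (𝓡 n) ∞ φ.symm φ.target
  eq_torusExp : ∀ x ∈ φ.source, f x = torusExp (φ x).1

/-- The difference has norm below 2 < π, where `torusLog` inverts `torusExp`. This is why adapted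
charts have balls of radius at most 1 as targets. -/
theorem torusExp_inj_of_mem_ball {v w c : Fin d → ℝ} {r : ℝ} (hr : r ≤ 1)
    (hv : v ∈ Metric.ball c r) (hw : w ∈ Metric.ball c r) (h : torusExp v = torusExp w) :
    v = w := by
  have h1 : ‖v - w‖ < Real.pi := by
    rw [← dist_eq_norm]
    have := dist_triangle_right v w c
    rw [Metric.mem_ball] at hv hw
    linarith [Real.pi_gt_three]
  have h2 := torusLog_torusExp h1
  rw [torusExp_sub, h, div_self', ← torusExp_zero, torusLog_torusExp (by simp [Real.pi_pos])] at h2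
  exact (sub_eq_zero.1 h2.symm)

theorem exists_equiv_prod_of_surjective {A : EuclideanSpace ℝ (Fin n) →L[ℝ] (Fin d → ℝ)}
    (hA : Function.Surjective A) :
    ∃ p : EuclideanSpace ℝ (Fin n) →L[ℝ] EuclideanSpace ℝ (Fin (n - d)),
      ∃ e : EuclideanSpace ℝ (Fin n) ≃L[ℝ] (Fin d → ℝ) × EuclideanSpace ℝ (Fin (n - d)),
        (e : EuclideanSpace ℝ (Fin n) →L[ℝ] _) = A.prod p := by
  obtain ⟨P, hP⟩ := Submodule.ClosedComplemented.of_finiteDimensional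
    A.toLinearMap.ker
  have hrank := LinearMap.finrank_range_add_finrank_ker A.toLinearMap
  rw [LinearMap.range_eq_top.2 hA, finrank_top] at hrank
  simp only [Module.finrank_fintype_fun_eq_card, Fintype.card_fin, finrank_euclideanSpace] at hrank
  -- Surjectivity forces d ≤ n, so `n - d` is a genuine difference.
  have hk : Module.finrank ℝ A.toLinearMap.ker =
      Module.finrank ℝ (EuclideanSpace ℝ (Fin (n - d))) := by
    rw [finrank_euclideanSpace, Fintype.card_fin]; omega
  let ι := ContinuousLinearEquiv.ofFinrankEq hk
  let p := (ι : A.toLinearMap.ker →L[ℝ] EuclideanSpace ℝ (Fin (n - d))).comp P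
  have hPs : Function.Surjective P := fun y => ⟨y, hP y⟩
  have hc : IsCompl A.toLinearMap.ker p.toLinearMap.ker := by
    have h1 : p.toLinearMap.ker = P.toLinearMap.ker := by
      ext x; simp [p]
    rw [h1]
    exact LinearMap.isCompl_of_proj hP
  refine ⟨p, ContinuousLinearMap.equivProdOfSurjectiveOfIsCompl A p
    (LinearMap.range_eq_top.2 hA) (LinearMap.range_eq_top.2 (ι.surjective.comp hPs)) hc, rfl⟩

variable [IsManifold (𝓡 n) ∞ M]

/-- In a chart of `M`, a local lift `h` is completed by a linear map `p` to a map with bijective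
derivative, and the inverse function theorem applies. The target is cut down to a ball, which for
the sup norm is a product of balls. -/
theorem IsTorusSubmersion.exists_isAdaptedChart {f : M → Torus d}
    (hf : IsTorusSubmersion (n := n) f) (x : M) {W : Set M} (hW : W ∈ 𝓝 x) :
    ∃ φ : OpenPartialHomeomorph M ((Fin d → ℝ) × EuclideanSpace ℝ (Fin (n - d))), ∃ r : ℝ,
      0 < r ∧ r ≤ 1 ∧ x ∈ φ.source ∧ φ.source ⊆ W ∧ φ.target = Metric.ball (φ x) r ∧
        IsAdaptedChart (n := n) f φ := by
  obtain ⟨U, h, hxU, hU⟩ := hf x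
  set c := chartAt (EuclideanSpace ℝ (Fin n)) x with hc
  have hcs : ContMDiffOn (𝓡 n) (𝓡 n) ∞ c.symm c.target := contMDiffOn_chart_symm
  have hcc : ContMDiffOn (𝓡 n) (𝓡 n) ∞ c c.source := contMDiffOn_chart
  have hxc : x ∈ c.source := mem_chart_source _ x
  have hsymm : c.symm (c x) = x := c.left_inv hxc
  set s := c.target ∩ c.symm ⁻¹' U with hs
  have hso : IsOpen s := c.isOpen_inter_preimage_symm hU.isOpen
  have hxs : c x ∈ s := ⟨c.map_source hxc, by rwa [mem_preimage, hsymm]⟩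
  have hcomp : ContDiffOn ℝ ∞ (h ∘ c.symm) s := by
    rw [← contMDiffOn_iff_contDiffOn]
    exact hU.contMDiffOn.comp (hcs.mono inter_subset_left) fun y hy => hy.2
  set A := fderiv ℝ (h ∘ c.symm) (c x) with hA
  have hAs : Function.Surjective A := by
    have h1 : MDifferentiableAt (𝓡 n) (𝓡 n) c.symm (c x) :=
      mdifferentiableAt_atlas_symm (chart_mem_atlas _ x) (c.map_source hxc)
    have h2 : MDifferentiableAt (𝓡 n) 𝓘(ℝ, Fin d → ℝ) h (c.symm (c x)) :=
      (hU.contMDiffOn.contMDiffAt (hU.isOpen.mem_nhds hxs.2)).mdifferentiableAt (by simp)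
    have h3 := mfderiv_comp (c x) h2 h1
    rw [mfderiv_eq_fderiv] at h3
    rw [hA, h3]
    refine (hU.surjective _ hxs.2).comp ?_
    have := (chartAt (EuclideanSpace ℝ (Fin n)) x)
    have h4 : MDifferentiableAt (𝓡 n) (𝓡 n) c x :=
      mdifferentiableAt_atlas (chart_mem_atlas _ x) hxc
    have h5 : c.symm ∘ c =ᶠ[𝓝 x] id := by
      filter_upwards [c.open_source.mem_nhds hxc] with y hy using c.left_inv hy
    have h6 := mfderiv_comp x h1 h4
    rw [h5.mfderiv_eq, mfderiv_id] at h6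
    intro v
    refine ⟨mfderiv (𝓡 n) (𝓡 n) c x v, ?_⟩
    exact (congrArg (fun T => T v) h6).symm
  obtain ⟨p, e', he'⟩ := exists_equiv_prod_of_surjective hAs
  have hF : HasFDerivAt (fun y => ((h ∘ c.symm) y, p y))
      (e' : EuclideanSpace ℝ (Fin n) →L[ℝ] (Fin d → ℝ) × EuclideanSpace ℝ (Fin (n - d))) (c x) := by
    rw [he']
    exact ((hcomp.contDiffAt (hso.mem_nhds hxs)).differentiableAt (by simp)).hasFDerivAt.prodMk
      p.hasFDerivAt
  have hFs : ContDiffOn ℝ ∞ (fun y => ((h ∘ c.symm) y, p y)) s := hcomp.prodMk p.contDiff.contDiffOn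
  obtain ⟨e, hxe, hes, hef, hesymm⟩ := exists_openPartialHomeomorph_contDiffOn hso hxs hFs e' hF
  set ψ := c.trans e with hψ
  have hψx : x ∈ ψ.source := by
    rw [hψ, OpenPartialHomeomorph.trans_source]; exact ⟨hxc, hxe⟩
  have hnhds : ψ.target ∩ ψ.symm ⁻¹' W ∈ 𝓝 (ψ x) := by
    refine inter_mem (ψ.open_target.mem_nhds (ψ.map_source hψx)) ?_
    refine (ψ.continuousAt_symm (ψ.map_source hψx)).preimage_mem_nhds ?_
    rwa [ψ.left_inv hψx]
  obtain ⟨r₀, hr₀, hball⟩ := Metric.mem_nhds_iff.1 hnhds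
  set r := min r₀ 1 with hr
  have hrpos : 0 < r := lt_min hr₀ one_pos
  have hball' : Metric.ball (ψ x) r ⊆ ψ.target ∩ ψ.symm ⁻¹' W :=
    (Metric.ball_subset_ball (min_le_left _ _)).trans hball
  set φ := (ψ.symm.restrOpen (Metric.ball (ψ x) r) Metric.isOpen_ball).symm with hφ
  have hφt : φ.target = Metric.ball (ψ x) r := by
    change ψ.target ∩ Metric.ball (ψ x) r = _
    exact inter_eq_right.2 fun y hy => (hball' hy).1
  have hφs : φ.source ⊆ ψ.source := fun y hy => by
    have h1 := φ.map_source hy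
    have h2 : ψ.symm (φ y) = y := φ.left_inv hy
    rw [← h2]
    exact ψ.map_target (hball' (hφt ▸ h1)).1
  refine ⟨φ, r, hrpos, min_le_right _ _, ?_, ?_, hφt, ?_, ?_, ?_⟩
  · have : ψ x ∈ φ.target := hφt ▸ Metric.mem_ball_self hrpos
    have h2 := φ.map_target this
    have h3 : φ.symm (ψ x) = x := ψ.left_inv hψx
    rwa [h3] at h2
  · intro y hy
    have h1 := φ.map_source hy
    have h2 : ψ.symm (φ y) = y := φ.left_inv hy
    rw [← h2]
    exact (hball' (hφt ▸ h1)).2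
  · have h1 : ContMDiffOn 𝓘(ℝ, EuclideanSpace ℝ (Fin n))
        𝓘(ℝ, (Fin d → ℝ) × EuclideanSpace ℝ (Fin (n - d))) ∞ e e.source := by
      rw [contMDiffOn_iff_contDiffOn, hef]; exact hFs.mono hes
    refine h1.comp (hcc.mono ?_) ?_
    · intro y hy
      exact (hφs hy).1
    · intro y hy
      exact (hφs hy).2
  · have h1 : ContMDiffOn 𝓘(ℝ, (Fin d → ℝ) × EuclideanSpace ℝ (Fin (n - d)))
        𝓘(ℝ, EuclideanSpace ℝ (Fin n)) ∞ e.symm e.target := by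
      rw [contMDiffOn_iff_contDiffOn]; exact hesymm
    refine hcs.comp (h1.mono ?_) ?_
    · intro y hy
      exact (hball' (hφt ▸ hy)).1.1
    · intro y hy
      exact (hball' (hφt ▸ hy)).1.2
  · intro y hy
    have h1 := hφs hy
    have h2 : c y ∈ s := hes h1.2
    have h3 : (φ y).1 = h y := by
      change (e (c y)).1 = h y
      rw [hef]
      simp [c.left_inv h1.1]
    rw [h3]
    refine hU.eq_torusExp y ?_
    have := h2.2
    rwa [mem_preimage, c.left_inv h1.1] at this

end Lift

end

section

open Filter Topology Set

/-! ### The fibres of a submersion to the torus -/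

section Fibre

variable {n d : ℕ} {M : Type*} [TopologicalSpace M] [ChartedSpace (EuclideanSpace ℝ (Fin n)) M]

/-- The fibre of `f` over `b`. -/
abbrev Fibre (f : M → Torus d) (b : Torus d) : Type _ := {x : M // f x = b}

open Classical in
/-- The chart of the fibre through `x` induced by an adapted chart whose target is a ball. -/
noncomputable def IsAdaptedChart.fibreChart {f : M → Torus d} {b : Torus d}
    {φ : OpenPartialHomeomorph M ((Fin d → ℝ) × EuclideanSpace ℝ (Fin (n - d)))}
    (hφ : IsAdaptedChart (n := n) f φ) (x : Fibre f b) (hx : x.1 ∈ φ.source) {r : ℝ} (hr0 : 0 < r)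
    (hr : r ≤ 1) (ht : φ.target = Metric.ball (φ x) r) :
    OpenPartialHomeomorph (Fibre f b) (EuclideanSpace ℝ (Fin (n - d))) :=
  have hmem : ∀ s ∈ Metric.ball (φ x.1).2 r, ((φ x.1).1, s) ∈ φ.target := fun s hs => by
    rw [ht, ← ball_prod_same]
    exact ⟨Metric.mem_ball_self hr0, hs⟩
  have hval : ∀ s ∈ Metric.ball (φ x.1).2 r, f (φ.symm ((φ x.1).1, s)) = b := fun s hs => by
    rw [hφ.eq_torusExp _ (φ.map_target (hmem s hs)), φ.right_inv (hmem s hs)]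
    exact (hφ.eq_torusExp _ hx).symm.trans x.2
  -- On a ball of radius at most 1 the value of `f` determines the first coordinate, so the fibre
  -- meets the chart domain in a single slice.
  have hfst : ∀ y : Fibre f b, y.1 ∈ φ.source → (φ y.1).1 = (φ x.1).1 := fun y hy => by
    have h1 : φ y.1 ∈ Metric.ball (φ x.1).1 r ×ˢ Metric.ball (φ x.1).2 r := by
      rw [ball_prod_same, Prod.mk.eta, ← ht]; exact φ.map_source hy
    refine torusExp_inj_of_mem_ball hr h1.1 (Metric.mem_ball_self hr0) ?_
    rw [← hφ.eq_torusExp _ hy, ← hφ.eq_torusExp _ hx, y.2, x.2]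
  { toFun := fun y => (φ y.1).2
    invFun := fun s =>
      if h : f (φ.symm ((φ x.1).1, s)) = b then ⟨φ.symm ((φ x.1).1, s), h⟩ else x
    source := {y | y.1 ∈ φ.source}
    target := Metric.ball (φ x.1).2 r
    map_source' := fun y hy => by
      have h1 : φ y.1 ∈ Metric.ball (φ x.1).1 r ×ˢ Metric.ball (φ x.1).2 r := by
        rw [ball_prod_same, Prod.mk.eta, ← ht]; exact φ.map_source hy
      exact h1.2
    map_target' := fun s hs => by
      rw [dif_pos (hval s hs)]
      exact φ.map_target (hmem s hs)
    left_inv' := fun y hy => by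
      have h1 : φ.symm ((φ x.1).1, (φ y.1).2) = y.1 := by
        rw [← hfst y hy, Prod.mk.eta, φ.left_inv hy]
      have h2 : f (φ.symm ((φ x.1).1, (φ y.1).2)) = b := by rw [h1]; exact y.2
      rw [dif_pos h2]
      exact Subtype.ext h1
    right_inv' := fun s hs => by
      rw [dif_pos (hval s hs)]
      change (φ (φ.symm ((φ x.1).1, s))).2 = s
      rw [φ.right_inv (hmem s hs)]
    open_source := φ.open_source.preimage continuous_subtype_val
    open_target := Metric.isOpen_ball
    continuousOn_toFun := continuous_snd.comp_continuousOn
      (φ.continuousOn.comp continuous_subtype_val.continuousOn fun _ hy => hy)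
    continuousOn_invFun := by
      have hi : Topology.IsInducing (Subtype.val : Fibre f b → M) := ⟨rfl⟩
      refine hi.continuousOn_iff.2 ?_
      have h1 : ContinuousOn (fun s => φ.symm ((φ x.1).1, s)) (Metric.ball (φ x.1).2 r) :=
        φ.continuousOn_symm.comp (by fun_prop) hmem
      refine h1.congr fun s hs => ?_
      exact congrArg Subtype.val (dif_pos (hval s hs)) }

variable [IsManifold (𝓡 n) ∞ M] {f : M → Torus d} (hf : IsTorusSubmersion (n := n) f)
  {b : Torus d}

/-- The preferred adapted chart at a point. -/
noncomputable def IsTorusSubmersion.adaptedChart (x : M) :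
    OpenPartialHomeomorph M ((Fin d → ℝ) × EuclideanSpace ℝ (Fin (n - d))) :=
  (hf.exists_isAdaptedChart x univ_mem).choose

theorem IsTorusSubmersion.adaptedChart_spec (x : M) :
    ∃ r : ℝ, 0 < r ∧ r ≤ 1 ∧ x ∈ (hf.adaptedChart x).source ∧
      (hf.adaptedChart x).target = Metric.ball (hf.adaptedChart x x) r ∧
        IsAdaptedChart (n := n) f (hf.adaptedChart x) := by
  obtain ⟨r, h1, h2, h3, -, h4, h5⟩ := (hf.exists_isAdaptedChart x univ_mem).choose_spec
  exact ⟨r, h1, h2, h3, h4, h5⟩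

theorem IsTorusSubmersion.isAdaptedChart (x : M) :
    IsAdaptedChart (n := n) f (hf.adaptedChart x) := by
  obtain ⟨r, h1, h2, h3, h4, h5⟩ := hf.adaptedChart_spec x
  exact h5

/-- The preferred chart of the fibre at a point. -/
noncomputable def IsTorusSubmersion.fibreChartAt (x : Fibre f b) :
    OpenPartialHomeomorph (Fibre f b) (EuclideanSpace ℝ (Fin (n - d))) :=
  (hf.isAdaptedChart x.1).fibreChart x
    (hf.adaptedChart_spec x.1).choose_spec.2.2.1
    (hf.adaptedChart_spec x.1).choose_spec.1
    (hf.adaptedChart_spec x.1).choose_spec.2.1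
    (hf.adaptedChart_spec x.1).choose_spec.2.2.2.1

theorem IsTorusSubmersion.mk_mem_target (x : Fibre f b) {s : EuclideanSpace ℝ (Fin (n - d))}
    (hs : s ∈ (hf.fibreChartAt x).target) :
    ((hf.adaptedChart x.1 x.1).1, s) ∈ (hf.adaptedChart x.1).target := by
  have h := (hf.adaptedChart_spec x.1).choose_spec
  rw [h.2.2.2.1, ← ball_prod_same]
  exact ⟨Metric.mem_ball_self h.1, hs⟩

theorem IsTorusSubmersion.fibreChartAt_symm_apply (x : Fibre f b)
    {s : EuclideanSpace ℝ (Fin (n - d))} (hs : s ∈ (hf.fibreChartAt x).target) :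
    ((hf.fibreChartAt x).symm s).1 =
      (hf.adaptedChart x.1).symm ((hf.adaptedChart x.1 x.1).1, s) := by
  have h1 := hf.mk_mem_target x hs
  have h2 : f ((hf.adaptedChart x.1).symm ((hf.adaptedChart x.1 x.1).1, s)) = b := by
    rw [(hf.isAdaptedChart x.1).eq_torusExp _ ((hf.adaptedChart x.1).map_target h1),
      (hf.adaptedChart x.1).right_inv h1]
    exact ((hf.isAdaptedChart x.1).eq_torusExp _
      (hf.adaptedChart_spec x.1).choose_spec.2.2.1).symm.trans x.2
  exact congrArg Subtype.val (dif_pos h2)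

/-- The charts of the fibre. -/
@[reducible]
noncomputable def IsTorusSubmersion.chartedSpaceFibre (b : Torus d) :
    ChartedSpace (EuclideanSpace ℝ (Fin (n - d))) (Fibre f b) where
  atlas := range fun x : Fibre f b => hf.fibreChartAt x
  chartAt x := hf.fibreChartAt x
  mem_chart_source x := (hf.adaptedChart_spec x.1).choose_spec.2.2.1
  chart_mem_atlas x := mem_range_self x

theorem IsTorusSubmersion.contMDiffOn_fibreChartAt_symm (x : Fibre f b) :
    ContMDiffOn (𝓡 (n - d)) (𝓡 n) ∞ (fun s => ((hf.fibreChartAt x).symm s).1)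
      (hf.fibreChartAt x).target := by
  have h1 : ContMDiffOn 𝓘(ℝ, EuclideanSpace ℝ (Fin (n - d)))
      𝓘(ℝ, (Fin d → ℝ) × EuclideanSpace ℝ (Fin (n - d))) ∞
      (fun s : EuclideanSpace ℝ (Fin (n - d)) => ((hf.adaptedChart x.1 x.1).1, s))
      (hf.fibreChartAt x).target := by
    rw [contMDiffOn_iff_contDiffOn]
    exact contDiffOn_const.prodMk contDiffOn_id
  exact ((hf.isAdaptedChart x.1).contMDiffOn_symm.comp h1 fun s hs => hf.mk_mem_target x hs).congr
    fun s hs => hf.fibreChartAt_symm_apply x hs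

theorem IsTorusSubmersion.isManifold_fibre (b : Torus d) :
    letI := hf.chartedSpaceFibre b
    IsManifold (𝓡 (n - d)) ∞ (Fibre f b) := by
  let := hf.chartedSpaceFibre b
  refine isManifold_of_contDiffOn _ _ _ ?_
  rintro _ _ ⟨x, rfl⟩ ⟨y, rfl⟩
  simp only [modelWithCornersSelf_coe, modelWithCornersSelf_coe_symm, Function.id_comp,
    Function.comp_id, range_id, inter_univ, preimage_id]
  rw [← contMDiffOn_iff_contDiffOn]
  have h1 := (hf.contMDiffOn_fibreChartAt_symm x).mono
    (show ((hf.fibreChartAt x).symm.trans (hf.fibreChartAt y)).source ⊆ _ from fun s hs => hs.1)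
  have h2 := (hf.isAdaptedChart y.1).contMDiffOn.comp h1 fun s hs => hs.2
  have h3 : ContMDiff 𝓘(ℝ, (Fin d → ℝ) × EuclideanSpace ℝ (Fin (n - d)))
      𝓘(ℝ, EuclideanSpace ℝ (Fin (n - d))) ∞ Prod.snd := contDiff_snd.contMDiff
  exact h3.comp_contMDiffOn h2

theorem IsTorusSubmersion.contMDiff_fibre_val (b : Torus d) :
    letI := hf.chartedSpaceFibre b
    ContMDiff (𝓡 (n - d)) (𝓡 n) ∞ (Subtype.val : Fibre f b → M) := by
  let := hf.chartedSpaceFibre b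
  have := hf.isManifold_fibre b
  intro x
  have h1 : ContMDiffAt (𝓡 (n - d)) (𝓡 (n - d)) ∞
      (chartAt (EuclideanSpace ℝ (Fin (n - d))) x) x :=
    contMDiffAt_of_mem_maximalAtlas (IsManifold.chart_mem_maximalAtlas x) (mem_chart_source _ x)
  have h2 := ((hf.contMDiffOn_fibreChartAt_symm x).contMDiffAt
    ((hf.fibreChartAt x).open_target.mem_nhds
      ((hf.fibreChartAt x).map_source (mem_chart_source _ x)))).comp x h1
  refine h2.congr_of_eventuallyEq ?_
  filter_upwards [(hf.fibreChartAt x).open_source.mem_nhds (mem_chart_source _ x)] with y hy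
  exact congrArg Subtype.val ((hf.fibreChartAt x).left_inv hy).symm

/-- The charts of the fibre are second components of charts of `M`, so smoothness can be tested
after inclusion into `M`. -/
theorem IsTorusSubmersion.contMDiffWithinAt_fibre {E H N : Type*} [NormedAddCommGroup E]
    [NormedSpace ℝ E] [TopologicalSpace H] {I : ModelWithCorners ℝ E H} [TopologicalSpace N]
    [ChartedSpace H N] {g : N → Fibre f b} {s : Set N} {x : N}
    (hg : ContMDiffWithinAt I (𝓡 n) ∞ (fun y => (g y).1) s x) :
    letI := hf.chartedSpaceFibre b
    ContMDiffWithinAt I (𝓡 (n - d)) ∞ g s x := by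
  let := hf.chartedSpaceFibre b
  have hc : ContinuousWithinAt g s x :=
    (⟨rfl⟩ : Topology.IsInducing (Subtype.val : Fibre f b → M)).continuousWithinAt_iff.2 hg.continuousWithinAt
  rw [contMDiffWithinAt_iff_target]
  refine ⟨hc, ?_⟩
  have h0 : (g x).1 ∈ (hf.adaptedChart (g x).1).source :=
    (hf.adaptedChart_spec (g x).1).choose_spec.2.2.1
  have h2 := ((hf.isAdaptedChart (g x).1).contMDiffOn.contMDiffAt
    ((hf.adaptedChart (g x).1).open_source.mem_nhds h0)).comp_contMDiffWithinAt x hg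
  have h3 : ContMDiff 𝓘(ℝ, (Fin d → ℝ) × EuclideanSpace ℝ (Fin (n - d)))
      𝓘(ℝ, EuclideanSpace ℝ (Fin (n - d))) ∞ Prod.snd := contDiff_snd.contMDiff
  exact h3.contMDiffAt.comp_contMDiffWithinAt x h2

end Fibre

end

section

open Filter Topology Set

/-! ### Small translations along a submersion to the torus -/

section Drift

variable {n d : ℕ} {M : Type*} [TopologicalSpace M] [ChartedSpace (EuclideanSpace ℝ (Fin n)) M]

/-- A self-map of `ℝ^d × M`, defined and smooth near `0 × M`, which fixes `0 × M` and preserves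
`(u, x) ↦ f x * exp u`. -/
structure IsDrift (f : M → Torus d) (σ : (Fin d → ℝ) × M → (Fin d → ℝ) × M) : Prop where
  map_zero : ∀ x, σ (0, x) = (0, x)
  contMDiffAt : ∀ x, ∀ᶠ p in 𝓝 ((0 : Fin d → ℝ), x),
    ContMDiffAt (𝓘(ℝ, Fin d → ℝ).prod (𝓡 n)) (𝓘(ℝ, Fin d → ℝ).prod (𝓡 n)) ∞ σ p
  conserve : ∀ x, ∀ᶠ p in 𝓝 ((0 : Fin d → ℝ), x),
    f (σ p).2 * torusExp (σ p).1 = f p.2 * torusExp p.1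

theorem IsDrift.tendsto {f : M → Torus d} {σ : (Fin d → ℝ) × M → (Fin d → ℝ) × M}
    (h : IsDrift (n := n) f σ) (x : M) : Tendsto σ (𝓝 (0, x)) (𝓝 (0, x)) := by
  have := (h.contMDiffAt x).self_of_nhds.continuousAt
  rwa [ContinuousAt, h.map_zero] at this

theorem IsDrift.id (f : M → Torus d) : IsDrift (n := n) f id :=
  ⟨fun _ => rfl, fun _ => Eventually.of_forall fun _ => contMDiffAt_id,
    fun _ => Eventually.of_forall fun _ => rfl⟩

theorem IsDrift.comp {f : M → Torus d} {σ τ : (Fin d → ℝ) × M → (Fin d → ℝ) × M}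
    (h : IsDrift (n := n) f σ) (h' : IsDrift (n := n) f τ) : IsDrift (n := n) f (σ ∘ τ) where
  map_zero x := by simp [h'.map_zero, h.map_zero]
  contMDiffAt x := by
    filter_upwards [h'.contMDiffAt x, (h'.tendsto x).eventually (h.contMDiffAt x)] with p h1 h2
    exact h2.comp p h1
  conserve x := by
    filter_upwards [h'.conserve x, (h'.tendsto x).eventually (h.conserve x)] with p h1 h2
    exact h2.trans h1

variable [IsManifold (𝓡 n) ∞ M] [T2Space M]

/-- In an adapted chart, the fraction `χ` of the displacement `u` is spent on moving the point, and
the fraction `1 - χ` is kept. Where `χ = 1` nothing is kept, and outside the support of `χ` nothing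
moves, so the formula extends by the identity. -/
theorem IsTorusSubmersion.exists_isDrift_near {f : M → Torus d}
    (hf : IsTorusSubmersion (n := n) f) (x₀ : M) :
    ∃ σ : (Fin d → ℝ) × M → (Fin d → ℝ) × M, ∃ K ∈ 𝓝 x₀, IsDrift (n := n) f σ ∧
      ∀ x ∈ K, ∀ᶠ p in 𝓝 ((0 : Fin d → ℝ), x), (σ p).1 = 0 := by
  classical
  obtain ⟨φ, r, -, -, hx₀, -, -, hφ⟩ := hf.exists_isAdaptedChart x₀ univ_mem
  obtain ⟨χ, -, hχ⟩ := (SmoothBumpFunction.nhds_basis_tsupport (I := 𝓡 n) x₀).mem_iff.1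
    (φ.open_source.mem_nhds hx₀)
  have hχs : ContMDiff (𝓡 n) 𝓘(ℝ, ℝ) ∞ χ := χ.contMDiff
  let τ : (Fin d → ℝ) × M → (Fin d → ℝ) × EuclideanSpace ℝ (Fin (n - d)) :=
    fun p => φ p.2 + (χ p.2 • p.1, 0)
  let σ : (Fin d → ℝ) × M → (Fin d → ℝ) × M := fun p =>
    if p.2 ∈ φ.source then ((1 - χ p.2) • p.1, φ.symm (τ p)) else p
  have hτ : ContMDiffOn (𝓘(ℝ, Fin d → ℝ).prod (𝓡 n))
      𝓘(ℝ, (Fin d → ℝ) × EuclideanSpace ℝ (Fin (n - d))) ∞ τ (Prod.snd ⁻¹' φ.source) := by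
    refine (hφ.contMDiffOn.comp contMDiff_snd.contMDiffOn fun p hp => hp).add ?_
    refine ContMDiff.contMDiffOn ?_
    exact ((hχs.comp contMDiff_snd).smul contMDiff_fst).prodMk_space contMDiff_const
  set O : Set ((Fin d → ℝ) × M) := Prod.snd ⁻¹' φ.source ∩ τ ⁻¹' φ.target with hO
  have hOo : IsOpen O := hτ.continuousOn.isOpen_inter_preimage
    (φ.open_source.preimage continuous_snd) φ.open_target
  set O' : Set ((Fin d → ℝ) × M) := Prod.snd ⁻¹' (tsupport χ)ᶜ with hO'
  have hOo' : IsOpen O' := (isClosed_tsupport χ).isOpen_compl.preimage continuous_snd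
  have hσ : ∀ p ∈ O, σ p = ((1 - χ p.2) • p.1, φ.symm (τ p)) := fun p hp => if_pos hp.1
  have hσ' : ∀ p ∈ O', σ p = p := fun p hp => by
    have h0 : χ p.2 = 0 := image_eq_zero_of_notMem_tsupport hp
    by_cases h : p.2 ∈ φ.source
    · have : τ p = φ p.2 := by
        simp only [τ, h0, zero_smul]
        exact add_zero _
      simp only [σ, if_pos h, h0, this, sub_zero, one_smul, φ.left_inv h]
    · exact if_neg h
  have hcover : ∀ x, ((0 : Fin d → ℝ), x) ∈ O ∨ ((0 : Fin d → ℝ), x) ∈ O' := fun x => by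
    by_cases h : x ∈ tsupport χ
    · refine Or.inl ⟨hχ h, ?_⟩
      have : τ (0, x) = φ x := by
        simp only [τ, smul_zero]
        exact add_zero _
      rw [mem_preimage, this]
      exact φ.map_source (hχ h)
    · exact Or.inr h
  have key : ∀ P : (Fin d → ℝ) × M → Prop, (∀ p ∈ O, P p) → (∀ p ∈ O', P p) →
      ∀ x, ∀ᶠ p in 𝓝 ((0 : Fin d → ℝ), x), P p := fun P h1 h2 x => by
    rcases hcover x with h | h
    · exact mem_of_superset (hOo.mem_nhds h) h1
    · exact mem_of_superset (hOo'.mem_nhds h) h2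
  refine ⟨σ, {x | ∀ᶠ y in 𝓝 x, χ y = 1}, eventually_eventually_nhds.2 χ.eventuallyEq_one,
    ⟨fun x => ?_, key _ ?_ ?_, key _ ?_ ?_⟩, ?_⟩
  · rcases hcover x with h | h
    · have : τ (0, x) = φ x := by
        simp only [τ, smul_zero]
        exact add_zero _
      rw [hσ _ h, this, φ.left_inv h.1, smul_zero]
    · exact hσ' _ h
  · intro p hp
    have h1 : ContMDiffOn (𝓘(ℝ, Fin d → ℝ).prod (𝓡 n)) (𝓘(ℝ, Fin d → ℝ).prod (𝓡 n)) ∞ σ O := by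
      refine ContMDiffOn.congr (ContMDiffOn.prodMk ?_ ?_) hσ
      · exact ((contMDiff_const.sub (hχs.comp contMDiff_snd)).smul contMDiff_fst).contMDiffOn
      · exact hφ.contMDiffOn_symm.comp (hτ.mono inter_subset_left) fun p hp => hp.2
    exact h1.contMDiffAt (hOo.mem_nhds hp)
  · intro p hp
    refine contMDiffAt_id.congr_of_eventuallyEq ?_
    filter_upwards [hOo'.mem_nhds hp] with q hq using hσ' q hq
  · intro p hp
    rw [hσ p hp]
    simp only
    rw [hφ.eq_torusExp _ (φ.map_target hp.2), φ.right_inv hp.2, hφ.eq_torusExp _ hp.1,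
      ← torusExp_add, ← torusExp_add]
    congr 1
    simp only [τ, Prod.fst_add, sub_smul, one_smul]
    abel
  · intro p hp
    rw [hσ' p hp]
  · intro x hx
    filter_upwards [(continuous_snd.tendsto ((0 : Fin d → ℝ), x)).eventually hx] with p hp
    have h1 : p.2 ∈ φ.source := hχ (subset_tsupport χ (by
      rw [Function.mem_support, hp]; exact one_ne_zero))
    simp only [σ, if_pos h1, hp, sub_self, zero_smul]

/-- Each drift uses up the whole displacement near its own centre, and a displacement that is
already zero stays zero. Composing drifts over a finite cover therefore leaves none near `0 × M`,
and the conservation law becomes the translation law. -/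
theorem IsTorusSubmersion.exists_translation [CompactSpace M] {f : M → Torus d}
    (hf : IsTorusSubmersion (n := n) f) :
    ∃ ψ : (Fin d → ℝ) × M → M, (∀ x, ψ (0, x) = x) ∧
      ∀ x, ∀ᶠ p in 𝓝 ((0 : Fin d → ℝ), x),
        ContMDiffAt (𝓘(ℝ, Fin d → ℝ).prod (𝓡 n)) (𝓡 n) ∞ ψ p ∧
          f (ψ p) = f p.2 * torusExp p.1 := by
  choose σ K hK hσ hσK using hf.exists_isDrift_near
  obtain ⟨t, ht⟩ := (isCompact_univ (X := M)).elim_nhds_subcover K fun x _ => hK x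
  have key : ∀ t : Finset M, ∃ τ, IsDrift (n := n) f τ ∧
      ∀ i ∈ t, ∀ x ∈ K i, ∀ᶠ p in 𝓝 ((0 : Fin d → ℝ), x), (τ p).1 = 0 := by
    classical
    intro t
    induction t using Finset.induction_on with
    | empty => exact ⟨id, IsDrift.id f, by simp⟩
    | insert i t _ ih =>
      obtain ⟨τ, hτ, hτt⟩ := ih
      refine ⟨σ i ∘ τ, (hσ i).comp hτ, fun j hj x hx => ?_⟩
      rcases Finset.mem_insert.1 hj with rfl | hj
      · exact (hτ.tendsto x).eventually (hσK j x hx)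
      · filter_upwards [hτt j hj x hx] with p hp
        have : τ p = (0, (τ p).2) := Prod.ext hp rfl
        rw [Function.comp_apply, this, (hσ i).map_zero]
  obtain ⟨τ, hτ, hτt⟩ := key t
  refine ⟨fun p => (τ p).2, fun x => by simp [hτ.map_zero], fun x => ?_⟩
  obtain ⟨i, hi, hx⟩ : ∃ i ∈ t, x ∈ K i := by simpa using ht.2 (mem_univ x)
  filter_upwards [hτ.contMDiffAt x, hτ.conserve x, hτt i hi x hx] with p h1 h2 h3
  refine ⟨contMDiffAt_snd.comp p h1, ?_⟩
  rw [← h2, h3, torusExp_zero, mul_one]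

end Drift

end

section

open Filter Topology Set

/-! ### Families of maps near the identity -/

section NearIdentity

variable {n : ℕ} {M : Type*} [TopologicalSpace M] [ChartedSpace (EuclideanSpace ℝ (Fin n)) M]
  {V : Type*} [NormedAddCommGroup V] [NormedSpace ℝ V]

theorem exists_equiv_fst_prod {E : Type*} [NormedAddCommGroup E] [NormedSpace ℝ E]
    (B : V × E →L[ℝ] E) (hB : ∀ w, B (0, w) = w) :
    ∃ e : (V × E) ≃L[ℝ] V × E,
      (e : V × E →L[ℝ] V × E) = (ContinuousLinearMap.fst ℝ V E).prod B := by
  have hB' : ∀ u w, B (u, w) = B (u, 0) + w := fun u w => by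
    rw [← hB w, ← map_add, hB]; simp
  refine ⟨ContinuousLinearEquiv.equivOfInverse ((ContinuousLinearMap.fst ℝ V E).prod B)
    ((ContinuousLinearMap.fst ℝ V E).prod (ContinuousLinearMap.snd ℝ V E -
      B.comp ((ContinuousLinearMap.inl ℝ V E).comp (ContinuousLinearMap.fst ℝ V E)))) ?_ ?_, rfl⟩
  · rintro ⟨u, w⟩
    simp [hB' u w]
  · rintro ⟨u, w⟩
    simp [hB' u (w - _)]

variable [IsManifold (𝓡 n) ∞ M] [CompleteSpace V]

/-- Since `ψ (0, ·)` is the identity, the derivative of `(u, x) ↦ (u, ψ (u, x))` at `(0, x₀)` is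
triangular with identity diagonal, and the inverse function theorem applies to this map with
parameter. -/
theorem exists_local_inverse_of_map_zero {ψ : V × M → M} (h0 : ∀ x, ψ (0, x) = x) (x₀ : M)
    (hψ : ∀ᶠ p in 𝓝 ((0 : V), x₀), ContMDiffAt (𝓘(ℝ, V).prod (𝓡 n)) (𝓡 n) ∞ ψ p) :
    (∃ W ∈ 𝓝 x₀, ∀ᶠ u in 𝓝 (0 : V), InjOn (fun x => ψ (u, x)) W) ∧
      ∃ g : V × M → M, ∀ᶠ p in 𝓝 ((0 : V), x₀),
        ContMDiffAt (𝓘(ℝ, V).prod (𝓡 n)) (𝓡 n) ∞ g p ∧ ψ (p.1, g p) = p.2 := by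
  set c := chartAt (EuclideanSpace ℝ (Fin n)) x₀ with hc
  have hcs : ContMDiffOn (𝓡 n) (𝓡 n) ∞ c.symm c.target := contMDiffOn_chart_symm
  have hcc : ContMDiffOn (𝓡 n) (𝓡 n) ∞ c c.source := contMDiffOn_chart
  have hxc : x₀ ∈ c.source := mem_chart_source _ x₀
  have hsymm : c.symm (c x₀) = x₀ := c.left_inv hxc
  have hψc : ∀ᶠ p in 𝓝 ((0 : V), x₀), ψ p ∈ c.source := by
    refine hψ.self_of_nhds.continuousAt.preimage_mem_nhds ?_
    rw [h0]; exact c.open_source.mem_nhds hxc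
  obtain ⟨O, hOsub, hOo, hxO⟩ := eventually_nhds_iff.1 (hψ.and hψc)
  let ι : V × EuclideanSpace ℝ (Fin n) → V × M := fun p => (p.1, c.symm p.2)
  have hι : ContMDiffOn 𝓘(ℝ, V × EuclideanSpace ℝ (Fin n)) (𝓘(ℝ, V).prod (𝓡 n)) ∞ ι
      (Prod.snd ⁻¹' c.target) := by
    refine ContMDiffOn.prodMk contDiff_fst.contMDiff.contMDiffOn ?_
    exact hcs.comp (I := 𝓘(ℝ, V × EuclideanSpace ℝ (Fin n))) contDiff_snd.contMDiff.contMDiffOn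
      fun p hp => hp
  set s := Prod.snd ⁻¹' c.target ∩ ι ⁻¹' O with hs
  have hso : IsOpen s := hι.continuousOn.isOpen_inter_preimage
    (c.open_target.preimage continuous_snd) hOo
  have hxs : ((0 : V), c x₀) ∈ s := ⟨c.map_source hxc, by
    change (0, c.symm (c x₀)) ∈ O; rwa [hsymm]⟩
  have hF2 : ContDiffOn ℝ ∞ (fun p => c (ψ (ι p))) s := by
    rw [← contMDiffOn_iff_contDiffOn]
    refine hcc.comp (t := c.source) ?_ fun p hp => (hOsub _ hp.2).2
    intro p hp
    exact (hOsub _ hp.2).1.comp_contMDiffWithinAt p ((hι p hp.1).mono inter_subset_left)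
  have hF : ContDiffOn ℝ ∞ (fun p => (p.1, c (ψ (ι p)))) s := contDiff_fst.contDiffOn.prodMk hF2
  set B := fderiv ℝ (fun p => c (ψ (ι p))) (0, c x₀) with hB
  have hBd : HasFDerivAt (fun p => c (ψ (ι p))) B (0, c x₀) :=
    ((hF2.contDiffAt (hso.mem_nhds hxs)).differentiableAt (by simp)).hasFDerivAt
  have hB0 : ∀ w, B (0, w) = w := by
    have h1 : HasFDerivAt (fun e : EuclideanSpace ℝ (Fin n) => ((0 : V), e))
        (ContinuousLinearMap.inr ℝ V _) (c x₀) := hasFDerivAt_prodMk_right _ _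
    have h2 := HasFDerivAt.comp (c x₀) hBd h1
    have h3 : HasFDerivAt ((fun p => c (ψ (ι p))) ∘ fun e : EuclideanSpace ℝ (Fin n) => ((0 : V), e))
        (ContinuousLinearMap.id ℝ _) (c x₀) := by
      refine (hasFDerivAt_id _).congr_of_eventuallyEq ?_
      filter_upwards [c.open_target.mem_nhds (c.map_source hxc)] with e he
      simp only [ι, Function.comp_apply, h0, id]
      exact c.right_inv he
    intro w
    exact congrArg (fun T => T w) (h2.unique h3)
  obtain ⟨e', he'⟩ := exists_equiv_fst_prod B hB0
  obtain ⟨e, hxe, hes, hef, hesymm⟩ := exists_openPartialHomeomorph_contDiffOn hso hxs hF e'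
    (by rw [he']; exact hasFDerivAt_fst.prodMk hBd)
  have hκ : ContMDiffOn (𝓘(ℝ, V).prod (𝓡 n)) 𝓘(ℝ, V × EuclideanSpace ℝ (Fin n)) ∞
      (fun p : V × M => (p.1, c p.2)) (Prod.snd ⁻¹' c.source) :=
    contMDiff_fst.contMDiffOn.prodMk_space (hcc.comp contMDiff_snd.contMDiffOn fun p hp => hp)
  refine ⟨?_, fun p => c.symm (e.symm (p.1, c p.2)).2, ?_⟩
  · have h1 : Prod.snd ⁻¹' c.source ∩ (fun p : V × M => (p.1, c p.2)) ⁻¹' e.source ∈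
        𝓝 ((0 : V), x₀) :=
      (hκ.continuousOn.isOpen_inter_preimage (c.open_source.preimage continuous_snd)
        e.open_source).mem_nhds ⟨hxc, hxe⟩
    rw [nhds_prod_eq, mem_prod_iff] at h1
    obtain ⟨A, hA, W, hW, hAW⟩ := h1
    refine ⟨W, hW, ?_⟩
    filter_upwards [hA] with u hu x hx y hy hxy
    have hx' := hAW (mk_mem_prod hu hx)
    have hy' := hAW (mk_mem_prod hu hy)
    have h2 := e.injOn hx'.2 hy'.2 (by
      rw [hef]
      simp only [ι]
      rw [c.left_inv hx'.1, c.left_inv hy'.1]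
      exact Prod.ext rfl (congrArg c hxy))
    exact c.injOn hx'.1 hy'.1 (Prod.ext_iff.1 h2).2
  · set Q := Prod.snd ⁻¹' c.source ∩ (fun p : V × M => (p.1, c p.2)) ⁻¹' e.target with hQ
    have hQo : IsOpen Q := hκ.continuousOn.isOpen_inter_preimage
      (c.open_source.preimage continuous_snd) e.open_target
    have hxQ : ((0 : V), x₀) ∈ Q := by
      refine ⟨hxc, ?_⟩
      have h1 := e.map_source hxe
      rw [hef] at h1
      simp only [ι, hsymm, h0] at h1
      exact h1
    have hmem : ∀ p ∈ Q, e.symm (p.1, c p.2) ∈ e.source := fun p hp => e.map_target hp.2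
    have hg : ContMDiffOn (𝓘(ℝ, V).prod (𝓡 n)) (𝓡 n) ∞
        (fun p : V × M => c.symm (e.symm (p.1, c p.2)).2) Q := by
      have h1 : ContMDiffOn 𝓘(ℝ, V × EuclideanSpace ℝ (Fin n))
          𝓘(ℝ, V × EuclideanSpace ℝ (Fin n)) ∞ e.symm e.target := by
        rw [contMDiffOn_iff_contDiffOn]; exact hesymm
      have h2 := h1.comp (hκ.mono inter_subset_left) fun p (hp : p ∈ Q) => hp.2
      have h3 : ContMDiff 𝓘(ℝ, V × EuclideanSpace ℝ (Fin n)) (𝓡 n) ∞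
          (Prod.snd : V × EuclideanSpace ℝ (Fin n) → _) := contDiff_snd.contMDiff
      exact hcs.comp (h3.comp_contMDiffOn h2) fun p hp => (hes (hmem p hp)).1
    filter_upwards [hQo.mem_nhds hxQ] with p hp
    refine ⟨hg.contMDiffAt (hQo.mem_nhds hp), ?_⟩
    set q := e.symm (p.1, c p.2) with hq
    have hqs := hes (hmem p hp)
    have h1 : e q = (p.1, c p.2) := e.right_inv hp.2
    rw [hef] at h1
    have h2 := (Prod.ext_iff.1 h1).1
    have h3 := (Prod.ext_iff.1 h1).2
    simp only at h2 h3
    refine c.injOn ?_ hp.1 ?_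
    · rw [← h2]; exact (hOsub _ hqs.2).2
    · rw [← h3, ← h2]

/-- Compactness makes the local statements uniform in `x` for small `u`. Injectivity is checked on
`M × M`: on the diagonal by local injectivity, off it by Hausdorff separation. The inverse so
obtained agrees locally with the smooth local right inverses. -/
theorem exists_smooth_inverse_of_map_zero [CompactSpace M] [T2Space M] {ψ : V × M → M}
    (h0 : ∀ x, ψ (0, x) = x)
    (hψ : ∀ x, ∀ᶠ p in 𝓝 ((0 : V), x), ContMDiffAt (𝓘(ℝ, V).prod (𝓡 n)) (𝓡 n) ∞ ψ p) :
    ∃ ψ' : V × M → M, ∀ᶠ u in 𝓝 (0 : V), ∀ x,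
      ContMDiffAt (𝓘(ℝ, V).prod (𝓡 n)) (𝓡 n) ∞ ψ (u, x) ∧
      ContMDiffAt (𝓘(ℝ, V).prod (𝓡 n)) (𝓡 n) ∞ ψ' (u, x) ∧
      ψ (u, ψ' (u, x)) = x ∧ ψ' (u, ψ (u, x)) = x := by
  classical
  have hsm : ∀ᶠ u in 𝓝 (0 : V), ∀ x ∈ (univ : Set M),
      ContMDiffAt (𝓘(ℝ, V).prod (𝓡 n)) (𝓡 n) ∞ ψ (u, x) :=
    isCompact_univ.eventually_forall_of_forall_eventually fun x _ => hψ x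
  have hg : ∀ᶠ u in 𝓝 (0 : V), ∀ x ∈ (univ : Set M), ∃ g : V × M → M,
      ∀ᶠ p in 𝓝 (u, x), ContMDiffAt (𝓘(ℝ, V).prod (𝓡 n)) (𝓡 n) ∞ g p ∧ ψ (p.1, g p) = p.2 := by
    refine isCompact_univ.eventually_forall_of_forall_eventually fun x _ => ?_
    obtain ⟨-, g, hg⟩ := exists_local_inverse_of_map_zero h0 x (hψ x)
    filter_upwards [eventually_eventually_nhds.2 hg] with p hp using ⟨g, hp⟩
  have hinj : ∀ᶠ u in 𝓝 (0 : V), ∀ q ∈ (univ : Set (M × M)),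
      ψ (u, q.1) = ψ (u, q.2) → q.1 = q.2 := by
    refine isCompact_univ.eventually_forall_of_forall_eventually fun q _ => ?_
    have hc1 : Tendsto (fun p : V × M × M => (p.1, p.2.1)) (𝓝 (0, q)) (𝓝 (0, q.1)) :=
      (continuous_fst.prodMk (continuous_fst.comp continuous_snd)).tendsto _
    have hc2 : Tendsto (fun p : V × M × M => (p.1, p.2.2)) (𝓝 (0, q)) (𝓝 (0, q.2)) :=
      (continuous_fst.prodMk (continuous_snd.comp continuous_snd)).tendsto _
    by_cases hq : q.1 = q.2
    · obtain ⟨q₁, q₂⟩ := q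
      obtain rfl : q₁ = q₂ := hq
      obtain ⟨⟨W, hW, hWinj⟩, -⟩ := exists_local_inverse_of_map_zero h0 q₁ (hψ q₁)
      have h1 : ∀ᶠ p in 𝓝 ((0 : V), (q₁, q₁)), p.2.1 ∈ W :=
        (((continuous_fst.comp continuous_snd).tendsto ((0 : V), (q₁, q₁))).eventually hW)
      have h2 : ∀ᶠ p in 𝓝 ((0 : V), (q₁, q₁)), p.2.2 ∈ W :=
        (((continuous_snd.comp continuous_snd).tendsto ((0 : V), (q₁, q₁))).eventually hW)
      have h3 := (continuous_fst.tendsto ((0 : V), (q₁, q₁))).eventually hWinj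
      filter_upwards [h1, h2, h3] with p hp1 hp2 hp3 h using hp3 hp1 hp2 h
    · have hd : Tendsto (fun p : V × M × M => (ψ (p.1, p.2.1), ψ (p.1, p.2.2))) (𝓝 (0, q))
          (𝓝 (q.1, q.2)) := by
        have e1 := (hψ q.1).self_of_nhds.continuousAt.tendsto.comp hc1
        have e2 := (hψ q.2).self_of_nhds.continuousAt.tendsto.comp hc2
        rw [h0] at e1 e2
        exact e1.prodMk_nhds e2
      have h1 : ∀ᶠ z in 𝓝 (q.1, q.2), z.1 ≠ z.2 :=
        isClosed_diagonal.isOpen_compl.mem_nhds (by simpa using hq)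
      filter_upwards [hd.eventually h1] with p hp h using absurd h hp
  refine ⟨fun p => if h : ∃ z, ψ (p.1, z) = p.2 then h.choose else p.2, ?_⟩
  have hall := (hsm.and (hg.and hinj))
  filter_upwards [hall, eventually_eventually_nhds.2 hall] with u hu hu' x
  obtain ⟨h1, h2, h3⟩ := hu
  have hright : ∀ y, ψ (u, if h : ∃ z, ψ (u, z) = y then h.choose else y) = y := fun y => by
    obtain ⟨g, hg⟩ := h2 y trivial
    have h : ∃ z, ψ (u, z) = y := ⟨_, hg.self_of_nhds.2⟩
    rw [dif_pos h]; exact h.choose_spec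
  refine ⟨h1 x trivial, ?_, hright x, h3 (_, _) trivial (hright _)⟩
  obtain ⟨g, hg⟩ := h2 x trivial
  refine hg.self_of_nhds.1.congr_of_eventuallyEq ?_
  filter_upwards [hg, (continuous_fst.tendsto (u, x)).eventually hu'] with p hp hp'
  have h : ∃ z, ψ (p.1, z) = p.2 := ⟨_, hp.2⟩
  rw [dif_pos h]
  exact hp'.2.2 (_, _) trivial (h.choose_spec.trans hp.2.symm)

end NearIdentity

end

section

open Filter Topology Set

/-! ### Submersions of compact manifolds to the torus are fibrations -/

section Ehresmann

variable {n d : ℕ}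

theorem IsTorusSubmersion.contMDiff {M : Type*} [TopologicalSpace M]
    [ChartedSpace (EuclideanSpace ℝ (Fin n)) M] {f : M → Torus d}
    (hf : IsTorusSubmersion (n := n) f) : ContMDiff (𝓡 n) (torusModel d) ∞ f := by
  intro x
  obtain ⟨U, h, hxU, hU⟩ := hf x
  refine ContMDiffAt.congr_of_eventuallyEq
    (ContMDiffWithinAt.torusExp (hU.contMDiffOn.contMDiffAt (hU.isOpen.mem_nhds hxU))) ?_
  filter_upwards [hU.isOpen.mem_nhds hxU] with y hy using hU.eq_torusExp y hy

/-- The branch of the logarithm on the torus which is smooth near `b`. -/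
noncomputable def torusLogAt (b c : Torus d) : Fin d → ℝ := torusLog b + torusLog (c / b)

theorem torusExp_torusLogAt (b c : Torus d) : torusExp (torusLogAt b c) = c := by
  rw [torusLogAt, torusExp_add, torusExp_torusLog, torusExp_torusLog, mul_div_cancel]

/-- The norm is at most 2π < 8; the constant 8 is the radius for which transport is needed below. -/
theorem norm_torusLogAt_lt (b c : Torus d) : ‖torusLogAt b c‖ < 8 := by
  have h1 := norm_torusLog_le b
  have h2 := norm_torusLog_le (c / b)
  have h3 := norm_add_le (torusLog b) (torusLog (c / b))
  have := Real.pi_lt_four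
  rw [torusLogAt]
  linarith

theorem contMDiff_torus_div_const (b : Torus d) :
    ContMDiff (torusModel d) (torusModel d) ∞ (fun c => c / b) := by
  intro c
  refine contMDiffWithinAt_torus fun j => ?_
  have h : ContMDiff (𝓡 1) (𝓡 1) ω (fun z : Circle => z * (b j)⁻¹) := contMDiff_mul_right
  have h' := (h.of_le (m := ∞) le_top).comp (contMDiff_torus_apply (d := d) j)
  refine (h' c).congr (fun z _ => ?_) ?_ <;> simp [div_eq_mul_inv]

theorem contMDiffOn_torusLogAt (b : Torus d) :
    ContMDiffOn (torusModel d) 𝓘(ℝ, Fin d → ℝ) ∞ (torusLogAt b)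
      ((fun c => c / b) ⁻¹' torusSlit d) :=
  contMDiffOn_const.add
    (contMDiffOn_torusLog.comp (contMDiff_torus_div_const b).contMDiffOn fun _ h => h)

/-- `θ` and `θ'` are smooth on the ball of radius `R` times `M`, and there they are families of
mutually inverse diffeomorphisms of `M` which lift the translations of the torus. -/
structure IsTransport {M : Type*} [TopologicalSpace M]
    [ChartedSpace (EuclideanSpace ℝ (Fin n)) M] (f : M → Torus d) (R : ℝ)
    (θ θ' : (Fin d → ℝ) × M → M) : Prop where
  contMDiffAt : ∀ p, ‖p.1‖ < R → ContMDiffAt (𝓘(ℝ, Fin d → ℝ).prod (𝓡 n)) (𝓡 n) ∞ θ p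
  contMDiffAt' : ∀ p, ‖p.1‖ < R → ContMDiffAt (𝓘(ℝ, Fin d → ℝ).prod (𝓡 n)) (𝓡 n) ∞ θ' p
  right_inv : ∀ v, ‖v‖ < R → ∀ x, θ (v, θ' (v, x)) = x
  left_inv : ∀ v, ‖v‖ < R → ∀ x, θ' (v, θ (v, x)) = x
  map_eq : ∀ v, ‖v‖ < R → ∀ x, f (θ (v, x)) = f x * torusExp v

section

variable {M : Type*} [TopologicalSpace M]
  [ChartedSpace (EuclideanSpace ℝ (Fin n)) M] {f : M → Torus d}

theorem IsTransport.mono {R R' : ℝ} {θ θ' : (Fin d → ℝ) × M → M}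
    (h : IsTransport (n := n) f R θ θ') (hR : R' ≤ R) : IsTransport (n := n) f R' θ θ' :=
  ⟨fun p hp => h.contMDiffAt p (hp.trans_le hR), fun p hp => h.contMDiffAt' p (hp.trans_le hR),
    fun v hv => h.right_inv v (hv.trans_le hR), fun v hv => h.left_inv v (hv.trans_le hR),
    fun v hv => h.map_eq v (hv.trans_le hR)⟩

theorem IsTransport.map_eq' {R : ℝ} {θ θ' : (Fin d → ℝ) × M → M}
    (h : IsTransport (n := n) f R θ θ') {v : Fin d → ℝ} (hv : ‖v‖ < R) (x : M) :
    f (θ' (v, x)) = f x / torusExp v := by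
  rw [eq_div_iff_mul_eq', ← h.map_eq v hv, h.right_inv v hv]

/-- Moving twice by half the vector doubles the radius, so the small translations suffice to reach
every radius. -/
theorem IsTransport.double {R : ℝ} {θ θ' : (Fin d → ℝ) × M → M}
    (h : IsTransport (n := n) f R θ θ') :
    IsTransport (n := n) f (2 * R)
      (fun p => θ ((1 / 2 : ℝ) • p.1, θ ((1 / 2 : ℝ) • p.1, p.2)))
      (fun p => θ' ((1 / 2 : ℝ) • p.1, θ' ((1 / 2 : ℝ) • p.1, p.2))) := by
  have hn : ∀ v : Fin d → ℝ, ‖v‖ < 2 * R → ‖(1 / 2 : ℝ) • v‖ < R := fun v hv => by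
    rw [norm_smul]; norm_num; linarith
  have hs : ContMDiff (𝓘(ℝ, Fin d → ℝ).prod (𝓡 n)) 𝓘(ℝ, Fin d → ℝ) ∞
      (fun p : (Fin d → ℝ) × M => (1 / 2 : ℝ) • p.1) :=
    (contDiff_const_smul (1 / 2 : ℝ)).contMDiff.comp contMDiff_fst
  have hsm : ∀ η : (Fin d → ℝ) × M → M,
      (∀ p, ‖p.1‖ < R → ContMDiffAt (𝓘(ℝ, Fin d → ℝ).prod (𝓡 n)) (𝓡 n) ∞ η p) →
      ∀ p, ‖p.1‖ < 2 * R → ContMDiffAt (𝓘(ℝ, Fin d → ℝ).prod (𝓡 n)) (𝓡 n) ∞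
        (fun p : (Fin d → ℝ) × M => η ((1 / 2 : ℝ) • p.1, η ((1 / 2 : ℝ) • p.1, p.2))) p :=
      fun η hη p hp => by
    have h1 := (hη ((1 / 2 : ℝ) • p.1, p.2) (hn _ hp)).comp p
      (f := fun p : (Fin d → ℝ) × M => ((1 / 2 : ℝ) • p.1, p.2))
      (hs.contMDiffAt.prodMk contMDiffAt_snd)
    exact (hη ((1 / 2 : ℝ) • p.1, η ((1 / 2 : ℝ) • p.1, p.2)) (hn _ hp)).comp p
      (f := fun p : (Fin d → ℝ) × M => ((1 / 2 : ℝ) • p.1, η ((1 / 2 : ℝ) • p.1, p.2)))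
      (hs.contMDiffAt.prodMk h1)
  refine ⟨hsm θ h.contMDiffAt, hsm θ' h.contMDiffAt', fun v hv x => ?_, fun v hv x => ?_,
    fun v hv x => ?_⟩
  · simp only [h.right_inv _ (hn v hv)]
  · simp only [h.left_inv _ (hn v hv)]
  · simp only [h.map_eq _ (hn v hv)]
    rw [mul_assoc, ← torusExp_add, ← add_smul]
    norm_num

theorem IsTorusSubmersion.exists_isTransport [IsManifold (𝓡 n) ∞ M] [CompactSpace M] [T2Space M]
    (hf : IsTorusSubmersion (n := n) f) (R : ℝ) :
    ∃ θ θ', IsTransport (n := n) f R θ θ' := by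
  obtain ⟨ψ, h0, hψ⟩ := hf.exists_translation
  obtain ⟨ψ', hψ'⟩ := exists_smooth_inverse_of_map_zero h0 fun x => (hψ x).mono fun p hp => hp.1
  have hmap : ∀ᶠ u in 𝓝 (0 : Fin d → ℝ), ∀ x ∈ (univ : Set M),
      f (ψ (u, x)) = f x * torusExp u :=
    isCompact_univ.eventually_forall_of_forall_eventually fun x _ => (hψ x).mono fun p hp => hp.2
  obtain ⟨ε, hε, hball⟩ := Metric.eventually_nhds_iff_ball.1 (hψ'.and hmap)
  have hb : ∀ v : Fin d → ℝ, ‖v‖ < ε → v ∈ Metric.ball (0 : Fin d → ℝ) ε := fun v hv => by simpa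
  have hbase : IsTransport (n := n) f ε ψ ψ' :=
    ⟨fun p hp => ((hball _ (hb _ hp)).1 p.2).1, fun p hp => ((hball _ (hb _ hp)).1 p.2).2.1,
      fun v hv x => ((hball _ (hb _ hv)).1 x).2.2.1, fun v hv x => ((hball _ (hb _ hv)).1 x).2.2.2,
      fun v hv x => (hball _ (hb _ hv)).2 x trivial⟩
  have hpow : ∀ k : ℕ, ∃ θ θ', IsTransport (n := n) f (2 ^ k * ε) θ θ' := by
    intro k
    induction k with
    | zero => exact ⟨ψ, ψ', by simpa using hbase⟩
    | succ k ih =>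
      obtain ⟨θ, θ', h⟩ := ih
      exact ⟨_, _, by simpa [pow_succ', mul_assoc] using h.double⟩
  obtain ⟨k, hk⟩ := pow_unbounded_of_one_lt (R / ε) (one_lt_two (α := ℝ))
  obtain ⟨θ, θ', h⟩ := hpow k
  exact ⟨θ, θ', h.mono ((div_lt_iff₀ hε).1 hk).le⟩

end

/-- The typical fibre is the one over 1. Transporting `y` back by a logarithm of `f y` lands in it,
and transporting forward is the inverse. These identities hold for any choice of logarithm; only
smoothness requires the restriction to the set where the branch is smooth. -/
theorem IsTorusSubmersion.isSmoothTorusFibration.{u} {M : Type u} [TopologicalSpace M]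
    [ChartedSpace (EuclideanSpace ℝ (Fin n)) M] [IsManifold (𝓡 n) ∞ M] [CompactSpace M]
    [T2Space M] {f : M → Torus d} (hf : IsTorusSubmersion (n := n) f) :
    IsSmoothTorusFibration (n := n) f := by
  obtain ⟨θ, θ', hθ⟩ := hf.exists_isTransport 8
  let _ := hf.chartedSpaceFibre 1
  refine ⟨n - d, Fibre f 1, inferInstance, hf.chartedSpaceFibre 1, hf.isManifold_fibre 1,
    fun b => ?_⟩
  set B : Set (Torus d) := (fun c => c / b) ⁻¹' torusSlit d with hB
  have hBo : IsOpen B := isOpen_torusSlit.preimage (contMDiff_torus_div_const b).continuous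
  have hfib : ∀ y, f (θ' (torusLogAt b (f y), y)) = 1 := fun y => by
    rw [hθ.map_eq' (norm_torusLogAt_lt _ _), torusExp_torusLogAt, div_self']
  let F : M → Torus d × Fibre f 1 := fun y => (f y, ⟨θ' (torusLogAt b (f y), y), hfib y⟩)
  let G : Torus d × Fibre f 1 → M := fun p => θ (torusLogAt b p.1, p.2.1)
  have hF : ContMDiffOn (𝓡 n) ((torusModel d).prod (𝓡 (n - d))) ∞ F (f ⁻¹' B) := by
    refine hf.contMDiff.contMDiffOn.prodMk fun y hy => ?_
    refine hf.contMDiffWithinAt_fibre ?_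
    have h1 : ContMDiffWithinAt (𝓡 n) 𝓘(ℝ, Fin d → ℝ) ∞ (fun y => torusLogAt b (f y)) (f ⁻¹' B) y :=
      (contMDiffOn_torusLogAt b).comp hf.contMDiff.contMDiffOn (fun _ h => h) y hy
    exact (hθ.contMDiffAt' (torusLogAt b (f y), y) (norm_torusLogAt_lt _ _)).comp_contMDiffWithinAt y
      (f := fun y => (torusLogAt b (f y), y)) (h1.prodMk contMDiffWithinAt_id)
  have hG : ContMDiffOn ((torusModel d).prod (𝓡 (n - d))) (𝓡 n) ∞ G (B ×ˢ univ) := by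
    intro p hp
    have h1 : ContMDiffWithinAt ((torusModel d).prod (𝓡 (n - d))) 𝓘(ℝ, Fin d → ℝ) ∞
        (fun p : Torus d × Fibre f 1 => torusLogAt b p.1) (B ×ˢ univ) p :=
      (contMDiffOn_torusLogAt b).comp contMDiff_fst.contMDiffOn (fun _ h => h.1) p hp
    have h2 : ContMDiffWithinAt ((torusModel d).prod (𝓡 (n - d))) (𝓡 n) ∞
        (fun p : Torus d × Fibre f 1 => p.2.1) (B ×ˢ univ) p :=
      ((hf.contMDiff_fibre_val 1).comp contMDiff_snd).contMDiffAt.contMDiffWithinAt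
    exact (hθ.contMDiffAt (torusLogAt b p.1, p.2.1)
      (norm_torusLogAt_lt _ _)).comp_contMDiffWithinAt p
      (f := fun p : Torus d × Fibre f 1 => (torusLogAt b p.1, p.2.1)) (h1.prodMk h2)
  have hfG : ∀ p, f (G p) = p.1 := fun p => by
    rw [hθ.map_eq _ (norm_torusLogAt_lt _ _), p.2.2, torusExp_torusLogAt, one_mul]
  refine ⟨{ toFun := F, invFun := G, source := f ⁻¹' B, target := B ×ˢ univ
            map_source' := fun y hy => ⟨hy, trivial⟩
            map_target' := fun p hp => by
              change f (G p) ∈ B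
              rw [hfG]; exact hp.1
            left_inv' := fun y _ => hθ.right_inv _ (norm_torusLogAt_lt _ _) _
            right_inv' := fun p _ => by
              refine Prod.ext (hfG p) (Subtype.ext ?_)
              change θ' (torusLogAt b (f (G p)), G p) = _
              rw [hfG]
              exact hθ.left_inv _ (norm_torusLogAt_lt _ _) _
            open_source := hBo.preimage hf.contMDiff.continuous
            open_target := hBo.prod isOpen_univ
            continuousOn_toFun := hF.continuousOn
            continuousOn_invFun := hG.continuousOn
            baseSet := B
            open_baseSet := hBo
            source_eq := rfl
            target_eq := rfl
            proj_toFun := fun y _ => rfl }, ?_, hF, hG⟩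
  change b / b ∈ torusSlit d
  rw [div_self']
  exact one_mem_torusSlit

end Ehresmann

end

section

open Filter Topology Set

/-! ### Local additive actions -/

theorem IsPreconnected.eq_of_eventually_eq {X Y : Type*} [TopologicalSpace X] {s : Set X}
    (hs : IsPreconnected s) {g : X → Y} (hg : ∀ x ∈ s, ∀ᶠ y in 𝓝[s] x, g y = g x) {x y : X}
    (hx : x ∈ s) (hy : y ∈ s) : g x = g y := by
  have := isPreconnected_iff_preconnectedSpace.1 hs
  have hl : IsLocallyConstant fun z : s => g z := by
    rw [IsLocallyConstant.iff_eventually_eq]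
    rintro ⟨z, hz⟩
    have := hg z hz
    rw [nhdsWithin_eq_map_subtype_coe hz] at this
    exact this
  exact hl.apply_eq_of_preconnectedSpace ⟨x, hx⟩ ⟨y, hy⟩

/-- `Φ u` is the 2^k-th iterate of `A (u / 2^k)` for any k that makes the argument small; local
additivity makes this independent of k. Since `u + v = v + u`, the maps `A` commute on small vectors
with small sum, which makes `Φ` additive. -/
theorem exists_action_of_local_action {V Q : Type*} [NormedAddCommGroup V] [NormedSpace ℝ V]
    (A : V → Q → Q) {ε : ℝ} (hε : 0 < ε)
    (hA : ∀ u v, ‖u‖ < ε → ‖v‖ < ε → ‖u + v‖ < ε → A (u + v) = A u ∘ A v) :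
    ∃ Φ : V → Q → Q, (∀ u v, Φ (u + v) = Φ u ∘ Φ v) ∧ ∀ u, ‖u‖ < ε → Φ u = A u := by
  have hhalf : ∀ u : V, ‖(1 / 2 : ℝ) • u‖ = ‖u‖ / 2 := fun u => by
    rw [norm_smul]; norm_num; ring
  have hsum : ∀ u : V, (1 / 2 : ℝ) • u + (1 / 2 : ℝ) • u = u := fun u => by
    rw [← add_smul]; norm_num
  have hpow : ∀ (j : ℕ) (u : V), ‖u‖ < ε → A u = (A ((1 / 2 : ℝ) ^ j • u))^[2 ^ j] := by
    intro j
    induction j with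
    | zero => intro u _; simp
    | succ j ih =>
      intro u hu
      have h1 : ‖(1 / 2 : ℝ) • u‖ < ε := by rw [hhalf]; linarith [norm_nonneg u]
      have h2 := hA _ _ h1 h1 (by rwa [hsum])
      rw [hsum, ih _ h1, ← Function.iterate_add, smul_smul] at h2
      rw [h2, pow_succ, pow_succ, mul_two]
  have hex : ∀ u : V, ∃ k : ℕ, ‖(1 / 2 : ℝ) ^ k • u‖ < ε := fun u => by
    have h1 : Tendsto (fun k : ℕ => (1 / 2 : ℝ) ^ k • u) atTop (𝓝 ((0 : ℝ) • u)) :=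
      (tendsto_pow_atTop_nhds_zero_of_lt_one (by norm_num) (by norm_num)).smul_const u
    rw [zero_smul] at h1
    have h2 := (h1.norm.eventually (gt_mem_nhds (by simpa using hε)))
    exact h2.exists
  choose k hk using hex
  have hmono : ∀ (u : V) (i j : ℕ), ‖(1 / 2 : ℝ) ^ i • u‖ < ε → i ≤ j →
      ‖(1 / 2 : ℝ) ^ j • u‖ < ε := fun u i j hi hij => by
    refine lt_of_le_of_lt ?_ hi
    rw [norm_smul, norm_smul, norm_pow, norm_pow]
    gcongr ?_ * _
    exact pow_le_pow_of_le_one (norm_nonneg _) (by norm_num) hij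
  have hindep : ∀ (u : V) (i : ℕ), ‖(1 / 2 : ℝ) ^ i • u‖ < ε → ∀ j, i ≤ j →
      (A ((1 / 2 : ℝ) ^ i • u))^[2 ^ i] = (A ((1 / 2 : ℝ) ^ j • u))^[2 ^ j] := by
    intro u i hi j hij
    obtain ⟨m, rfl⟩ := Nat.exists_eq_add_of_le hij
    rw [hpow m _ hi, ← Function.iterate_mul, smul_smul, ← pow_add, ← pow_add, add_comm m i]
  refine ⟨fun u => (A ((1 / 2 : ℝ) ^ k u • u))^[2 ^ k u], fun u v => ?_, fun u hu => ?_⟩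
  · set j := max (k (u + v)) (max (k u) (k v)) with hj
    have h1 : k (u + v) ≤ j := le_max_left _ _
    have h2 : k u ≤ j := (le_max_left _ _).trans (le_max_right _ _)
    have h3 : k v ≤ j := (le_max_right _ _).trans (le_max_right _ _)
    simp only
    rw [hindep _ _ (hk _) j h1, hindep _ _ (hk _) j h2, hindep _ _ (hk _) j h3]
    have e1 := hmono _ _ _ (hk _) h1
    have e2 := hmono _ _ _ (hk _) h2
    have e3 := hmono _ _ _ (hk _) h3
    rw [smul_add] at e1 ⊢
    have hc : Function.Commute (A ((1 / 2 : ℝ) ^ j • u)) (A ((1 / 2 : ℝ) ^ j • v)) := by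
      have c1 := hA _ _ e2 e3 e1
      have c2 := hA _ _ e3 e2 (by rwa [add_comm])
      rw [add_comm, c1] at c2
      exact fun q => congrFun c2 q
    rw [hA _ _ e2 e3 e1, hc.comp_iterate]
  · exact (hpow (k u) u hu).symm

/-! ### Paths in the fibres of a submersion to the torus -/

section FibrePath

variable {n d : ℕ} {M : Type*} [TopologicalSpace M] [ChartedSpace (EuclideanSpace ℝ (Fin n)) M]

variable (n) in
/-- `x` and `y` are joined by a smooth path on which `f` is constant. -/
def JoinedByFibrePath (f : M → Torus d) (x y : M) : Prop :=
  ∃ γ : ℝ → M, ContMDiffOn 𝓘(ℝ, ℝ) (𝓡 n) ∞ γ (Icc 0 1) ∧ γ 0 = x ∧ γ 1 = y ∧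
    ∀ t ∈ Icc (0 : ℝ) 1, f (γ t) = f x

variable (n) in
/-- `(x, v)` and `(y, w)` are joined by the graph of a local lift of `f`, up to translation. -/
def LiftStep (f : M → Torus d) (p q : M × (Fin d → ℝ)) : Prop :=
  ∃ U h, IsLocalLift (n := n) f U h ∧ IsPreconnected U ∧ p.1 ∈ U ∧ q.1 ∈ U ∧
    q.2 - p.2 = h q.1 - h p.1

variable {f : M → Torus d}

theorem JoinedByFibrePath.symm {x y : M} (h : JoinedByFibrePath n f x y) :
    JoinedByFibrePath n f y x := by
  obtain ⟨γ, hγ, h0, h1, hf⟩ := h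
  have hm : ∀ t ∈ Icc (0 : ℝ) 1, 1 - t ∈ Icc (0 : ℝ) 1 := fun t ht =>
    ⟨by linarith [ht.2], by linarith [ht.1]⟩
  refine ⟨fun t => γ (1 - t), hγ.comp (I := 𝓘(ℝ, ℝ)) ?_ hm, by simpa using h1, by simpa using h0,
    fun t ht => ?_⟩
  · exact (contDiff_const.sub contDiff_id).contMDiff.contMDiffOn
  · rw [hf _ (hm t ht), ← h1, hf 1 (by simp)]

variable (n f) in
/-- The relation of being joined by a piecewise smooth path on which `f` is constant. -/
def fibrePathSetoid : Setoid M where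
  r := Relation.ReflTransGen (JoinedByFibrePath n f)
  iseqv := ⟨fun _ => .refl,
    fun h => by
      have : Std.Symm (JoinedByFibrePath n f) := ⟨fun _ _ h => h.symm⟩
      exact Relation.ReflTransGen.stdSymm.symm _ _ h, fun h h' => h.trans h'⟩

/-- Points of one fibre have the same first coordinate in the chart, so the segment between them
stays in the fibre. -/
theorem IsAdaptedChart.joinedByFibrePath
    {φ : OpenPartialHomeomorph M ((Fin d → ℝ) × EuclideanSpace ℝ (Fin (n - d)))}
    (hφ : IsAdaptedChart (n := n) f φ) {r : ℝ} (hr : r ≤ 1)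
    {c : (Fin d → ℝ) × EuclideanSpace ℝ (Fin (n - d))}
    (ht : φ.target = Metric.ball c r) {x y : M} (hx : x ∈ φ.source) (hy : y ∈ φ.source)
    (hxy : f x = f y) : JoinedByFibrePath n f x y := by
  have hb : ∀ z ∈ φ.source, (φ z).1 ∈ Metric.ball c.1 r := fun z hz => by
    have : φ z ∈ Metric.ball c.1 r ×ˢ Metric.ball c.2 r := by
      rw [ball_prod_same, Prod.mk.eta, ← ht]; exact φ.map_source hz
    exact this.1
  have h1 : (φ x).1 = (φ y).1 := by
    refine torusExp_inj_of_mem_ball hr (hb x hx) (hb y hy) ?_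
    rw [← hφ.eq_torusExp _ hx, ← hφ.eq_torusExp _ hy, hxy]
  have hconv : Convex ℝ φ.target := by rw [ht]; exact convex_ball _ _
  have hm : ∀ t ∈ Icc (0 : ℝ) 1, φ x + t • (φ y - φ x) ∈ φ.target := fun t ht =>
    hconv.add_smul_sub_mem (φ.map_source hx) (φ.map_source hy) ht
  refine ⟨fun t => φ.symm (φ x + t • (φ y - φ x)), ?_, ?_, ?_, fun t ht => ?_⟩
  · refine hφ.contMDiffOn_symm.comp (I := 𝓘(ℝ, ℝ)) ?_ hm
    exact (contDiff_const.add (contDiff_id.smul contDiff_const)).contMDiff.contMDiffOn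
  · simp [φ.left_inv hx]
  · simp [φ.left_inv hy]
  · rw [hφ.eq_torusExp _ (φ.map_target (hm t ht)), φ.right_inv (hm t ht), hφ.eq_torusExp _ hx]
    simp [h1]

variable [IsManifold (𝓡 n) ∞ M] [CompactSpace M] [T2Space M]

/-- Small translations map fibres to fibres and so act on path classes. They need not be additive on
`M`, but they are on classes, which is enough to extend them to an action of ℝ^d. For `y` near `x`,
the point `y` and the translate of `x` by `h y - h x` lie in one fibre and one adapted chart, hence
in one class. -/
theorem IsTorusSubmersion.exists_leaf_action (hf : IsTorusSubmersion (n := n) f) :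
    ∃ Φ : (Fin d → ℝ) → Quotient (fibrePathSetoid n f) → Quotient (fibrePathSetoid n f),
      (∀ u v q, Φ (u + v) q = Φ u (Φ v q)) ∧ (∀ q, Φ 0 q = q) ∧
      ∀ U h, IsLocalLift (n := n) f U h → ∀ x ∈ U, ∀ᶠ y in 𝓝 x,
        Quotient.mk (fibrePathSetoid n f) y = Φ (h y - h x) (Quotient.mk _ x) := by
  obtain ⟨ψ, h0, hψ⟩ := hf.exists_translation
  have hall : ∀ᶠ u in 𝓝 (0 : Fin d → ℝ), ∀ x ∈ (univ : Set M),
      ContMDiffAt (𝓘(ℝ, Fin d → ℝ).prod (𝓡 n)) (𝓡 n) ∞ ψ (u, x) ∧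
        f (ψ (u, x)) = f x * torusExp u :=
    isCompact_univ.eventually_forall_of_forall_eventually fun x _ => hψ x
  obtain ⟨ε, hε, hball⟩ := Metric.eventually_nhds_iff_ball.1 hall
  have hsm : ∀ u : Fin d → ℝ, ‖u‖ < ε → ∀ x,
      ContMDiffAt (𝓘(ℝ, Fin d → ℝ).prod (𝓡 n)) (𝓡 n) ∞ ψ (u, x) := fun u hu x =>
    (hball u (by simpa using hu) x trivial).1
  have hmap : ∀ u : Fin d → ℝ, ‖u‖ < ε → ∀ x, f (ψ (u, x)) = f x * torusExp u := fun u hu x =>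
    (hball u (by simpa using hu) x trivial).2
  have hpres : ∀ u : Fin d → ℝ, ‖u‖ < ε → ∀ x y, JoinedByFibrePath n f x y →
      JoinedByFibrePath n f (ψ (u, x)) (ψ (u, y)) := by
    rintro u hu x y ⟨γ, hγ, hγ0, hγ1, hγf⟩
    refine ⟨fun t => ψ (u, γ t), fun t ht => ?_, by simp [hγ0], by simp [hγ1], fun t ht => ?_⟩
    · exact (hsm u hu (γ t)).comp_contMDiffWithinAt t (f := fun t => (u, γ t))
        (contMDiffWithinAt_const.prodMk (hγ t ht))
    · rw [hmap u hu, hmap u hu, hγf t ht]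
  have hadd : ∀ u v : Fin d → ℝ, ‖u‖ < ε → ‖v‖ < ε → ‖u + v‖ < ε → ∀ x,
      JoinedByFibrePath n f (ψ (u, ψ (v, x))) (ψ (u + v, x)) := by
    intro u v hu hv huv x
    have n1 : ∀ t ∈ Icc (0 : ℝ) 1, ‖(1 - t) • u‖ < ε := fun t ht => by
      rw [norm_smul, Real.norm_of_nonneg (by linarith [ht.2])]
      nlinarith [norm_nonneg u, ht.1]
    have n2 : ∀ t ∈ Icc (0 : ℝ) 1, ‖v + t • u‖ < ε := fun t ht => by
      have := (convex_ball (0 : Fin d → ℝ) ε).add_smul_sub_mem (x := v) (y := u + v)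
        (by simpa using hv) (by simpa using huv) ht
      simpa using this
    have s1 : ContMDiff 𝓘(ℝ, ℝ) 𝓘(ℝ, Fin d → ℝ) ∞ (fun t : ℝ => (1 - t) • u) :=
      ((contDiff_const.sub contDiff_id).smul contDiff_const).contMDiff
    have s2 : ContMDiff 𝓘(ℝ, ℝ) 𝓘(ℝ, Fin d → ℝ) ∞ (fun t : ℝ => v + t • u) :=
      (contDiff_const.add (contDiff_id.smul contDiff_const)).contMDiff
    -- The displacement `u` is handed over gradually from the outer translation to the inner one.
    -- The total stays `u + v`, so the path remains in one fibre.
    refine ⟨fun t => ψ ((1 - t) • u, ψ (v + t • u, x)), fun t ht => ?_, by simp, ?_, fun t ht => ?_⟩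
    · have h1 := (hsm _ (n2 t ht) x).comp t (f := fun t : ℝ => (v + t • u, x))
        (s2.contMDiffAt.prodMk contMDiffAt_const)
      exact ((hsm _ (n1 t ht) (ψ (v + t • u, x))).comp t
        (f := fun t : ℝ => ((1 - t) • u, ψ (v + t • u, x)))
        (s1.contMDiffAt.prodMk h1)).contMDiffWithinAt
    · simp [h0, add_comm]
    · rw [hmap _ (n1 t ht), hmap _ (n2 t ht), hmap _ hu, hmap _ hv, mul_assoc, mul_assoc,
        ← torusExp_add, ← torusExp_add]
      congr 2
      rw [sub_smul, one_smul]; abel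
  classical
  let A : (Fin d → ℝ) → Quotient (fibrePathSetoid n f) → Quotient (fibrePathSetoid n f) :=
    fun u => if hu : ‖u‖ < ε then
      Quotient.map (fun x => ψ (u, x)) fun x y hxy =>
        Relation.ReflTransGen.lift (fun x => ψ (u, x)) (hpres u hu) x y hxy
      else id
  have hAmk : ∀ u : Fin d → ℝ, ‖u‖ < ε → ∀ x, A u (Quotient.mk _ x) = Quotient.mk _ (ψ (u, x)) :=
    fun u hu x => by simp only [A, dif_pos hu]; rfl
  obtain ⟨Φ, hΦ, hΦA⟩ := exists_action_of_local_action A hε fun u v hu hv huv => by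
    funext q
    induction q using Quotient.inductionOn with
    | h x =>
      rw [Function.comp_apply, hAmk _ huv, hAmk _ hv, hAmk _ hu]
      exact Quotient.sound (Relation.ReflTransGen.single (hadd u v hu hv huv x).symm)
  refine ⟨Φ, fun u v q => congrFun (hΦ u v) q, fun q => ?_, fun U h hU x hx => ?_⟩
  · rw [hΦA 0 (by simpa using hε)]
    induction q using Quotient.inductionOn with
    | h x => rw [hAmk 0 (by simpa using hε), h0]
  · obtain ⟨φ, r, -, hr1, hxφ, -, ht, hφ⟩ := hf.exists_isAdaptedChart x univ_mem
    have hc : Tendsto (fun y => h y - h x) (𝓝 x) (𝓝 0) := by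
      have := (hU.contMDiffOn.contMDiffAt (hU.isOpen.mem_nhds hx)).continuousAt.tendsto.sub_const
        (h x)
      rwa [sub_self] at this
    have hc2 : Tendsto (fun y => ψ (h y - h x, x)) (𝓝 x) (𝓝 x) := by
      have h1 := (hψ x).self_of_nhds.1.continuousAt.tendsto
      rw [h0] at h1
      exact h1.comp (hc.prodMk_nhds tendsto_const_nhds)
    filter_upwards [hU.isOpen.mem_nhds hx, hc.norm.eventually (gt_mem_nhds (by simpa using hε)),
      hc2 (φ.open_source.mem_nhds hxφ), φ.open_source.mem_nhds hxφ] with y hy1 hy2 hy3 hy4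
    rw [hΦA _ hy2, hAmk _ hy2]
    refine Quotient.sound (Relation.ReflTransGen.single ?_)
    refine hφ.joinedByFibrePath hr1 ht hy4 hy3 ?_
    rw [hmap _ hy2, hU.eq_torusExp _ hy1, hU.eq_torusExp _ hx, ← torusExp_add]
    congr 1; abel

/-- Along a local lift `h` the class `Φ (-h z) [z]` is locally constant in `z`. Hence `Φ (-v) [x]`
is unchanged by each step, and a chain with no net change of `v` preserves the class. -/
theorem IsTorusSubmersion.reflTransGen_joinedByFibrePath (hf : IsTorusSubmersion (n := n) f)
    {x y : M} {v : Fin d → ℝ} (h : Relation.ReflTransGen (LiftStep n f) (x, v) (y, v)) :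
    Relation.ReflTransGen (JoinedByFibrePath n f) x y := by
  obtain ⟨Φ, hadd, h0, hloc⟩ := hf.exists_leaf_action
  have key : ∀ p q : M × (Fin d → ℝ), Relation.ReflTransGen (LiftStep n f) p q →
      Φ (-p.2) (Quotient.mk _ p.1) = Φ (-q.2) (Quotient.mk _ q.1) := by
    intro p q hpq
    induction hpq with
    | refl => rfl
    | @tail q s _ hstep ih =>
      rw [ih]
      obtain ⟨U, h, hU, hconn, hq, hs, heq⟩ := hstep
      have h1 := hconn.eq_of_eventually_eq
        (g := fun z => Φ (-h z) (Quotient.mk (fibrePathSetoid n f) z)) (fun z hz => by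
          refine mem_nhdsWithin_of_mem_nhds ?_
          filter_upwards [hloc U h hU z hz] with y hy
          rw [hy, ← hadd]
          congr 1; abel) hq hs
      have h2 := congrArg (Φ (h q.1 - q.2)) h1
      simp only [← hadd] at h2
      have e1 : h q.1 - q.2 + -h q.1 = -q.2 := by abel
      have e2 : h q.1 - q.2 + -h s.1 = -s.2 := by
        have : s.2 = q.2 + (h s.1 - h q.1) := by rw [← heq]; abel
        rw [this]; abel
      rwa [e1, e2] at h2
  have h1 := congrArg (Φ v) (key _ _ h)
  simp only [← hadd, add_neg_cancel, h0] at h1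
  exact Quotient.exact h1

end FibrePath

end

section

open Filter Topology Set

/-! ### Leaves and fibres -/

section Leaf

variable {n d q : ℕ} {M : Type*} [TopologicalSpace M] [ChartedSpace (EuclideanSpace ℝ (Fin n)) M]
  {f : M → Torus d} {F : Foliation n M q}

/-- Locally `h ∘ γ` has derivative zero on an interval, so it is constant there, and so is `f ∘ γ`.
-/
theorem Foliation.JoinedByTangentPath.eq_of_isLocalLift
    (hf : ∀ x, ∃ U h, x ∈ U ∧ IsLocalLift (n := n) f U h ∧
      ∀ y ∈ U, F.tangent y ≤ (mfderiv (𝓡 n) 𝓘(ℝ, Fin d → ℝ) h y).toLinearMap.ker)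
    {x y : M} (hxy : F.JoinedByTangentPath x y) : f x = f y := by
  obtain ⟨γ, hγ, rfl, rfl, htan⟩ := hxy
  refine isPreconnected_Icc.eq_of_eventually_eq (g := fun t => f (γ t)) (s := Icc (0 : ℝ) 1) ?_
    (by simp) (by simp)
  intro t ht
  obtain ⟨U, h, hU, hlift, hker⟩ := hf (γ t)
  have hcont := hγ.continuousOn t ht
  have hpre : γ ⁻¹' U ∈ 𝓝[Icc 0 1] t := hcont (hlift.isOpen.mem_nhds hU)
  obtain ⟨ε, hε, hball⟩ := Metric.mem_nhdsWithin_iff.1 hpre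
  set J := Metric.ball t ε ∩ Icc (0 : ℝ) 1 with hJ
  have hJc : Convex ℝ J := (convex_ball t ε).inter (convex_Icc 0 1)
  have hder : ∀ s ∈ J, HasFDerivWithinAt (h ∘ γ) (0 : ℝ →L[ℝ] Fin d → ℝ) J s := by
    intro s hs
    have hsU : γ s ∈ U := hball hs
    have h1 : MDifferentiableAt (𝓡 n) 𝓘(ℝ, Fin d → ℝ) h (γ s) :=
      (hlift.contMDiffOn.contMDiffAt (hlift.isOpen.mem_nhds hsU)).mdifferentiableAt (by simp)
    have h2 : MDifferentiableWithinAt 𝓘(ℝ, ℝ) (𝓡 n) γ (Icc 0 1) s :=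
      (hγ s hs.2).mdifferentiableWithinAt (by simp)
    have h3 := h1.hasMFDerivAt.comp_hasMFDerivWithinAt s h2.hasMFDerivWithinAt
    have h4 : (mfderiv (𝓡 n) 𝓘(ℝ, Fin d → ℝ) h (γ s)).comp
        (mfderivWithin 𝓘(ℝ, ℝ) (𝓡 n) γ (Icc 0 1) s) = 0 := by
      refine ContinuousLinearMap.ext_ring ?_
      exact hker _ hsU (htan s hs.2)
    rw [h4] at h3
    exact (hasMFDerivWithinAt_iff_hasFDerivWithinAt.1 h3).mono inter_subset_right
  have htJ : t ∈ J := ⟨Metric.mem_ball_self hε, ht⟩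
  have hconst : ∀ s ∈ J, (h ∘ γ) s = (h ∘ γ) t := fun s hs => by
    have := hJc.norm_image_sub_le_of_norm_hasFDerivWithin_le (C := 0) hder (by simp) htJ hs
    rwa [zero_mul, norm_le_zero_iff, sub_eq_zero] at this
  have hJn : J ∈ 𝓝[Icc 0 1] t := inter_mem (mem_nhdsWithin_of_mem_nhds (Metric.ball_mem_nhds t hε))
    self_mem_nhdsWithin
  filter_upwards [hJn] with s hs
  rw [hlift.eq_torusExp _ (hball hs), hlift.eq_torusExp _ hU]
  exact congrArg torusExp (hconst s hs)

theorem Foliation.leaf_subset_fibre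
    (hf : ∀ x, ∃ U h, x ∈ U ∧ IsLocalLift (n := n) f U h ∧
      ∀ y ∈ U, F.tangent y ≤ (mfderiv (𝓡 n) 𝓘(ℝ, Fin d → ℝ) h y).toLinearMap.ker) (x : M) :
    F.leaf x ⊆ f ⁻¹' {f x} := by
  intro y hy
  induction hy with
  | refl => rfl
  | tail _ hstep ih => exact (hstep.eq_of_isLocalLift hf).symm.trans ih

/-- As `torusExp` is injective on small balls, constancy of `f ∘ γ` makes the continuous lift `h ∘
γ` locally constant. Its derivative is then zero, endpoints included, by unique differentiability on
the closed interval. -/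
theorem JoinedByFibrePath.joinedByTangentPath
    (hf : ∀ x, ∃ U h, x ∈ U ∧ IsLocalLift (n := n) f U h ∧
      ∀ y ∈ U, (mfderiv (𝓡 n) 𝓘(ℝ, Fin d → ℝ) h y).toLinearMap.ker ≤ F.tangent y)
    {x y : M} (hxy : JoinedByFibrePath n f x y) : F.JoinedByTangentPath x y := by
  obtain ⟨γ, hγ, h0, h1, hγf⟩ := hxy
  refine ⟨γ, hγ, h0, h1, fun t ht => ?_⟩
  obtain ⟨U, h, hU, hlift, hker⟩ := hf (γ t)
  refine hker _ hU ?_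
  have h1 : MDifferentiableAt (𝓡 n) 𝓘(ℝ, Fin d → ℝ) h (γ t) :=
    (hlift.contMDiffOn.contMDiffAt (hlift.isOpen.mem_nhds hU)).mdifferentiableAt (by simp)
  have h2 : MDifferentiableWithinAt 𝓘(ℝ, ℝ) (𝓡 n) γ (Icc 0 1) t :=
    (hγ t ht).mdifferentiableWithinAt (by simp)
  let A : ℝ →L[ℝ] Fin d → ℝ := (mfderiv (𝓡 n) 𝓘(ℝ, Fin d → ℝ) h (γ t)).comp
    (mfderivWithin 𝓘(ℝ, ℝ) (𝓡 n) γ (Icc 0 1) t)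
  have h3 : HasFDerivWithinAt (h ∘ γ) A (Icc 0 1) t := hasMFDerivWithinAt_iff_hasFDerivWithinAt.1
    (h1.hasMFDerivAt.comp_hasMFDerivWithinAt t h2.hasMFDerivWithinAt)
  have hconst : h ∘ γ =ᶠ[𝓝[Icc 0 1] t] fun _ => h (γ t) := by
    have hc : ContinuousWithinAt (h ∘ γ) (Icc 0 1) t :=
      h1.continuousAt.comp_continuousWithinAt (hγ.continuousOn t ht)
    have hpre : γ ⁻¹' U ∈ 𝓝[Icc 0 1] t := hγ.continuousOn t ht (hlift.isOpen.mem_nhds hU)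
    filter_upwards [hc (Metric.ball_mem_nhds _ one_pos), hpre, self_mem_nhdsWithin] with s hs hsU hsI
    refine torusExp_inj_of_mem_ball le_rfl hs (Metric.mem_ball_self one_pos) ?_
    rw [← hlift.eq_torusExp _ hU, Function.comp_apply, ← hlift.eq_torusExp _ hsU, hγf s hsI,
      hγf t ht]
  have h4 : HasFDerivWithinAt (h ∘ γ) (0 : ℝ →L[ℝ] Fin d → ℝ) (Icc 0 1) t :=
    (hasFDerivWithinAt_const (h (γ t)) t _).congr_of_eventuallyEq hconst rfl
  have h5 := (uniqueDiffOn_Icc (zero_lt_one (α := ℝ)) t ht).eq h3 h4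
  exact DFunLike.congr_fun h5 (1 : ℝ)

end Leaf

end

section

open Filter Topology Set

/-! ### Locally exact one-forms -/

section LocallyExact

variable {n : ℕ} {M : Type*} [TopologicalSpace M] [ChartedSpace (EuclideanSpace ℝ (Fin n)) M]
  {W : Type*} [NormedAddCommGroup W] [NormedSpace ℝ W]

/-- `h` is a smooth primitive on the open set `U` of the `W`-valued one-form `α`. -/
structure IsPrimitiveOn (α : ∀ x : M, TangentSpace (𝓡 n) x →L[ℝ] W) (U : Set M) (h : M → W) :
    Prop where
  isOpen : IsOpen U
  contMDiffOn : ContMDiffOn (𝓡 n) 𝓘(ℝ, W) ∞ h U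
  hasMFDerivAt : ∀ x ∈ U, HasMFDerivAt (𝓡 n) 𝓘(ℝ, W) h x (α x)

/-- The `W`-valued one-form `α` has smooth local primitives. -/
def IsLocallyExact (α : ∀ x : M, TangentSpace (𝓡 n) x →L[ℝ] W) : Prop :=
  ∀ x, ∃ U h, x ∈ U ∧ IsPrimitiveOn α U h

theorem IsPrimitiveOn.mono {α : ∀ x : M, TangentSpace (𝓡 n) x →L[ℝ] W} {U U' : Set M} {h : M → W}
    (hU : IsPrimitiveOn α U h) (hU' : IsOpen U') (hsub : U' ⊆ U) : IsPrimitiveOn α U' h :=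
  ⟨hU', hU.contMDiffOn.mono hsub, fun x hx => hU.hasMFDerivAt x (hsub hx)⟩

theorem IsPrimitiveOn.add_const {α : ∀ x : M, TangentSpace (𝓡 n) x →L[ℝ] W} {U : Set M} {h : M → W}
    (hU : IsPrimitiveOn α U h) (c : W) : IsPrimitiveOn α U fun y => h y + c :=
  ⟨hU.isOpen, hU.contMDiffOn.add contMDiffOn_const, fun x hx => by
    exact ((hU.hasMFDerivAt x hx).add (hasMFDerivAt_const c x)).congr_mfderiv
      (ContinuousLinearMap.ext fun v => add_zero (α x v))⟩

theorem IsPrimitiveOn.clm_comp {W' : Type*} [NormedAddCommGroup W'] [NormedSpace ℝ W']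
    {α : ∀ x : M, TangentSpace (𝓡 n) x →L[ℝ] W} {U : Set M} {h : M → W}
    (hU : IsPrimitiveOn α U h) (T : W →L[ℝ] W') :
    IsPrimitiveOn (fun x => T.comp (α x)) U fun y => T (h y) :=
  ⟨hU.isOpen, T.contDiff.contMDiff.comp_contMDiffOn hU.contMDiffOn, fun x hx =>
    (T.hasMFDerivAt (x := h x)).comp x (hU.hasMFDerivAt x hx)⟩

theorem IsLocallyExact.clm_comp {W' : Type*} [NormedAddCommGroup W'] [NormedSpace ℝ W']
    {α : ∀ x : M, TangentSpace (𝓡 n) x →L[ℝ] W} (hα : IsLocallyExact α) (T : W →L[ℝ] W') :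
    IsLocallyExact (fun x => T.comp (α x)) := fun x => by
  obtain ⟨U, h, hx, hU⟩ := hα x
  exact ⟨U, _, hx, hU.clm_comp T⟩

theorem eventually_eq_of_hasMFDerivAt_zero {U : Set M} (hU : IsOpen U) {g : M → W}
    (hg : ∀ x ∈ U, HasMFDerivAt (𝓡 n) 𝓘(ℝ, W) g x (0 : TangentSpace (𝓡 n) x →L[ℝ] W)) {x : M}
    (hx : x ∈ U) [IsManifold (𝓡 n) ∞ M] : ∀ᶠ y in 𝓝 x, g y = g x := by
  set c := chartAt (EuclideanSpace ℝ (Fin n)) x with hc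
  have hxc : x ∈ c.source := mem_chart_source _ x
  set s := c.target ∩ c.symm ⁻¹' U with hs
  have hso : IsOpen s := c.isOpen_inter_preimage_symm hU
  have hxs : c x ∈ s := ⟨c.map_source hxc, by rwa [mem_preimage, c.left_inv hxc]⟩
  obtain ⟨r, hr, hball⟩ := Metric.isOpen_iff.1 hso _ hxs
  have hder : ∀ e ∈ Metric.ball (c x) r,
      HasFDerivWithinAt (g ∘ c.symm) (0 : EuclideanSpace ℝ (Fin n) →L[ℝ] W)
        (Metric.ball (c x) r) e := by
    intro e he
    have h1 : MDifferentiableAt (𝓡 n) (𝓡 n) c.symm e :=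
      mdifferentiableAt_atlas_symm (chart_mem_atlas _ x) (hball he).1
    have h2 := ((hg _ (hball he).2).comp e h1.hasMFDerivAt).congr_mfderiv
      (f₁' := (0 : EuclideanSpace ℝ (Fin n) →L[ℝ] W)) (ContinuousLinearMap.ext fun v => rfl)
    exact (hasMFDerivAt_iff_hasFDerivAt.1 h2).hasFDerivWithinAt
  have hconst : ∀ e ∈ Metric.ball (c x) r, (g ∘ c.symm) e = (g ∘ c.symm) (c x) := fun e he => by
    have := (convex_ball (c x) r).norm_image_sub_le_of_norm_hasFDerivWithin_le (C := 0) hder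
      (by simp) (Metric.mem_ball_self hr) he
    rwa [zero_mul, norm_le_zero_iff, sub_eq_zero] at this
  filter_upwards [c.open_source.mem_nhds hxc,
    (c.continuousAt hxc).preimage_mem_nhds (Metric.ball_mem_nhds _ hr)] with y hy1 hy2
  have := hconst _ hy2
  simpa only [Function.comp_apply, c.left_inv hy1, c.left_inv hxc] using this

theorem IsLocallyExact.exists_isPreconnected {α : ∀ x : M, TangentSpace (𝓡 n) x →L[ℝ] W}
    (hα : IsLocallyExact α) (x : M) :
    ∃ U h, x ∈ U ∧ IsPreconnected U ∧ IsPrimitiveOn α U h := by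
  have := ChartedSpace.locallyConnectedSpace (EuclideanSpace ℝ (Fin n)) M
  obtain ⟨U, h, hx, hU⟩ := hα x
  exact ⟨connectedComponentIn U x, h, mem_connectedComponentIn hx,
    isPreconnected_connectedComponentIn, hU.mono hU.isOpen.connectedComponentIn
      (connectedComponentIn_subset U x)⟩

variable [IsManifold (𝓡 n) ∞ M]

theorem IsPrimitiveOn.eventually_sub_eq {α : ∀ x : M, TangentSpace (𝓡 n) x →L[ℝ] W}
    {U U' : Set M} {h h' : M → W} (hU : IsPrimitiveOn α U h) (hU' : IsPrimitiveOn α U' h') {x : M}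
    (hx : x ∈ U) (hx' : x ∈ U') : ∀ᶠ y in 𝓝 x, h y - h' y = h x - h' x := by
  refine eventually_eq_of_hasMFDerivAt_zero (n := n) (U := U ∩ U') (g := fun y => h y - h' y)
    (hU.isOpen.inter hU'.isOpen) (fun y hy => ?_) ⟨hx, hx'⟩
  exact ((hU.hasMFDerivAt y hy.1).sub (hU'.hasMFDerivAt y hy.2)).congr_mfderiv
    (ContinuousLinearMap.ext fun v => sub_self (α y v))

theorem IsLocallyExact.contMDiff {α : ∀ x : M, TangentSpace (𝓡 n) x →L[ℝ] ℝ}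
    (hα : IsLocallyExact α) :
    ContMDiff (𝓡 n) ((𝓡 n).prod 𝓘(ℝ, EuclideanSpace ℝ (Fin n) →L[ℝ] ℝ)) ∞
      (fun x => Bundle.TotalSpace.mk' (EuclideanSpace ℝ (Fin n) →L[ℝ] ℝ)
        (E := fun x : M => TangentSpace (𝓡 n) x →L[ℝ] Bundle.Trivial M ℝ x) x (α x)) := by
  intro x₀
  obtain ⟨U, h, hx, hU⟩ := hα x₀
  rw [contMDiffAt_hom_bundle]
  refine ⟨contMDiffAt_id, ?_⟩
  have h1 := (hU.contMDiffOn.contMDiffAt (hU.isOpen.mem_nhds hx)).mfderiv_const (m := ∞) (by simp)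
  refine h1.congr_of_eventuallyEq ?_
  filter_upwards [hU.isOpen.mem_nhds hx] with y hy
  ext v
  simp [inTangentCoordinates, ContinuousLinearMap.inCoordinates, (hU.hasMFDerivAt y hy).mfderiv]
  rfl

/-- A locally exact real-valued one-form as a closed smooth one-form. -/
noncomputable def IsLocallyExact.toClosedOneForm {α : ∀ x : M, TangentSpace (𝓡 n) x →L[ℝ] ℝ}
    (hα : IsLocallyExact α) : closedOneForms n M :=
  ⟨⟨α, hα.contMDiff⟩, by
    intro x₀ e he v w
    set η : OneForm n M := ⟨α, hα.contMDiff⟩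
    have hφ := contMDiffOn_extChartAt_symm (I := 𝓡 n) (n := ∞) x₀
    have hopen := isOpen_extChartAt_target (I := 𝓡 n) x₀
    obtain ⟨U, h, hx, hU⟩ := hα ((extChartAt (𝓡 n) x₀).symm e)
    set s := (extChartAt (𝓡 n) x₀).target ∩ (extChartAt (𝓡 n) x₀).symm ⁻¹' U
    have hs : IsOpen s := hφ.continuousOn.isOpen_inter_preimage hopen hU.isOpen
    have hes : e ∈ s := ⟨he, hx⟩
    have hg : ContDiffOn ℝ ∞ (h ∘ (extChartAt (𝓡 n) x₀).symm) s := by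
      rw [← contMDiffOn_iff_contDiffOn]
      exact hU.contMDiffOn.comp (hφ.mono inter_subset_left) fun y hy => hy.2
    have heq : ∀ y ∈ s, η.inChart x₀ y = fderiv ℝ (h ∘ (extChartAt (𝓡 n) x₀).symm) y := by
      intro y hy
      have h1 := ((hφ y hy.1).contMDiffAt (hopen.mem_nhds hy.1)).mdifferentiableAt (by simp)
      have h3 : HasFDerivAt (h ∘ (extChartAt (𝓡 n) x₀).symm) (η.inChart x₀ y) y :=
        hasMFDerivAt_iff_hasFDerivAt.1 ((hU.hasMFDerivAt _ hy.2).comp y h1.hasMFDerivAt)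
      exact h3.fderiv.symm
    have h2 : η.inChart x₀ =ᶠ[nhds e] fderiv ℝ (h ∘ (extChartAt (𝓡 n) x₀).symm) := by
      filter_upwards [hs.mem_nhds hes] with y hy using heq y hy
    rw [h2.fderiv_eq]
    have := (hg.contDiffAt (hs.mem_nhds hes)).isSymmSndFDerivAt (by
      rw [minSmoothness_of_isRCLikeNormedField]; exact ENat.LEInfty.out)
    exact this.eq v w⟩

end LocallyExact

end

section

open Filter Topology Set

/-! ### Pointwise independent closed one-forms on a compact manifold -/

section Independent

variable {n c : ℕ} {M : Type*} [TopologicalSpace M] [ChartedSpace (EuclideanSpace ℝ (Fin n)) M]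
  {α : ∀ x : M, TangentSpace (𝓡 n) x →L[ℝ] (Fin c → ℝ)}

/-- At a maximum of `u` on the compact set `S`, which is a local maximum on `M` because `S` is open,
`l ∘ α` vanishes; surjectivity of `α` there gives `l = 0`. Allowing a clopen `S` is what yields
connectedness of `M` below. -/
theorem eq_zero_of_isExact_on (hsurj : ∀ x, Function.Surjective (α x)) {S : Set M}
    (hS : IsCompact S) (hSo : IsOpen S) (hne : S.Nonempty) {u : M → ℝ}
    (l : (Fin c → ℝ) →L[ℝ] ℝ)
    (hu : ∀ x ∈ S, HasMFDerivAt (𝓡 n) 𝓘(ℝ, ℝ) u x (l.comp (α x))) : l = 0 := by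
  obtain ⟨x, hxS, hmax⟩ := hS.exists_isMaxOn hne fun x hx =>
    (hu x hx).continuousAt.continuousWithinAt
  let A : EuclideanSpace ℝ (Fin n) →L[ℝ] ℝ := l.comp (α x)
  have h1 : HasFDerivAt (writtenInExtChartAt (𝓡 n) 𝓘(ℝ, ℝ) x u) A (extChartAt (𝓡 n) x x) := by
    have := (hu x hxS).2
    rw [ModelWithCorners.range_eq_univ] at this
    exact hasFDerivWithinAt_univ.1 this
  have h2 : IsLocalMax (writtenInExtChartAt (𝓡 n) 𝓘(ℝ, ℝ) x u) (extChartAt (𝓡 n) x x) := by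
    have h3 := (continuousAt_extChartAt_symm (I := 𝓡 n) x).preimage_mem_nhds
      (by rw [extChartAt_to_inv]; exact hSo.mem_nhds hxS)
    filter_upwards [h3] with e he
    change u ((extChartAt (𝓡 n) x).symm e) ≤ u ((extChartAt (𝓡 n) x).symm (extChartAt (𝓡 n) x x))
    rw [extChartAt_to_inv]
    exact hmax he
  have h4 : A = 0 := h2.hasFDerivAt_eq_zero h1
  refine ContinuousLinearMap.ext fun w => ?_
  obtain ⟨v, rfl⟩ := hsurj x w
  exact DFunLike.congr_fun h4 v

variable [IsManifold (𝓡 n) ∞ M]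

/-- The scalar components of `α` as closed one-forms. -/
noncomputable def IsLocallyExact.components (hα : IsLocallyExact α) :
    ((Fin c → ℝ) →L[ℝ] ℝ) →ₗ[ℝ] closedOneForms n M where
  toFun l := (hα.clm_comp l).toClosedOneForm
  map_add' _ _ := Subtype.ext (ContMDiffSection.ext fun _ => rfl)
  map_smul' _ _ := Subtype.ext (ContMDiffSection.ext fun _ => rfl)

/-- The classes of the scalar components of `α`. -/
noncomputable def IsLocallyExact.toDeRhamH1 (hα : IsLocallyExact α) :
    ((Fin c → ℝ) →L[ℝ] ℝ) →ₗ[ℝ] DeRhamH1 n M :=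
  (Submodule.mkQ _).comp hα.components

theorem IsLocallyExact.toDeRhamH1_apply (hα : IsLocallyExact α) (l : (Fin c → ℝ) →L[ℝ] ℝ) :
    hα.toDeRhamH1 l = Submodule.Quotient.mk (hα.clm_comp l).toClosedOneForm := by
  rw [IsLocallyExact.toDeRhamH1, LinearMap.comp_apply, Submodule.mkQ_apply]
  rfl

theorem finite_of_rank_eq_natCast {K W : Type*} [DivisionRing K] [AddCommGroup W] [Module K W]
    {d : ℕ} (h : Module.rank K W = d) : Module.Finite K W :=
  Module.rank_lt_aleph0_iff.1 (h ▸ Cardinal.natCast_lt_aleph0)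

theorem IsLocallyExact.toDeRhamH1_injective [CompactSpace M] [Nonempty M]
    (hα : IsLocallyExact α) (hsurj : ∀ x, Function.Surjective (α x)) :
    Function.Injective hα.toDeRhamH1 := by
  rw [injective_iff_map_eq_zero]
  intro l hl
  rw [hα.toDeRhamH1_apply] at hl
  have h1 : (hα.clm_comp l).toClosedOneForm ∈ (exactOneForms n M).submoduleOf (closedOneForms n M) :=
    (Submodule.Quotient.mk_eq_zero _).1 hl
  obtain ⟨u, hu, hul⟩ := h1
  refine eq_zero_of_isExact_on hsurj isCompact_univ isOpen_univ univ_nonempty (u := u) l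
    fun x _ => ?_
  exact ((hu.mdifferentiable (by simp)) x).hasMFDerivAt.congr_mfderiv
    (ContinuousLinearMap.ext fun v => (hul x v).symm)

theorem finrank_clm_fun (c : ℕ) : Module.finrank ℝ ((Fin c → ℝ) →L[ℝ] ℝ) = c := by
  rw [← (LinearMap.toContinuousLinearMap (𝕜 := ℝ) (E := Fin c → ℝ) (F' := ℝ)).finrank_eq]
  exact (Subspace.dual_finrank_eq (K := ℝ) (V := Fin c → ℝ)).trans (by simp)

variable [CompactSpace M] [Nonempty M]

theorem IsLocallyExact.le_of_rank_eq (hα : IsLocallyExact α)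
    (hsurj : ∀ x, Function.Surjective (α x)) {d : ℕ} (hd : Module.rank ℝ (DeRhamH1 n M) = d) :
    c ≤ d := by
  have : Module.Finite ℝ (DeRhamH1 n M) := finite_of_rank_eq_natCast hd
  have h := LinearMap.finrank_le_finrank_of_injective (hα.toDeRhamH1_injective hsurj)
  rwa [finrank_clm_fun, Module.finrank_eq_of_rank_eq hd] at h

/-- If the components of `α` span the first cohomology, then every locally exact form is
cohomologous to a linear combination of them. -/
theorem IsLocallyExact.exists_eq_add_exact (hα : IsLocallyExact α)
    (hsurj : ∀ x, Function.Surjective (α x)) (hd : Module.rank ℝ (DeRhamH1 n M) = c)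
    {β : ∀ x : M, TangentSpace (𝓡 n) x →L[ℝ] ℝ} (hβ : IsLocallyExact β) :
    ∃ (l : (Fin c → ℝ) →L[ℝ] ℝ) (u : M → ℝ), ContMDiff (𝓡 n) 𝓘(ℝ, ℝ) ∞ u ∧
      ∀ x, HasMFDerivAt (𝓡 n) 𝓘(ℝ, ℝ) u x (β x - l.comp (α x)) := by
  have : Module.Finite ℝ (DeRhamH1 n M) := finite_of_rank_eq_natCast hd
  have hs : Function.Surjective hα.toDeRhamH1 :=
    (LinearMap.injective_iff_surjective_of_finrank_eq_finrank
      (by rw [finrank_clm_fun, Module.finrank_eq_of_rank_eq hd])).1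
      (hα.toDeRhamH1_injective hsurj)
  obtain ⟨l, hl⟩ := hs (Submodule.Quotient.mk hβ.toClosedOneForm)
  rw [hα.toDeRhamH1_apply] at hl
  have h1 : hβ.toClosedOneForm - (hα.clm_comp l).toClosedOneForm ∈
      (exactOneForms n M).submoduleOf (closedOneForms n M) :=
    (Submodule.Quotient.eq _).1 hl.symm
  obtain ⟨u, hu, hul⟩ := h1
  refine ⟨l, u, hu, fun x => ?_⟩
  exact ((hu.mdifferentiable (by simp)) x).hasMFDerivAt.congr_mfderiv
    (ContinuousLinearMap.ext fun v => (hul x v).symm)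

/-- For a proper nonempty clopen `S`, the form equal to a nonzero component `l₀ ∘ α` on `S` and to 0
elsewhere is cohomologous to some `l ∘ α`. The maximum argument on `S` gives `l = l₀`, and on the
complement `l = 0`. -/
theorem IsLocallyExact.preconnectedSpace (hα : IsLocallyExact α)
    (hsurj : ∀ x, Function.Surjective (α x)) (hd : Module.rank ℝ (DeRhamH1 n M) = c)
    (hc : 0 < c) : PreconnectedSpace M := by
  classical
  rw [preconnectedSpace_iff_clopen]
  intro S hS
  by_contra! hne
  obtain ⟨hS0, hS1⟩ := hne
  let l₀ : (Fin c → ℝ) →L[ℝ] ℝ := ContinuousLinearMap.proj ⟨0, hc⟩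
  have hl₀ : l₀ ≠ 0 := fun h => by
    have := DFunLike.congr_fun h (fun _ => (1 : ℝ))
    simp [l₀] at this
  let β : ∀ x : M, TangentSpace (𝓡 n) x →L[ℝ] ℝ := fun x => if x ∈ S then l₀.comp (α x) else 0
  have hβS : ∀ x ∈ S, β x = l₀.comp (α x) := fun x hx => if_pos hx
  have hβS' : ∀ x ∈ Sᶜ, β x = 0 := fun x hx => if_neg hx
  have hβ : IsLocallyExact β := by
    intro x
    by_cases hx : x ∈ S
    · obtain ⟨U, h, hxU, hU⟩ := hα.clm_comp l₀ x
      have hU' := hU.mono (hU.isOpen.inter hS.isOpen) inter_subset_left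
      refine ⟨U ∩ S, h, ⟨hxU, hx⟩, hU'.isOpen, hU'.contMDiffOn, fun y hy => ?_⟩
      rw [hβS y hy.2]
      exact hU'.hasMFDerivAt y hy
    · refine ⟨Sᶜ, fun _ => 0, hx, hS.compl.isOpen, contMDiffOn_const, fun y hy => ?_⟩
      rw [hβS' y hy]
      exact hasMFDerivAt_const _ _
  obtain ⟨l, u, hu, hul⟩ := hα.exists_eq_add_exact hsurj hd hβ
  have e1 : l₀ - l = 0 := by
    refine eq_zero_of_isExact_on hsurj hS.isClosed.isCompact hS.isOpen
      hS0 (u := u) _ fun x hx => ?_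
    refine (hul x).congr_mfderiv ?_
    rw [hβS x hx]
    rfl
  have e2 : -l = 0 := by
    refine eq_zero_of_isExact_on hsurj hS.compl.isClosed.isCompact hS.compl.isOpen
      (nonempty_compl.2 hS1) (u := u) _ fun x hx => ?_
    refine (hul x).congr_mfderiv ?_
    rw [hβS' x hx]
    exact ContinuousLinearMap.ext fun v => zero_sub _
  rw [neg_eq_zero] at e2
  rw [e2, sub_zero] at e1
  exact hl₀ e1

end Independent

end

section

open Filter Topology Set

/-! ### Periods of a locally exact one-form -/

section Periods

variable {n : ℕ} {M : Type*} [TopologicalSpace M] [ChartedSpace (EuclideanSpace ℝ (Fin n)) M]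
  {W : Type*} [NormedAddCommGroup W] [NormedSpace ℝ W]

/-- `(x, v)` and `(y, w)` are joined by the graph of a local primitive, up to translation. -/
def PeriodStep (α : ∀ x : M, TangentSpace (𝓡 n) x →L[ℝ] W) (p q : M × W) : Prop :=
  ∃ U h, IsPrimitiveOn α U h ∧ IsPreconnected U ∧ p.1 ∈ U ∧ q.1 ∈ U ∧ q.2 - p.2 = h q.1 - h p.1

variable {α : ∀ x : M, TangentSpace (𝓡 n) x →L[ℝ] W}

theorem PeriodStep.symm {p q : M × W} (h : PeriodStep α p q) : PeriodStep α q p := by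
  obtain ⟨U, h, hU, hc, hp, hq, he⟩ := h
  exact ⟨U, h, hU, hc, hq, hp, by rw [← neg_sub, he, neg_sub]⟩

theorem PeriodStep.add_right {p q : M × W} (h : PeriodStep α p q) (a : W) :
    PeriodStep α (p.1, p.2 + a) (q.1, q.2 + a) := by
  obtain ⟨U, h, hU, hc, hp, hq, he⟩ := h
  exact ⟨U, h, hU, hc, hp, hq, by simpa using he⟩

variable (α) in
/-- The equivalence relation generated by `PeriodStep`. -/
def PeriodChain : M × W → M × W → Prop := Relation.ReflTransGen (PeriodStep α)

theorem PeriodChain.symm {p q : M × W} (h : PeriodChain α p q) : PeriodChain α q p := by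
  have : Std.Symm (PeriodStep α) := ⟨fun _ _ h => h.symm⟩
  exact Relation.ReflTransGen.stdSymm.symm _ _ h

theorem PeriodChain.add_right {p q : M × W} (h : PeriodChain α p q) (a : W) :
    PeriodChain α (p.1, p.2 + a) (q.1, q.2 + a) :=
  Relation.ReflTransGen.lift (fun p : M × W => (p.1, p.2 + a)) (fun _ _ h => h.add_right a) _ _ h

variable (α) in
/-- The group of periods of `α` along loops at `x₀`. -/
def periods (x₀ : M) : Submodule ℤ W :=
  AddSubgroup.toIntSubmodule
    { carrier := {v | PeriodChain α (x₀, 0) (x₀, v)}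
      zero_mem' := Relation.ReflTransGen.refl
      add_mem' := fun {v w} hv hw => by
        have := PeriodChain.add_right hv w
        rw [zero_add] at this
        exact Relation.ReflTransGen.trans hw this
      neg_mem' := fun {v} hv => by
        have := PeriodChain.add_right hv (-v)
        rw [zero_add, add_neg_cancel] at this
        exact this.symm }

theorem PeriodChain.sub_mem_periods {x₀ y : M} {v w : W} (hv : PeriodChain α (x₀, 0) (y, v))
    (hw : PeriodChain α (x₀, 0) (y, w)) : v - w ∈ periods α x₀ := by
  have h1 := hw.add_right (v - w)
  simp only [zero_add, add_sub_cancel] at h1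
  exact Relation.ReflTransGen.trans hv h1.symm

/-- Reachability from `x` is a locally constant property of the end point. -/
theorem IsLocallyExact.exists_periodChain [PreconnectedSpace M] (hα : IsLocallyExact α) (x y : M)
    (v : W) : ∃ w, PeriodChain α (x, v) (y, w) := by
  have h := isPreconnected_univ.eq_of_eventually_eq (X := M)
    (g := fun y => ∃ w, PeriodChain α (x, v) (y, w)) (fun y _ => by
      rw [nhdsWithin_univ]
      obtain ⟨U, h, hyU, hconn, hU⟩ := hα.exists_isPreconnected y
      filter_upwards [hU.isOpen.mem_nhds hyU] with z hz
      refine propext ⟨fun ⟨w, hw⟩ => ⟨w + (h y - h z), hw.tail ?_⟩,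
        fun ⟨w, hw⟩ => ⟨w + (h z - h y), hw.tail ?_⟩⟩
      · exact ⟨U, h, hU, hconn, hz, hyU, by simp⟩
      · exact ⟨U, h, hU, hconn, hyU, hz, by simp⟩) (mem_univ x) (mem_univ y)
  exact h.mp ⟨v, Relation.ReflTransGen.refl⟩

theorem IsCompact.finite_image_of_eventually_eq {X Y : Type*} [TopologicalSpace X] {K : Set X}
    (hK : IsCompact K) {g : X → Y} (hg : ∀ x ∈ K, ∀ᶠ y in 𝓝 x, g y = g x) : (g '' K).Finite := by
  obtain ⟨t, -, ht⟩ := hK.elim_nhds_subcover (fun x => {y | g y = g x}) hg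
  refine (t.finite_toSet.image g).subset ?_
  rintro _ ⟨x, hx, rfl⟩
  obtain ⟨i, hi, hxi⟩ := mem_iUnion₂.1 (ht hx)
  exact ⟨i, hi, hxi.symm⟩

variable [IsManifold (𝓡 n) ∞ M] [CompactSpace M] [T2Space M]

/-- Fix primitives `h i` on a finite cover by closed sets `K i`. On the compact overlaps `h i - h j`
is locally constant, so takes finitely many values, which generate a group `Γ`. Modulo `Γ` the
choice of primitive does not matter, so `v - h i y` is invariant along chains; thus all periods lie
in `Γ`, a Noetherian ℤ-module. -/
theorem IsLocallyExact.periods_fg (hα : IsLocallyExact α) (x₀ : M) : (periods α x₀).FG := by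
  classical
  choose U h hxU hU using hα
  have hK : ∀ x, ∃ K ∈ 𝓝 x, IsClosed K ∧ K ⊆ U x := fun x =>
    exists_mem_nhds_isClosed_subset ((hU x).isOpen.mem_nhds (hxU x))
  choose K hKn hKc hKU using hK
  obtain ⟨t, ht⟩ := (isCompact_univ (X := M)).elim_nhds_subcover K fun x _ => hKn x
  have ht' : ∀ y, ∃ i ∈ t, y ∈ K i := fun y => by simpa using ht.2 (mem_univ y)
  choose κ hκt hκ using ht'
  set C : Set W := ⋃ i ∈ t, ⋃ j ∈ t, (fun y => h i y - h j y) '' (K i ∩ K j) with hC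
  have hCfin : C.Finite := t.finite_toSet.biUnion fun i _ => t.finite_toSet.biUnion fun j _ =>
    ((hKc i).inter (hKc j)).isCompact.finite_image_of_eventually_eq fun x hx =>
      (hU i).eventually_sub_eq (hU j) (hKU i hx.1) (hKU j hx.2)
  set Γ : Submodule ℤ W := Submodule.span ℤ C with hΓ
  have hmem : ∀ i ∈ t, ∀ j ∈ t, ∀ y, y ∈ K i → y ∈ K j → h i y - h j y ∈ Γ :=
    fun i hi j hj y hyi hyj => Submodule.subset_span
      (mem_iUnion₂.2 ⟨i, hi, mem_iUnion₂.2 ⟨j, hj, y, ⟨hyi, hyj⟩, rfl⟩⟩)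
  have hstep : ∀ p q : M × W, PeriodStep α p q →
      (q.2 - h (κ q.1) q.1) - (p.2 - h (κ p.1) p.1) ∈ Γ := by
    rintro ⟨x, v⟩ ⟨y, w⟩ ⟨O, g, hO, hconn, hx, hy, he⟩
    simp only at hx hy he ⊢
    have h1 := hconn.eq_of_eventually_eq
      (g := fun z => Submodule.Quotient.mk (p := Γ) (g z - h (κ z) z)) (fun z hz => by
        refine mem_nhdsWithin_of_mem_nhds ?_
        -- The sets `K i` are closed, so near `z` the choice `κ` only uses indices whose set
        -- contains `z`.
        have e1 : ∀ᶠ z' in 𝓝 z, ∀ i ∈ t, z ∉ K i → z' ∉ K i := by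
          rw [eventually_all_finset]
          intro i _
          by_cases hzi : z ∈ K i
          · exact Eventually.of_forall fun _ h => absurd hzi h
          · filter_upwards [(hKc i).isOpen_compl.mem_nhds hzi] with z' hz' _ using hz'
        have e2 : ∀ᶠ z' in 𝓝 z, ∀ i ∈ t, z ∈ K i → g z' - h i z' = g z - h i z := by
          rw [eventually_all_finset]
          intro i _
          by_cases hzi : z ∈ K i
          · filter_upwards [hO.eventually_sub_eq (hU i) hz (hKU i hzi)] with z' hz' _ using hz'
          · exact Eventually.of_forall fun _ h => absurd h hzi
        filter_upwards [e1, e2] with z' h1 h2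
        have h3 : z ∈ K (κ z') := by
          by_contra h4
          exact h1 _ (hκt z') h4 (hκ z')
        rw [h2 _ (hκt z') h3, Submodule.Quotient.eq]
        have := hmem _ (hκt z) _ (hκt z') z (hκ z) h3
        convert this using 1
        abel) hx hy
    rw [eq_comm, Submodule.Quotient.eq] at h1
    convert h1 using 1
    have : w = v + (g y - g x) := by rw [← he]; abel
    rw [this]; abel
  have hchain : ∀ p q : M × W, PeriodChain α p q →
      (q.2 - h (κ q.1) q.1) - (p.2 - h (κ p.1) p.1) ∈ Γ := by
    intro p q hpq
    induction hpq with
    | refl => simp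
    | tail _ hs ih =>
      have := Γ.add_mem (hstep _ _ hs) ih
      convert this using 1
      abel
  have hle : periods α x₀ ≤ Γ := fun v hv => by simpa using hchain _ _ hv
  have : Module.Finite ℤ Γ := Module.Finite.span_of_finite ℤ hCfin
  exact isNoetherian_submodule.1 inferInstance _ hle

end Periods

-- Periods span, and additive functions on them are linear.

section Realization

variable {n c : ℕ} {M : Type*} [TopologicalSpace M] [ChartedSpace (EuclideanSpace ℝ (Fin n)) M]
  [CompactSpace M] {α : ∀ x : M, TangentSpace (𝓡 n) x →L[ℝ] (Fin c → ℝ)}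

/-- If `l` kills the periods, the integral of `l ∘ α` from `x₀` is path independent and is a global
primitive, which a maximum on the compact `M` forbids unless `l = 0`. -/
theorem IsLocallyExact.eq_zero_of_periods (hα : IsLocallyExact α) [PreconnectedSpace M]
    (hsurj : ∀ x, Function.Surjective (α x)) (x₀ : M) (l : (Fin c → ℝ) →L[ℝ] ℝ)
    (hl : ∀ v ∈ periods α x₀, l v = 0) : l = 0 := by
  choose v hv using fun y => hα.exists_periodChain x₀ y 0
  refine eq_zero_of_isExact_on hsurj isCompact_univ isOpen_univ ⟨x₀, trivial⟩
    (u := fun y => l (v y)) l fun x _ => ?_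
  obtain ⟨U, h, hxU, hconn, hU⟩ := hα.exists_isPreconnected x
  have h1 := (((hU.clm_comp l).add_const (l (v x) - l (h x))).hasMFDerivAt x hxU)
  refine h1.congr_of_eventuallyEq ?_
  filter_upwards [hU.isOpen.mem_nhds hxU] with y hy
  have h2 : PeriodChain α (x₀, 0) (y, v x + (h y - h x)) :=
    (hv x).tail ⟨U, h, hU, hconn, hxU, hy, by simp⟩
  have h3 := hl _ ((hv y).sub_mem_periods h2)
  simp only [map_sub, map_add] at h3
  linarith

/-- This is de Rham's theorem in degree one: a partition of unity produces a closed form `β` whose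
period is `φ v` wherever that of `α` is `v`. As the components of `α` span the cohomology, `β = l ∘
α + du`, and the periods agree. -/
theorem IsLocallyExact.exists_clm_eq_on_periods [IsManifold (𝓡 n) ∞ M] [T2Space M] [Nonempty M] (hα : IsLocallyExact α)
    (hsurj : ∀ x, Function.Surjective (α x)) (hd : Module.rank ℝ (DeRhamH1 n M) = c) (x₀ : M)
    (φ : (Fin c → ℝ) →+ ℝ) : ∃ l : (Fin c → ℝ) →L[ℝ] ℝ, ∀ v ∈ periods α x₀, φ v = l v := by
  classical
  choose U h hxU hU using id hα
  obtain ⟨t, ht⟩ := (isCompact_univ (X := M)).elim_nhds_subcover U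
    fun x _ => (hU x).isOpen.mem_nhds (hxU x)
  obtain ⟨ρ, hρ⟩ := SmoothPartitionOfUnity.exists_isSubordinate (𝓡 n) (isClosed_univ (X := M))
    (fun i : t => U i) (fun i => (hU i).isOpen) (fun x _ => by
      obtain ⟨i, hi, hx⟩ := mem_iUnion₂.1 (ht.2 (mem_univ x))
      exact mem_iUnion.2 ⟨⟨i, hi⟩, hx⟩)
  have hsum : ∀ x, ∑ i, ρ i x = 1 := fun x => by
    have := ρ.sum_eq_one (mem_univ x)
    rwa [finsum_eq_sum_of_fintype] at this
  -- Adding `a` to `w` adds `φ a` to `g y w`. So the differential of `g y (k y)` does not depend on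
  -- the primitive `k` of `α`, and these differentials glue to `β`.
  let g : M → (Fin c → ℝ) → ℝ := fun y w => ∑ i, ρ i y * φ (w - h i y)
  have hgadd : ∀ y w a, g y (w + a) = g y w + φ a := fun y w a => by
    simp only [g]
    calc ∑ i, ρ i y * φ (w + a - h i y) = ∑ i, (ρ i y * φ (w - h i y) + ρ i y * φ a) := by
          refine Finset.sum_congr rfl fun i _ => ?_
          rw [← mul_add, ← map_add]; congr 2; abel
      _ = _ := by rw [Finset.sum_add_distrib, ← Finset.sum_mul, hsum, one_mul]
  have hgs : ∀ O k, IsPrimitiveOn α O k →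
      ContMDiffOn (𝓡 n) 𝓘(ℝ, ℝ) ∞ (fun y => g y (k y)) O := by
    intro O k hO x hx
    refine ContMDiffAt.contMDiffWithinAt ?_
    refine ContMDiffAt.sum fun i _ => ?_
    -- The additive map `φ` may be discontinuous, but near a point of `U i` its argument `k y - h i
    -- y` is constant, and near any other point `ρ i` is zero.
    by_cases hi : x ∈ U i
    · refine ((ρ i).contMDiff.contMDiffAt.mul
        (contMDiffAt_const (c := φ (k x - h i x)))).congr_of_eventuallyEq ?_
      filter_upwards [hO.eventually_sub_eq (hU i) hx hi] with y hy
      rw [hy]; rfl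
    · refine (contMDiffAt_const (c := (0 : ℝ))).congr_of_eventuallyEq ?_
      have : x ∉ tsupport (ρ i) := fun h => hi (hρ i h)
      filter_upwards [(isClosed_tsupport (ρ i)).isOpen_compl.mem_nhds this] with y hy
      rw [image_eq_zero_of_notMem_tsupport hy, zero_mul]
  let β : ∀ x : M, TangentSpace (𝓡 n) x →L[ℝ] ℝ := fun x =>
    mfderiv (𝓡 n) 𝓘(ℝ, ℝ) (fun y => g y (h x y)) x
  have hβ : ∀ O k, IsPrimitiveOn α O k → IsPrimitiveOn β O (fun y => g y (k y)) := by
    intro O k hO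
    refine ⟨hO.isOpen, hgs O k hO, fun x hx => ?_⟩
    have h1 : HasMFDerivAt (𝓡 n) 𝓘(ℝ, ℝ) (fun y => g y (h x y)) x (β x) :=
      (((hgs _ _ (hU x)).contMDiffAt
        ((hU x).isOpen.mem_nhds (hxU x))).mdifferentiableAt (by simp)).hasMFDerivAt
    have h2 := h1.add (hasMFDerivAt_const (φ (k x - h x x)) x)
    refine (h2.congr_mfderiv (f₁' := β x)
      (ContinuousLinearMap.ext fun v => add_zero (β x v))).congr_of_eventuallyEq ?_
    filter_upwards [hO.eventually_sub_eq (hU x) hx (hxU x)] with y hy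
    rw [Pi.add_apply, ← hgadd, ← hy]
    congr 1; abel
  obtain ⟨l, u, -, hul⟩ := hα.exists_eq_add_exact hsurj hd (β := β)
    fun x => ⟨U x, _, hxU x, hβ _ _ (hU x)⟩
  -- Along a primitive of `α` this expression has differential `β - l ∘ α - du = 0`. Comparing its
  -- values at `(x₀, 0)` and `(x₀, v)` gives `φ v = l v`.
  have hstep : ∀ p q : M × (Fin c → ℝ), PeriodStep α p q →
      g p.1 p.2 - l p.2 - u p.1 = g q.1 q.2 - l q.2 - u q.1 := by
    rintro ⟨x, v⟩ ⟨y, w⟩ ⟨O, k, hO, hconn, hx, hy, he⟩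
    simp only at hx hy he ⊢
    set k' := fun z => k z + (v - k x) with hk'
    have hO' : IsPrimitiveOn α O k' := hO.add_const _
    have e1 : k' x = v := by simp [hk']
    have e2 : k' y = w := by
      have : w = v + (k y - k x) := by rw [← he]; abel
      simp only [hk']; rw [this]; abel
    have h1 := hconn.eq_of_eventually_eq (g := fun z => g z (k' z) - l (k' z) - u z)
      (fun z hz => by
        refine mem_nhdsWithin_of_mem_nhds ?_
        refine eventually_eq_of_hasMFDerivAt_zero (n := n) hO.isOpen (fun z hz => ?_) hz
        have h2 := (((hβ _ _ hO').hasMFDerivAt z hz).sub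
          ((hO'.clm_comp l).hasMFDerivAt z hz)).sub (hul z)
        exact h2.congr_mfderiv (ContinuousLinearMap.ext fun v => sub_self (β z v - l (α z v))))
      hx hy
    simp only [e1, e2] at h1
    exact h1
  have hchain : ∀ p q : M × (Fin c → ℝ), PeriodChain α p q →
      g p.1 p.2 - l p.2 - u p.1 = g q.1 q.2 - l q.2 - u q.1 := by
    intro p q hpq
    induction hpq with
    | refl => rfl
    | tail _ hs ih => exact ih.trans (hstep _ _ hs)
  refine ⟨l, fun v hv => ?_⟩
  have h1 := hchain _ _ hv
  have h2 := hgadd x₀ 0 v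
  rw [zero_add] at h2
  simp only [h2, map_zero] at h1
  linarith

end Realization

end

section

/-! ### Lattices -/

section Lattice

/-- A finitely generated subgroup `Λ` of `ℝ^c` is a lattice if it spans `ℝ^c` and each additive
function on it is the restriction of a linear one. -/
theorem exists_equiv_mem_iff_int {c : ℕ} (Λ : Submodule ℤ (Fin c → ℝ)) (hfg : Λ.FG)
    (hspan : ∀ l : (Fin c → ℝ) →L[ℝ] ℝ, (∀ v ∈ Λ, l v = 0) → l = 0)
    (hlin : ∀ φ : (Fin c → ℝ) →+ ℝ, ∃ l : (Fin c → ℝ) →L[ℝ] ℝ, ∀ v ∈ Λ, φ v = l v) :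
    ∃ B : (Fin c → ℝ) ≃L[ℝ] (Fin c → ℝ), ∀ v, v ∈ Λ ↔ ∀ j, ∃ m : ℤ, B v j = m := by
  have : Module.Finite ℤ Λ := Module.Finite.iff_fg.2 hfg
  obtain ⟨r, b⟩ := Module.basisOfFiniteTypeTorsionFree' (R := ℤ) (M := Λ)
  have hZ : LinearIndependent ℤ fun k => (b k : Fin c → ℝ) :=
    b.linearIndependent.map' Λ.subtype Λ.ker_subtype
  have hQ : LinearIndependent ℚ fun k => (b k : Fin c → ℝ) :=
    (LinearIndependent.iff_fractionRing ℤ ℚ).1 hZ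
  -- The dual basis over ℚ extends to ℚ-linear functions on all of ℝ^c. On `Λ` these agree with real
  -- linear functionals, which forces the ℤ-basis to be independent over ℝ.
  have hdual : ∀ j, ∃ l : (Fin c → ℝ) →L[ℝ] ℝ, ∀ k, l (b k) = if k = j then 1 else 0 := by
    intro j
    obtain ⟨g, hg⟩ := LinearMap.exists_extend
      ((Module.Basis.span hQ).constr ℚ fun k => if k = j then (1 : ℝ) else 0)
    obtain ⟨l, hl⟩ := hlin g.toAddMonoidHom
    refine ⟨l, fun k => ?_⟩
    rw [← hl _ (b k).2]
    have h1 : g (Module.Basis.span hQ k : Fin c → ℝ) = if k = j then 1 else 0 :=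
      (DFunLike.congr_fun hg (Module.Basis.span hQ k)).trans (Module.Basis.constr_basis _ _ _ _)
    rwa [Module.Basis.span_apply] at h1
  choose l hl using hdual
  have hrepr : ∀ v (hv : v ∈ Λ), v = ∑ k, (b.repr ⟨v, hv⟩ k) • (b k : Fin c → ℝ) := fun v hv => by
    have := congrArg Λ.subtype (b.sum_repr ⟨v, hv⟩)
    rw [map_sum] at this
    simp only [map_smul, Submodule.subtype_apply] at this
    exact this.symm
  have hR : LinearIndependent ℝ fun k => (b k : Fin c → ℝ) := by
    rw [Fintype.linearIndependent_iff]
    intro a ha j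
    have h1 := congrArg (l j) ha
    simpa [hl] using h1
  have htop : ⊤ ≤ Submodule.span ℝ (Set.range fun k => (b k : Fin c → ℝ)) := by
    by_contra hne
    obtain ⟨f, hf0, hf⟩ := Submodule.exists_le_ker_of_lt_top _ (lt_of_le_not_ge le_top hne)
    refine hf0 ?_
    have h2 : LinearMap.toContinuousLinearMap f = 0 := hspan _ fun v hv => by
      change f v = 0
      rw [hrepr v hv, map_sum]
      refine Finset.sum_eq_zero fun k _ => ?_
      rw [map_zsmul, show f (b k) = 0 from hf (Submodule.subset_span ⟨k, rfl⟩), smul_zero]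
    exact LinearMap.toContinuousLinearMap.map_eq_zero_iff.1 h2
  let e : Module.Basis (Fin r) ℝ (Fin c → ℝ) := Module.Basis.mk hR htop
  obtain rfl : r = c := by
    have := Module.finrank_eq_card_basis e
    simpa using this.symm
  refine ⟨e.equivFun.toContinuousLinearEquiv, fun v => ⟨fun hv j => ?_, fun h => ?_⟩⟩
  · refine ⟨b.repr ⟨v, hv⟩ j, ?_⟩
    have h4 : v = ∑ k, ((b.repr ⟨v, hv⟩ k : ℤ) : ℝ) • e k := by
      conv_lhs => rw [hrepr v hv]
      simp only [Int.cast_smul_eq_zsmul, e, Module.Basis.mk_apply]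
    have h5 : e.equivFun v = fun k => ((b.repr ⟨v, hv⟩ k : ℤ) : ℝ) := by
      conv_lhs => rw [h4]
      exact e.equivFun_symm_apply _ ▸ e.equivFun.apply_symm_apply _
    exact congrFun h5 j
  · choose m hm using h
    have h6 : v = ∑ k, m k • (b k : Fin r → ℝ) := by
      conv_lhs => rw [← e.sum_equivFun v]
      refine Finset.sum_congr rfl fun k _ => ?_
      rw [show e.equivFun v k = m k from hm k]
      simp only [Int.cast_smul_eq_zsmul, e, Module.Basis.mk_apply]
    rw [h6]
    exact Λ.sum_mem fun k _ => Λ.smul_mem _ (b k).2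

end Lattice

end

section

open Filter Topology Set

/-! ### The torus-valued map with given periods -/

section TorusMap

theorem torusExp_eq_iff {d : ℕ} {v w : Fin d → ℝ} :
    torusExp v = torusExp w ↔ ∀ j, ∃ m : ℤ, v j - w j = m * (2 * Real.pi) := by
  simp only [funext_iff, torusExp, Circle.exp_eq_exp]
  exact forall_congr' fun j => exists_congr fun m => sub_eq_iff_eq_add'.symm

variable {n c : ℕ} {M : Type*} [TopologicalSpace M] [ChartedSpace (EuclideanSpace ℝ (Fin n)) M]
  [CompactSpace M] [IsManifold (𝓡 n) ∞ M] [T2Space M]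
  {α : ∀ x : M, TangentSpace (𝓡 n) x →L[ℝ] (Fin c → ℝ)}

theorem IsLocallyExact.exists_isLocalLift [PreconnectedSpace M] [Nonempty M]
    (hα : IsLocallyExact α) (hsurj : ∀ x, Function.Surjective (α x))
    (hd : Module.rank ℝ (DeRhamH1 n M) = c) :
    ∃ f : M → Torus c,
      (∀ x, ∃ U h, x ∈ U ∧ IsLocalLift (n := n) f U h ∧ ∀ y ∈ U,
        (mfderiv (𝓡 n) 𝓘(ℝ, Fin c → ℝ) h y).toLinearMap.ker = (α y).toLinearMap.ker) ∧
      ∀ x y, f x = f y → Relation.ReflTransGen (JoinedByFibrePath n f) x y := by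
  obtain ⟨x₀⟩ := ‹Nonempty M›
  have : Nonempty M := ⟨x₀⟩
  obtain ⟨B, hB⟩ := exists_equiv_mem_iff_int (periods α x₀) (hα.periods_fg x₀)
    (fun l hl => hα.eq_zero_of_periods hsurj x₀ l hl)
    (fun φ => hα.exists_clm_eq_on_periods hsurj hd x₀ φ)
  have h2pi : (2 * Real.pi) ≠ 0 := by positivity
  -- The factor 2π carries the lattice of periods onto the kernel of `torusExp`.
  let T : (Fin c → ℝ) ≃L[ℝ] (Fin c → ℝ) :=
    B.trans (ContinuousLinearEquiv.smulLeft (Units.mk0 (2 * Real.pi) h2pi))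
  have hT : ∀ v j, T v j = 2 * Real.pi * B v j := fun v j => rfl
  have hexp : ∀ v w, torusExp (T v) = torusExp (T w) ↔ v - w ∈ periods α x₀ := fun v w => by
    rw [torusExp_eq_iff, hB]
    refine forall_congr' fun j => exists_congr fun m => ?_
    rw [hT, hT, map_sub, Pi.sub_apply, ← mul_sub, mul_comm, mul_left_inj' h2pi]
  -- `v y` is an arbitrary integral of `α` from `x₀` to `y`. It is determined modulo periods, which
  -- `torusExp ∘ T` does not see.
  choose v hv using fun y => hα.exists_periodChain x₀ y 0
  let f : M → Torus c := fun y => torusExp (T (v y))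
  have hlift : ∀ U h, IsPrimitiveOn α U h → IsPreconnected U → ∀ x ∈ U,
      IsLocalLift (n := n) f U (fun y => T (h y + (v x - h x))) ∧ ∀ y ∈ U,
        HasMFDerivAt (𝓡 n) 𝓘(ℝ, Fin c → ℝ) (fun y => T (h y + (v x - h x))) y
          ((T : (Fin c → ℝ) →L[ℝ] (Fin c → ℝ)).comp (α y)) := by
    intro U h hU hconn x hx
    have h1 := (hU.add_const (v x - h x)).clm_comp (T : (Fin c → ℝ) →L[ℝ] (Fin c → ℝ))
    refine ⟨⟨hU.isOpen, h1.contMDiffOn, fun y hy => ?_, fun y hy => ?_⟩, h1.hasMFDerivAt⟩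
    · refine (hexp _ _).2 ((hv y).sub_mem_periods ((hv x).tail ⟨U, h, hU, hconn, hx, hy, ?_⟩))
      simp only
      abel
    · have h2 : Function.Surjective ((T : (Fin c → ℝ) →L[ℝ] (Fin c → ℝ)).comp (α y)) :=
        T.surjective.comp (hsurj y)
      rw [← (h1.hasMFDerivAt y hy).mfderiv] at h2
      exact h2
  have hsub : ∀ x, ∃ U h, x ∈ U ∧ IsLocalLift (n := n) f U h ∧ ∀ y ∈ U,
      (mfderiv (𝓡 n) 𝓘(ℝ, Fin c → ℝ) h y).toLinearMap.ker = (α y).toLinearMap.ker := by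
    intro x
    obtain ⟨U, h, hxU, hconn, hU⟩ := hα.exists_isPreconnected x
    obtain ⟨h1, h2⟩ := hlift U h hU hconn x hxU
    refine ⟨U, _, hxU, h1, fun y hy => ?_⟩
    rw [(h2 y hy).mfderiv]
    ext u
    exact T.map_eq_zero_iff
  refine ⟨f, hsub, fun x y hxy => ?_⟩
  have hf : IsTorusSubmersion (n := n) f := fun x => by
    obtain ⟨U, h, hx, hU, -⟩ := hsub x
    exact ⟨U, h, hx, hU⟩
  have hloop : v x - v y ∈ periods α x₀ := (hexp _ _).1 hxy
  -- Going back from `x` to `x₀`, around a loop of period `v x - v y`, and on to `y` gives total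
  -- integral zero.
  have hchain : PeriodChain α (x, v x) (y, v x) := by
    have h1 := (hv y).add_right (v x - v y)
    rw [zero_add, add_sub_cancel] at h1
    exact (hv x).symm.trans (Relation.ReflTransGen.trans hloop h1)
  refine hf.reflTransGen_joinedByFibrePath (v := T (v x)) ?_
  refine Relation.ReflTransGen.lift (fun p : M × (Fin c → ℝ) => (p.1, T p.2)) ?_ _ _ hchain
  rintro ⟨a, s⟩ ⟨b, t⟩ ⟨U, h, hU, hconn, ha, hb, he⟩
  refine ⟨U, _, (hlift U h hU hconn a ha).1, hconn, ha, hb, ?_⟩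
  simp only at he ⊢
  rw [← map_sub, ← map_sub, he]
  congr 1
  abel

end TorusMap

end

section

open Filter Topology Set

/-! ### Left-invariant one-forms -/

section Frame

/-- Differentiating the constant `η (V w)` gives `Dη(a)(V w) = -η(D(V w) a)`, so the antisymmetric
part of `Dη` on two frame fields is minus `η` of their bracket, which is zero. -/
theorem fderiv_apply_comm_of_frame {E W L : Type*} [NormedAddCommGroup E] [NormedSpace ℝ E]
    [NormedAddCommGroup W] [NormedSpace ℝ W] {η : E → E →L[ℝ] W} {e : E}
    (hη : DifferentiableAt ℝ η e) (V : L → E → E) (hV : ∀ v, DifferentiableAt ℝ (V v) e)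
    (p : L → W) (hconst : ∀ v, ∀ᶠ y in 𝓝 e, η y (V v y) = p v)
    (hbr : ∀ v w, η e (VectorField.lieBracket ℝ (V v) (V w) e) = 0)
    (hsurj : ∀ x, ∃ v, V v e = x) (x y : E) : fderiv ℝ η e x y = fderiv ℝ η e y x := by
  have key : ∀ w a, fderiv ℝ η e a (V w e) = - η e (fderiv ℝ (V w) e a) := fun w a => by
    have h1 := hη.hasFDerivAt.clm_apply (hV w).hasFDerivAt
    have h2 : HasFDerivAt (fun y => η y (V w y)) (0 : E →L[ℝ] W) e :=
      (hasFDerivAt_const (p w) e).congr_of_eventuallyEq (hconst w)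
    have h3 := DFunLike.congr_fun (h1.unique h2) a
    simp only [add_apply, ContinuousLinearMap.comp_apply,
      ContinuousLinearMap.flip_apply, zero_apply] at h3
    rw [eq_neg_iff_add_eq_zero, add_comm]
    exact h3
  obtain ⟨v, rfl⟩ := hsurj x
  obtain ⟨w, rfl⟩ := hsurj y
  have h4 := hbr v w
  rw [VectorField.lieBracket_eq, map_sub, sub_eq_zero] at h4
  rw [key, key, h4]

end Frame

section LeftInvariant

variable {q : ℕ} {G : Type*} [TopologicalSpace G] [Group G]
  [ChartedSpace (EuclideanSpace ℝ (Fin q)) G]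
  {W : Type*} [NormedAddCommGroup W] [NormedSpace ℝ W]

/-- The left-invariant one-form on `G` with value `p` at the identity. -/
noncomputable def leftInvariantForm (p : EuclideanSpace ℝ (Fin q) →L[ℝ] W) (g : G) :
    TangentSpace (𝓡 q) g →L[ℝ] W :=
  let D : EuclideanSpace ℝ (Fin q) →L[ℝ] EuclideanSpace ℝ (Fin q) :=
    mfderiv (𝓡 q) (𝓡 q) (fun y : G => g⁻¹ * y) g
  p.comp D

theorem leftInvariantForm_one (p : EuclideanSpace ℝ (Fin q) →L[ℝ] W)
    (v : EuclideanSpace ℝ (Fin q)) : leftInvariantForm p (1 : G) v = p v := by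
  have h1 : (fun y : G => (1 : G)⁻¹ * y) = id := by funext y; simp
  -- The map and its derivative are generalized before substituting, since the type of the
  -- derivative depends on the map although all tangent spaces are the model space.
  have h2 : ∀ (f : G → G), f = id → ∀ D : EuclideanSpace ℝ (Fin q) →L[ℝ] EuclideanSpace ℝ (Fin q),
      mfderiv (𝓡 q) (𝓡 q) f 1 = D → D v = v := by
    rintro _ rfl _ rfl
    rw [mfderiv_id]
    rfl
  exact congrArg p (h2 _ h1 _ rfl)

variable [LieGroup (𝓡 q) ∞ G]

theorem hasMFDerivAt_mul_left (a g : G) :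
    HasMFDerivAt (𝓡 q) (𝓡 q) (fun y : G => a * y) g
      (mfderiv (𝓡 q) (𝓡 q) (fun y : G => a * y) g) :=
  ((contMDiff_mul_left (I := 𝓡 q) (n := ∞) (a := a)).mdifferentiable (by simp) g).hasMFDerivAt

/-- Left translation by `a` followed by that by `(a * g)⁻¹` is left translation by `g⁻¹`; the claim
is the chain rule. -/
theorem leftInvariantForm_comp_mul_left (p : EuclideanSpace ℝ (Fin q) →L[ℝ] W) (a g : G)
    (v : EuclideanSpace ℝ (Fin q)) :
    leftInvariantForm p (a * g) (mfderiv (𝓡 q) (𝓡 q) (fun y : G => a * y) g v) =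
      leftInvariantForm p g v := by
  have h1 := (hasMFDerivAt_mul_left (q := q) (a * g)⁻¹ (a * g)).comp g (hasMFDerivAt_mul_left a g)
  have h2 : (fun y : G => (a * g)⁻¹ * y) ∘ (fun y : G => a * y) = fun y : G => g⁻¹ * y := by
    funext y
    simp [mul_assoc]
  rw [h2] at h1
  have h3 := h1.mfderiv
  have h4 : ∀ D : EuclideanSpace ℝ (Fin q) →L[ℝ] EuclideanSpace ℝ (Fin q),
      mfderiv (𝓡 q) (𝓡 q) (fun y : G => g⁻¹ * y) g = D →
      leftInvariantForm p g v = p (D v) := by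
    rintro D rfl
    rfl
  exact (h4 _ h3).symm

theorem leftInvariantForm_mulInvariantVectorField (p : EuclideanSpace ℝ (Fin q) →L[ℝ] W)
    (v : GroupLieAlgebra (𝓡 q) G) (g : G) :
    leftInvariantForm p g (mulInvariantVectorField v g) = p v := by
  have h1 := (leftInvariantForm_comp_mul_left p g (1 : G) v).trans (leftInvariantForm_one p v)
  rw [← h1]
  have h2 : ∀ g' : G, g' = g → ∀ u : EuclideanSpace ℝ (Fin q),
      (leftInvariantForm p g' : EuclideanSpace ℝ (Fin q) →L[ℝ] W) u = leftInvariantForm p g u := by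
    rintro _ rfl u
    rfl
  exact (h2 _ (mul_one g) _).symm

theorem surjective_leftInvariantForm {p : EuclideanSpace ℝ (Fin q) →L[ℝ] W}
    (hp : Function.Surjective p) (g : G) : Function.Surjective (leftInvariantForm p g) := fun w => by
  obtain ⟨v, rfl⟩ := hp w
  exact ⟨_, leftInvariantForm_mulInvariantVectorField (G := G) p v g⟩

/-- Left-invariant vector fields span each tangent space. -/
theorem exists_mulInvariantVectorField_eq (g : G) (u : TangentSpace (𝓡 q) g) :
    ∃ v : GroupLieAlgebra (𝓡 q) G, mulInvariantVectorField v g = u := by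
  let L : EuclideanSpace ℝ (Fin q) →ₗ[ℝ] EuclideanSpace ℝ (Fin q) :=
    { toFun := fun v => mulInvariantVectorField (v : GroupLieAlgebra (𝓡 q) G) g
      map_add' := fun v w => congrFun (mulInvariantVectorField_add (I := 𝓡 q) (G := G) v w) g
      map_smul' := fun a v => congrFun (mulInvariantVectorField_smul (I := 𝓡 q) (G := G) a v) g }
  have hL : Function.Injective L := by
    intro v w h
    have h1 := leftInvariantForm_mulInvariantVectorField (ContinuousLinearMap.id ℝ _) v g
    have h2 := leftInvariantForm_mulInvariantVectorField (ContinuousLinearMap.id ℝ _) w g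
    have h3 : mulInvariantVectorField v g = mulInvariantVectorField w g := h
    rw [h3] at h1
    exact h1.symm.trans h2
  exact (LinearMap.injective_iff_surjective (f := L)).1 hL u

theorem injective_leftInvariantForm {p : EuclideanSpace ℝ (Fin q) →L[ℝ] W}
    (hp : Function.Injective p) (g : G) : Function.Injective (leftInvariantForm p g) := by
  intro u u' h
  obtain ⟨v, rfl⟩ := exists_mulInvariantVectorField_eq g u
  obtain ⟨w, rfl⟩ := exists_mulInvariantVectorField_eq g u'
  rw [leftInvariantForm_mulInvariantVectorField, leftInvariantForm_mulInvariantVectorField] at h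
  rw [hp h]

end LeftInvariant

end

section

open Filter Topology Set

-- Local primitives of left-invariant forms that kill brackets.

section LeftInvariantExact

variable {q : ℕ} {G : Type*} [TopologicalSpace G] [Group G]
  [ChartedSpace (EuclideanSpace ℝ (Fin q)) G] [LieGroup (𝓡 q) ∞ G]
  {W : Type*} [NormedAddCommGroup W] [NormedSpace ℝ W]

theorem hasMFDerivAt_extChartAt_symm {e : EuclideanSpace ℝ (Fin q)} {x₀ : G}
    (he : e ∈ (extChartAt (𝓡 q) x₀).target) :
    HasMFDerivAt 𝓘(ℝ, EuclideanSpace ℝ (Fin q)) (𝓡 q) (extChartAt (𝓡 q) x₀).symm e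
      (mfderiv 𝓘(ℝ, EuclideanSpace ℝ (Fin q)) (𝓡 q) (extChartAt (𝓡 q) x₀).symm e) :=
  (((contMDiffOn_extChartAt_symm (I := 𝓡 q) (n := ∞) x₀ e he).contMDiffAt
    ((isOpen_extChartAt_target x₀).mem_nhds he)).mdifferentiableAt (by simp)).hasMFDerivAt

theorem hasMFDerivAt_extChartAt' {x x₀ : G} (hx : x ∈ (extChartAt (𝓡 q) x₀).source) :
    HasMFDerivAt (𝓡 q) 𝓘(ℝ, EuclideanSpace ℝ (Fin q)) (extChartAt (𝓡 q) x₀) x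
      (mfderiv (𝓡 q) 𝓘(ℝ, EuclideanSpace ℝ (Fin q)) (extChartAt (𝓡 q) x₀) x) :=
  ((contMDiffAt_extChartAt' (I := 𝓡 q) (n := ∞) (by
    rwa [extChartAt_source] at hx)).mdifferentiableAt (by simp)).hasMFDerivAt

/-- The expression of the left-invariant one-form in the preferred chart at the identity. -/
noncomputable def leftInvariantFormInChart (G : Type*) [TopologicalSpace G] [Group G]
    [ChartedSpace (EuclideanSpace ℝ (Fin q)) G]
    (p : EuclideanSpace ℝ (Fin q) →L[ℝ] W) (e : EuclideanSpace ℝ (Fin q)) :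
    EuclideanSpace ℝ (Fin q) →L[ℝ] W :=
  let ψ := (extChartAt (𝓡 q) (1 : G)).symm
  let D : EuclideanSpace ℝ (Fin q) →L[ℝ] EuclideanSpace ℝ (Fin q) :=
    mfderiv 𝓘(ℝ, EuclideanSpace ℝ (Fin q)) (𝓡 q) ψ e
  let η : EuclideanSpace ℝ (Fin q) →L[ℝ] W := leftInvariantForm p (ψ e)
  η.comp D

/-- The multiplication `(e, y) ↦ e⁻¹ y`, read in the chart, is jointly smooth near the diagonal. Its
derivative in `y` at `y = e` is the form for `p = id` followed by the invertible derivative `D₁` of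
the chart at 1; undoing `D₁` and applying `p` gives the form in question. -/
theorem contDiffOn_leftInvariantFormInChart (p : EuclideanSpace ℝ (Fin q) →L[ℝ] W) :
    ContDiffOn ℝ ∞ (leftInvariantFormInChart G p) (extChartAt (𝓡 q) (1 : G)).target := by
  intro e₀ he₀
  set φ := extChartAt (𝓡 q) (1 : G) with hφ
  have hT : IsOpen φ.target := isOpen_extChartAt_target _
  have hψs : ContMDiffOn 𝓘(ℝ, EuclideanSpace ℝ (Fin q)) (𝓡 q) ∞ φ.symm φ.target :=
    contMDiffOn_extChartAt_symm _
  have h1s : (1 : G) ∈ φ.source := mem_extChartAt_source _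
  have h1t : φ 1 ∈ φ.target := mem_extChartAt_target _
  let D₁ : EuclideanSpace ℝ (Fin q) →L[ℝ] EuclideanSpace ℝ (Fin q) :=
    mfderiv (𝓡 q) 𝓘(ℝ, EuclideanSpace ℝ (Fin q)) φ 1
  let D₂ : EuclideanSpace ℝ (Fin q) →L[ℝ] EuclideanSpace ℝ (Fin q) :=
    mfderiv 𝓘(ℝ, EuclideanSpace ℝ (Fin q)) (𝓡 q) φ.symm (φ 1)
  have hD : ∀ v, D₂ (D₁ v) = v := by
    have h1 := (hasMFDerivAt_extChartAt_symm h1t).comp 1 (hasMFDerivAt_extChartAt' h1s)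
    have h2 : HasMFDerivAt (𝓡 q) (𝓡 q) (φ.symm ∘ φ) 1 (ContinuousLinearMap.id ℝ _) := by
      refine (hasMFDerivAt_id (1 : G)).congr_of_eventuallyEq ?_
      filter_upwards [(isOpen_extChartAt_source (I := 𝓡 q) (1 : G)).mem_nhds h1s] with y hy
      exact φ.left_inv hy
    have h3 := h1.mfderiv.symm.trans h2.mfderiv
    exact fun v => DFunLike.congr_fun h3 v
  let μ : EuclideanSpace ℝ (Fin q) → EuclideanSpace ℝ (Fin q) → EuclideanSpace ℝ (Fin q) :=
    fun e y => φ ((φ.symm e)⁻¹ * φ.symm y)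
  have hμ : ∀ e ∈ φ.target, HasFDerivAt (μ e)
      (D₁.comp (leftInvariantFormInChart G (ContinuousLinearMap.id ℝ _) e)) e := by
    intro e he
    have h1 : HasMFDerivAt (𝓡 q) 𝓘(ℝ, EuclideanSpace ℝ (Fin q)) φ
        ((φ.symm e)⁻¹ * φ.symm e) D₁ := by
      rw [inv_mul_cancel]
      exact hasMFDerivAt_extChartAt' h1s
    exact hasMFDerivAt_iff_hasFDerivAt.1
      ((h1.comp (φ.symm e) (hasMFDerivAt_mul_left _ _)).comp e (hasMFDerivAt_extChartAt_symm he))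
  have hμs : ContDiffAt ℝ ∞ (Function.uncurry μ) (e₀, e₀) := by
    rw [← contMDiffAt_iff_contDiffAt]
    have hψ := (hψs e₀ he₀).contMDiffAt (hT.mem_nhds he₀)
    have h1 : ContMDiffAt 𝓘(ℝ, EuclideanSpace ℝ (Fin q) × EuclideanSpace ℝ (Fin q)) (𝓡 q) ∞
        (fun z : EuclideanSpace ℝ (Fin q) × EuclideanSpace ℝ (Fin q) => φ.symm z.1) (e₀, e₀) :=
      ContMDiffAt.comp (e₀, e₀) (f := Prod.fst) hψ contDiff_fst.contMDiff.contMDiffAt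
    have h2 : ContMDiffAt 𝓘(ℝ, EuclideanSpace ℝ (Fin q) × EuclideanSpace ℝ (Fin q)) (𝓡 q) ∞
        (fun z : EuclideanSpace ℝ (Fin q) × EuclideanSpace ℝ (Fin q) => φ.symm z.2) (e₀, e₀) :=
      ContMDiffAt.comp (e₀, e₀) (f := Prod.snd) hψ contDiff_snd.contMDiff.contMDiffAt
    have h3 : ContMDiffAt (𝓡 q) 𝓘(ℝ, EuclideanSpace ℝ (Fin q)) ∞ φ
        ((φ.symm e₀)⁻¹ * φ.symm e₀) := by
      rw [inv_mul_cancel]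
      exact contMDiffAt_extChartAt
    exact ContMDiffAt.comp (e₀, e₀)
      (f := fun z : EuclideanSpace ℝ (Fin q) × EuclideanSpace ℝ (Fin q) =>
        (φ.symm z.1)⁻¹ * φ.symm z.2) h3 (h1.inv.mul h2)
  have hd : ContDiffAt ℝ ∞ (fun e => fderiv ℝ (μ e) e) e₀ :=
    ContDiffAt.fderiv (f := μ) (g := id) hμs contDiffAt_id (by simp)
  refine ContDiffAt.contDiffWithinAt ?_
  refine (contDiffAt_const (c := p.comp D₂)).clm_comp hd |>.congr_of_eventuallyEq ?_
  filter_upwards [hT.mem_nhds he₀] with e he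
  rw [(hμ e he).fderiv]
  ext v
  exact congrArg p (hD _).symm

/-- The left-invariant fields, pulled back to the chart, are a frame on which the form takes
constant values. Brackets of these fields come from brackets in the Lie algebra, which `p` kills. -/
theorem fderiv_leftInvariantFormInChart_comm {p : EuclideanSpace ℝ (Fin q) →L[ℝ] W}
    (hp : ∀ v w : GroupLieAlgebra (𝓡 q) G, p (⁅v, w⁆ : GroupLieAlgebra (𝓡 q) G) = 0) {e : EuclideanSpace ℝ (Fin q)}
    (he : e ∈ (extChartAt (𝓡 q) (1 : G)).target) (x y : EuclideanSpace ℝ (Fin q)) :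
    fderiv ℝ (leftInvariantFormInChart G p) e x y =
      fderiv ℝ (leftInvariantFormInChart G p) e y x := by
  have : IsManifold (𝓡 q) (minSmoothness ℝ 2) G := .of_le (n := ∞) (by
    rw [minSmoothness_of_isRCLikeNormedField]; exact ENat.LEInfty.out)
  set φ := extChartAt (𝓡 q) (1 : G) with hφ
  have hT : IsOpen φ.target := isOpen_extChartAt_target _
  have hψ : ∀ e ∈ φ.target, ContMDiffAt 𝓘(ℝ, EuclideanSpace ℝ (Fin q)) (𝓡 q) ∞ φ.symm e :=
    fun e he => (contMDiffOn_extChartAt_symm _ e he).contMDiffAt (hT.mem_nhds he)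
  have hinv : ∀ e ∈ φ.target,
      (mfderiv 𝓘(ℝ, EuclideanSpace ℝ (Fin q)) (𝓡 q) φ.symm e).IsInvertible := fun e he => by
    have h1 := isInvertible_mfderivWithin_extChartAt_symm (I := 𝓡 q) (x := (1 : G)) he
    rwa [ModelWithCorners.range_eq_univ, mfderivWithin_univ] at h1
  let V : GroupLieAlgebra (𝓡 q) G → EuclideanSpace ℝ (Fin q) → EuclideanSpace ℝ (Fin q) :=
    fun v => VectorField.mpullback 𝓘(ℝ, EuclideanSpace ℝ (Fin q)) (𝓡 q) φ.symm
      (mulInvariantVectorField v)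
  have hV : ∀ v, ∀ e ∈ φ.target, leftInvariantFormInChart G p e (V v e) = p v := by
    intro v e he
    have h1 := (hinv e he).self_apply_inverse (mulInvariantVectorField v (φ.symm e))
    exact (congrArg (leftInvariantForm p (φ.symm e)) h1).trans
      (leftInvariantForm_mulInvariantVectorField p v _)
  refine fderiv_apply_comm_of_frame
    (((contDiffOn_leftInvariantFormInChart p).contDiffAt (hT.mem_nhds he)).differentiableAt
      (by simp)) V (fun v => ?_) (fun v => p v) (fun v => ?_) (fun v w => ?_) (fun u => ?_) x y
  · have h1 := ContMDiffAt.mpullback_vectorField_preimage (m := 1) (n := ∞) (f := φ.symm)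
      (x₀ := e) ((contMDiffAt_mulInvariantVectorField (I := 𝓡 q) v).of_le (by
        rw [minSmoothness_of_isRCLikeNormedField]; exact one_le_two)) (hψ e he) (hinv e he)
      (by rw [one_add_one_eq_two]; exact ENat.LEInfty.out)
    exact (contMDiffAt_vectorSpace_iff_contDiffAt.1 h1).differentiableAt one_ne_zero
  · filter_upwards [hT.mem_nhds he] with y hy using hV v y hy
  · have h1 := VectorField.mpullback_mlieBracket (n := ∞) (f := φ.symm) (x₀ := e)
      (mdifferentiableAt_mulInvariantVectorField (I := 𝓡 q) v)
      (mdifferentiableAt_mulInvariantVectorField (I := 𝓡 q) w) (hψ e he) (by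
        rw [minSmoothness_of_isRCLikeNormedField]; exact ENat.LEInfty.out)
    rw [← mulInvariantVector_mlieBracket, ← GroupLieAlgebra.bracket_def,
      ← VectorField.mlieBracketWithin_univ (I := 𝓘(ℝ, EuclideanSpace ℝ (Fin q))),
      VectorField.mlieBracketWithin_eq_lieBracketWithin] at h1
    have h2 : VectorField.lieBracket ℝ (V v) (V w) e = V ⁅v, w⁆ e :=
      (h1.trans (congrFun (VectorField.lieBracketWithin_univ (V := V v) (W := V w)) e)).symm
    rw [h2, hV _ e he, hp]
  · obtain ⟨v, hv⟩ := exists_mulInvariantVectorField_eq (φ.symm e)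
      (mfderiv 𝓘(ℝ, EuclideanSpace ℝ (Fin q)) (𝓡 q) φ.symm e u)
    refine ⟨v, ?_⟩
    have := (hinv e he).inverse_apply_self u
    rw [← hv] at this
    exact this

/-- The Poincaré lemma on a ball in the chart at 1 gives a primitive there, which is carried back to
`G`. -/
theorem exists_isPrimitiveOn_leftInvariantForm_one [CompleteSpace W]
    {p : EuclideanSpace ℝ (Fin q) →L[ℝ] W}
    (hp : ∀ v w : GroupLieAlgebra (𝓡 q) G, p (⁅v, w⁆ : GroupLieAlgebra (𝓡 q) G) = 0) :
    ∃ U h, (1 : G) ∈ U ∧ IsPrimitiveOn (leftInvariantForm (G := G) p) U h := by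
  set φ := extChartAt (𝓡 q) (1 : G) with hφ
  have h1s : (1 : G) ∈ φ.source := mem_extChartAt_source _
  have h1t : φ 1 ∈ φ.target := mem_extChartAt_target _
  have hω := contDiffOn_leftInvariantFormInChart (G := G) p
  obtain ⟨r, hr, hball⟩ := Metric.isOpen_iff.1 (isOpen_extChartAt_target (I := 𝓡 q) (1 : G)) _ h1t
  obtain ⟨h, hh⟩ := (convex_ball (φ 1) r).exists_forall_hasFDerivAt_of_fderiv_symmetric
    Metric.isOpen_ball ((hω.mono hball).differentiableOn (by simp))
    fun a ha => fderiv_leftInvariantFormInChart_comm hp (hball ha)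
  have hs : ContDiffOn ℝ ∞ h (Metric.ball (φ 1) r) := by
    rw [contDiffOn_infty_iff_fderiv_of_isOpen Metric.isOpen_ball]
    exact ⟨fun a ha => (hh a ha).differentiableAt.differentiableWithinAt,
      (hω.mono hball).congr fun a ha => (hh a ha).fderiv⟩
  have hφs : ContMDiffOn (𝓡 q) 𝓘(ℝ, EuclideanSpace ℝ (Fin q)) ∞ φ φ.source := fun x hx =>
    (contMDiffAt_extChartAt' (I := 𝓡 q) (n := ∞) (by
      rwa [hφ, extChartAt_source] at hx)).contMDiffWithinAt
  refine ⟨φ.source ∩ φ ⁻¹' Metric.ball (φ 1) r, h ∘ φ, ⟨h1s, Metric.mem_ball_self hr⟩,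
    hφs.continuousOn.isOpen_inter_preimage (isOpen_extChartAt_source _) Metric.isOpen_ball,
    hs.contMDiffOn.comp (hφs.mono inter_subset_left) fun x hx => hx.2, fun x hx => ?_⟩
  have h2 := (hasMFDerivAt_iff_hasFDerivAt.2 (hh _ hx.2)).comp x (hasMFDerivAt_extChartAt' hx.1)
  refine h2.congr_mfderiv (ContinuousLinearMap.ext fun v => ?_)
  have h3 : HasMFDerivAt (𝓡 q) (𝓡 q) (φ.symm ∘ φ) x (ContinuousLinearMap.id ℝ _) := by
    refine (hasMFDerivAt_id x).congr_of_eventuallyEq ?_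
    filter_upwards [(isOpen_extChartAt_source (I := 𝓡 q) (1 : G)).mem_nhds hx.1] with y hy
    exact φ.left_inv hy
  have h4 := (hasMFDerivAt_extChartAt_symm (hball hx.2)).comp x (hasMFDerivAt_extChartAt' hx.1)
  have h5 := h4.mfderiv.symm.trans h3.mfderiv
  have h6 : ∀ g : G, g = x → ∀ u : EuclideanSpace ℝ (Fin q),
      (leftInvariantForm p g : EuclideanSpace ℝ (Fin q) →L[ℝ] W) u = leftInvariantForm p x u := by
    rintro _ rfl u
    rfl
  exact (h6 _ (φ.left_inv hx.1) _).trans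
    (congrArg (leftInvariantForm p x) (DFunLike.congr_fun h5 v))

/-- By left invariance, a primitive near 1 composed with translation by `g⁻¹` is a primitive near
`g`. -/
theorem isLocallyExact_leftInvariantForm [CompleteSpace W]
    {p : EuclideanSpace ℝ (Fin q) →L[ℝ] W}
    (hp : ∀ v w : GroupLieAlgebra (𝓡 q) G, p (⁅v, w⁆ : GroupLieAlgebra (𝓡 q) G) = 0) :
    IsLocallyExact (leftInvariantForm (G := G) p) := by
  intro g
  obtain ⟨U, h, h1, hU⟩ := exists_isPrimitiveOn_leftInvariantForm_one hp
  have hs : ContMDiff (𝓡 q) (𝓡 q) ∞ (fun y : G => g⁻¹ * y) := contMDiff_mul_left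
  refine ⟨(fun y => g⁻¹ * y) ⁻¹' U, fun y => h (g⁻¹ * y), by simpa using h1,
    hU.isOpen.preimage hs.continuous, hU.contMDiffOn.comp hs.contMDiffOn fun x hx => hx,
    fun x hx => ?_⟩
  refine ((hU.hasMFDerivAt _ hx).comp x (hasMFDerivAt_mul_left g⁻¹ x)).congr_mfderiv
    (ContinuousLinearMap.ext fun v => ?_)
  exact leftInvariantForm_comp_mul_left p g⁻¹ x v

end LeftInvariantExact

-- Pull-back of left-invariant forms to the foliated manifold.

section Transversal

variable {n q : ℕ} {M : Type*} [TopologicalSpace M] [ChartedSpace (EuclideanSpace ℝ (Fin n)) M]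
  {G : Type*} [TopologicalSpace G] [Group G] [ChartedSpace (EuclideanSpace ℝ (Fin q)) G]
  {F : Foliation n M q} {ι : Type*}

theorem GTransversalStructure.hasMFDerivAt (S : GTransversalStructure F G ι) {i : ι} {x : M}
    (hx : x ∈ S.U i) :
    HasMFDerivAt (𝓡 n) (𝓡 q) (S.f i) x (mfderiv (𝓡 n) (𝓡 q) (S.f i) x) :=
  (((S.submersion i).contMDiffOn.contMDiffAt
    ((S.submersion i).isOpen.mem_nhds hx)).mdifferentiableAt (by simp)).hasMFDerivAt

variable [LieGroup (𝓡 q) ∞ G] {W : Type*} [NormedAddCommGroup W] [NormedSpace ℝ W]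

/-- Near `x` the two local submersions differ by a fixed left translation, as the transition is
locally constant, and the form is left-invariant. -/
theorem GTransversalStructure.leftInvariantForm_mfderiv (S : GTransversalStructure F G ι)
    (p : EuclideanSpace ℝ (Fin q) →L[ℝ] W) {i j : ι} {x : M} (hi : x ∈ S.U i) (hj : x ∈ S.U j)
    (v : TangentSpace (𝓡 n) x) :
    leftInvariantForm p (S.f i x) (mfderiv (𝓡 n) (𝓡 q) (S.f i) x v) =
      leftInvariantForm p (S.f j x) (mfderiv (𝓡 n) (𝓡 q) (S.f j) x v) := by
  have hij : IsOpen (S.U i ∩ S.U j) := (S.submersion i).isOpen.inter (S.submersion j).isOpen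
  set g := S.γ i j x with hg
  have h1 : ∀ᶠ y in 𝓝 x, S.f i y = g * S.f j y := by
    have h2 := (IsLocallyConstant.iff_eventually_eq _).1 (S.locallyConstant i j) ⟨x, hi, hj⟩
    have h3 : Filter.map Subtype.val _ = 𝓝 x :=
      hij.isOpenEmbedding_subtypeVal.map_nhds_eq ⟨x, hi, hj⟩
    rw [← h3, eventually_map]
    filter_upwards [h2] with y hy
    rw [S.compatible i j y y.2, hy]
  have h3 := ((hasMFDerivAt_mul_left g _).comp x (S.hasMFDerivAt hj)).congr_of_eventuallyEq h1
  have h4 := h3.mfderiv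
  have h5 : ∀ g' : G, g' = S.f i x → ∀ u : EuclideanSpace ℝ (Fin q),
      (leftInvariantForm p g' : EuclideanSpace ℝ (Fin q) →L[ℝ] W) u =
        leftInvariantForm p (S.f i x) u := by
    rintro _ rfl u
    rfl
  have h6 := leftInvariantForm_comp_mul_left p g (S.f j x) (mfderiv (𝓡 n) (𝓡 q) (S.f j) x v)
  refine Eq.trans ?_ h6
  exact (congrArg (leftInvariantForm p (S.f i x)) (DFunLike.congr_fun h4 v)).trans
    (h5 _ h1.self_of_nhds.symm _).symm

/-- A closed left-invariant form on `G` pulls back to `M` along the local submersions. -/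
theorem GTransversalStructure.exists_isLocallyExact [CompleteSpace W]
    (S : GTransversalStructure F G ι) {p : EuclideanSpace ℝ (Fin q) →L[ℝ] W}
    (hp : ∀ v w : GroupLieAlgebra (𝓡 q) G, p (⁅v, w⁆ : GroupLieAlgebra (𝓡 q) G) = 0)
    (hsurj : Function.Surjective p) :
    ∃ α : ∀ x : M, TangentSpace (𝓡 n) x →L[ℝ] W, IsLocallyExact α ∧
      (∀ x, Function.Surjective (α x)) ∧ (∀ x, F.tangent x ≤ (α x).toLinearMap.ker) ∧
      (Function.Injective p → ∀ x, (α x).toLinearMap.ker ≤ F.tangent x) := by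
  -- The chosen index may jump from point to point; since the pull-back does not depend on the
  -- index, a primitive near `x` can use the single submersion with index `κ x`.
  choose κ hκ using S.cover
  let α : ∀ x : M, TangentSpace (𝓡 n) x →L[ℝ] W := fun x =>
    (leftInvariantForm p (S.f (κ x) x)).comp (mfderiv (𝓡 n) (𝓡 q) (S.f (κ x)) x)
  refine ⟨α, fun x => ?_, fun x => ?_, fun x v hv => ?_, fun hinj x v hv => ?_⟩
  · obtain ⟨U, h, hx, hU⟩ := isLocallyExact_leftInvariantForm hp (S.f (κ x) x)
    have hS := S.submersion (κ x)
    refine ⟨S.U (κ x) ∩ S.f (κ x) ⁻¹' U, fun y => h (S.f (κ x) y), ⟨hκ x, hx⟩,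
      hS.contMDiffOn.continuousOn.isOpen_inter_preimage hS.isOpen hU.isOpen,
      hU.contMDiffOn.comp (hS.contMDiffOn.mono inter_subset_left) fun y hy => hy.2,
      fun y hy => ?_⟩
    refine ((hU.hasMFDerivAt _ hy.2).comp y (S.hasMFDerivAt hy.1)).congr_mfderiv
      (ContinuousLinearMap.ext fun v => ?_)
    exact S.leftInvariantForm_mfderiv p hy.1 (hκ y) v
  · exact (surjective_leftInvariantForm hsurj _).comp ((S.submersion _).surjective x (hκ x))
  · rw [← (S.submersion (κ x)).ker_eq x (hκ x)] at hv
    have h1 : mfderiv (𝓡 n) (𝓡 q) (S.f (κ x)) x v = 0 := hv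
    have h2 : α x v = leftInvariantForm p (S.f (κ x) x) (mfderiv (𝓡 n) (𝓡 q) (S.f (κ x)) x v) :=
      rfl
    rw [h1, map_zero] at h2
    exact h2
  · rw [← (S.submersion (κ x)).ker_eq x (hκ x)]
    refine injective_leftInvariantForm hinj (S.f (κ x) x) ?_
    rw [map_zero]
    exact hv

end Transversal

end

section

open Filter Topology Set

-- Coordinates on the abelianized Lie algebra.

section Abelianization

theorem derivedSeries_one_eq_bot (L : Type*) [LieRing L] [LieAlgebra ℝ L] [IsLieAbelian L] :
    LieAlgebra.derivedSeries ℝ L 1 = ⊥ := by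
  rw [LieAlgebra.derivedSeries_def, LieAlgebra.derivedSeriesOfIdeal_succ,
    LieAlgebra.derivedSeriesOfIdeal_zero, LieSubmodule.lie_eq_bot_iff]
  exact fun x _ y _ => trivial_lie_zero L L x y

/-- The map is the projection to the quotient by the derived algebra, followed by a choice of basis.
It is injective when the derived algebra is zero. -/
theorem exists_linearMap_ker_eq_derivedSeries (L : Type*) [LieRing L] [LieAlgebra ℝ L]
    [FiniteDimensional ℝ L] :
    ∃ (c : ℕ) (p : L →ₗ[ℝ] (Fin c → ℝ)), Function.Surjective p ∧ (∀ v w : L, p ⁅v, w⁆ = 0) ∧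
      c + Module.finrank ℝ (LieAlgebra.derivedSeries ℝ L 1) = Module.finrank ℝ L ∧
      (IsLieAbelian L → Function.Injective p) := by
  let D : Submodule ℝ L := (LieAlgebra.derivedSeries ℝ L 1).toSubmodule
  let e : (L ⧸ D) ≃ₗ[ℝ] (Fin (Module.finrank ℝ (L ⧸ D)) → ℝ) :=
    LinearEquiv.ofFinrankEq _ _ (by simp)
  refine ⟨Module.finrank ℝ (L ⧸ D), e.toLinearMap ∘ₗ D.mkQ,
    e.surjective.comp D.mkQ_surjective, fun v w => ?_, D.finrank_quotient_add_finrank,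
    fun h => e.injective.comp ?_⟩
  · have h1 : ⁅v, w⁆ ∈ D := by
      change ⁅v, w⁆ ∈ LieAlgebra.derivedSeries ℝ L 1
      rw [LieAlgebra.derivedSeries_def, LieAlgebra.derivedSeriesOfIdeal_succ,
        LieAlgebra.derivedSeriesOfIdeal_zero]
      exact LieSubmodule.lie_mem_lie (LieSubmodule.mem_top v) (LieSubmodule.mem_top w)
    rw [LinearMap.comp_apply, Submodule.mkQ_apply, (Submodule.Quotient.mk_eq_zero D).2 h1,
      map_zero]
  · refine LinearMap.ker_eq_bot.1 ?_
    rw [Submodule.ker_mkQ]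
    exact congrArg LieSubmodule.toSubmodule (derivedSeries_one_eq_bot L)

variable {n q : ℕ} {M : Type*} [TopologicalSpace M] [ChartedSpace (EuclideanSpace ℝ (Fin n)) M]
  {G : Type*} [TopologicalSpace G] [Group G] [ChartedSpace (EuclideanSpace ℝ (Fin q)) G]
  [LieGroup (𝓡 q) ∞ G] {F : Foliation n M q} {ι : Type*}

theorem finrank_groupLieAlgebra (G : Type*) [TopologicalSpace G] [Group G]
    [ChartedSpace (EuclideanSpace ℝ (Fin q)) G] [LieGroup (𝓡 q) ∞ G] :
    Module.finrank ℝ (GroupLieAlgebra (𝓡 q) G) = q := by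
  have : Module.finrank ℝ (EuclideanSpace ℝ (Fin q)) = q := by simp
  exact this

theorem GTransversalStructure.exists_isLocallyExact_finrank (S : GTransversalStructure F G ι) :
    ∃ (c : ℕ) (α : ∀ x : M, TangentSpace (𝓡 n) x →L[ℝ] (Fin c → ℝ)),
      c + Module.finrank ℝ (LieAlgebra.derivedSeries ℝ (GroupLieAlgebra (𝓡 q) G) 1) =
        Module.finrank ℝ (GroupLieAlgebra (𝓡 q) G) ∧
      IsLocallyExact α ∧ (∀ x, Function.Surjective (α x)) ∧
      (∀ x, F.tangent x ≤ (α x).toLinearMap.ker) ∧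
      (IsLieAbelian (GroupLieAlgebra (𝓡 q) G) →
        ∀ x, (α x).toLinearMap.ker ≤ F.tangent x) := by
  have : FiniteDimensional ℝ (GroupLieAlgebra (𝓡 q) G) :=
    inferInstanceAs (FiniteDimensional ℝ (EuclideanSpace ℝ (Fin q)))
  obtain ⟨c, p, hsurj, hp, hc, hinj⟩ :=
    exists_linearMap_ker_eq_derivedSeries (GroupLieAlgebra (𝓡 q) G)
  let p' : EuclideanSpace ℝ (Fin q) →ₗ[ℝ] (Fin c → ℝ) := p
  obtain ⟨α, h1, h2, h3, h4⟩ := S.exists_isLocallyExact (p := LinearMap.toContinuousLinearMap p')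
    hp hsurj
  exact ⟨c, α, hc, h1, h2, h3, fun h => h4 (hinj h)⟩

end Abelianization

end

-- The main theorem.

theorem mainTheorem4 {n q : ℕ} {M : Type*} [TopologicalSpace M] [T2Space M] [CompactSpace M]
    [Nonempty M] [ChartedSpace (EuclideanSpace ℝ (Fin n)) M] [IsManifold (𝓡 n) ∞ M]
    {G : Type*} [TopologicalSpace G] [Group G] [ChartedSpace (EuclideanSpace ℝ (Fin q)) G]
    [LieGroup (𝓡 q) ∞ G]
    (F : Foliation n M q) {ι : Type*} (S : GTransversalStructure F G ι)
    (d : ℕ) (hd : Module.rank ℝ (DeRhamH1 n M) = d) :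
    (d + Module.finrank ℝ (LieAlgebra.derivedSeries ℝ (GroupLieAlgebra (𝓡 q) G) 1) ≤
        Module.finrank ℝ (GroupLieAlgebra (𝓡 q) G) →
      d + Module.finrank ℝ (LieAlgebra.derivedSeries ℝ (GroupLieAlgebra (𝓡 q) G) 1) =
        Module.finrank ℝ (GroupLieAlgebra (𝓡 q) G) ∧
      ∃ f : M → Torus d, IsSmoothTorusFibration (n := n) f ∧ ∀ x, F.leaf x ⊆ f ⁻¹' {f x}) ∧
    (IsLieAbelian (GroupLieAlgebra (𝓡 q) G) →
      d ≤ Module.finrank ℝ (GroupLieAlgebra (𝓡 q) G) →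
      (ConnectedSpace M ∨ 0 < q) →
      ∃ f : M → Torus d, IsSmoothTorusFibration (n := n) f ∧ ∀ x, F.leaf x = f ⁻¹' {f x}) := by
  obtain ⟨c, α, hc, hα, hsurj, hle, hge⟩ := S.exists_isLocallyExact_finrank
  have hcd : c ≤ d := hα.le_of_rank_eq hsurj hd
  refine ⟨fun h => ?_, fun hab hdq hconn => ?_⟩
  · obtain rfl : d = c := by omega
    refine ⟨hc, ?_⟩
    -- For `d = 0` the manifold may be disconnected, and the constant map to the one-point torus
    -- serves. For `d > 0` connectedness is automatic.
    obtain rfl | hpos := Nat.eq_zero_or_pos d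
    · have hlift : IsLocalLift (n := n) (fun _ : M => (torusExp 0 : Torus 0)) Set.univ
          (fun _ => 0) :=
        ⟨isOpen_univ, contMDiffOn_const, fun _ _ => rfl, fun _ _ w => ⟨0, Subsingleton.elim (α := Fin 0 → ℝ) _ _⟩⟩
      have hf : IsTorusSubmersion (n := n) (fun _ : M => (torusExp 0 : Torus 0)) :=
        fun x => ⟨_, _, Set.mem_univ x, hlift⟩
      exact ⟨_, hf.isSmoothTorusFibration, fun _ _ _ => rfl⟩
    · have := hα.preconnectedSpace hsurj hd hpos
      obtain ⟨f, hf, -⟩ := hα.exists_isLocalLift hsurj hd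
      have hf' : IsTorusSubmersion (n := n) f := fun x => by
        obtain ⟨U, h, hx, hU, -⟩ := hf x
        exact ⟨U, h, hx, hU⟩
      refine ⟨f, hf'.isSmoothTorusFibration, Foliation.leaf_subset_fibre fun x => ?_⟩
      obtain ⟨U, h, hx, hU, hker⟩ := hf x
      exact ⟨U, h, hx, hU, fun y hy => (hle y).trans (hker y hy).ge⟩
  · have hD : Module.finrank ℝ (LieAlgebra.derivedSeries ℝ (GroupLieAlgebra (𝓡 q) G) 1) = 0 := by
      rw [derivedSeries_one_eq_bot]
      exact finrank_bot ℝ (GroupLieAlgebra (𝓡 q) G)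
    have hq := finrank_groupLieAlgebra (q := q) G
    obtain rfl : d = c := by omega
    -- In the abelian case `d = q`, so a positive `q` yields connectedness from the form, and `q =
    -- 0` is the case where it is assumed.
    have : PreconnectedSpace M := hconn.elim (fun h => h.toPreconnectedSpace)
      fun hpos => hα.preconnectedSpace hsurj hd (by omega)
    obtain ⟨f, hf, hfib⟩ := hα.exists_isLocalLift hsurj hd
    have hf' : IsTorusSubmersion (n := n) f := fun x => by
      obtain ⟨U, h, hx, hU, -⟩ := hf x
      exact ⟨U, h, hx, hU⟩
    refine ⟨f, hf'.isSmoothTorusFibration, fun x => Set.Subset.antisymm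
      (Foliation.leaf_subset_fibre (fun x => ?_) x) fun y hy => ?_⟩
    · obtain ⟨U, h, hx, hU, hker⟩ := hf x
      exact ⟨U, h, hx, hU, fun y hy => (hle y).trans (hker y hy).ge⟩
    · refine Relation.ReflTransGen.mono (fun a b hab' => ?_) _ _ (hfib x y (Eq.symm hy))
      refine hab'.joinedByTangentPath fun x => ?_
      obtain ⟨U, h, hx, hU, hker⟩ := hf x
      exact ⟨U, h, hx, hU, fun y hy => (hker y hy).le.trans (hge hab y)⟩
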